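/- Let $\Bbbk$ be a commutative ring. A graded supercategory is a $\Bbbk$-linear category whose morphism modules are graded by $\mathbb Z\oplus\mathbb Z/2$ (degree, parity), with identities of degree $0$ and even, and with degrees and parities adding under composition. A graded superfunctor is a $\Bbbk$-linear functor preserving degrees and parities. A supernatural transformation $x:F\Rightarrow G$ of degree $n$ and parity $p$ is a family of morphisms $x_\lambda:F\lambda\to G\lambda$ of degree $n$ and parity $p$ with $x_\mu\circ Ff=(-1)^{p|f|}\,Gf\circ x_\lambda$ for all homogeneous $f:\lambda\to\mu$. Juxtaposition denotes horizontal composition, $(yx)_\lambda=y_{H\lambda}\circ Gx_\lambda$ for $x:F\Rightarrow H$ and $y:G\Rightarrow K$. A graded $(Q,\Pi)$-supercategory is a graded supercategory $\mathcal A$ with graded superfunctors $Q,Q^{-1},\Pi:\mathcal A\to\mathcal A$, an odd supernatural isomorphism $\zeta:\Pi\Rightarrow I$ of degree $0$, and even supernatural isomorphisms $\sigma:Q\Rightarrow I$ and $\bar\sigma:Q^{-1}\Rightarrow I$ of degrees $-1$ and $1$. Let $(Q,\Pi)\text{-}\underline{\mathfrak{GSCat}}$ be the strict 2-category of graded $(Q,\Pi)$-supercategories,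 (arbitrary) graded superfunctors, and even supernatural transformations of degree $0$. A $(Q,\Pi)$-category is a $\Bbbk$-linear category $\mathcal A$ with $\Bbbk$-linear endofunctors $\Pi,Q,Q^{-1}$ and natural isomorphisms $\xi:\Pi^2\Rightarrow I$, $\imath:Q^{-1}Q\Rightarrow I$, $\jmath:QQ^{-1}\Rightarrow I$, $\beta_Q:\Pi Q\Rightarrow Q\Pi$ such that $\xi\Pi=\Pi\xi$, $\imath^{-1}$ and $\jmath$ are unit and counit of an adjunction $(Q,Q^{-1})$, and $\xi Q\xi^{-1}=\beta_Q\Pi\circ\Pi\beta_Q$. A $(Q,\Pi)$-functor $F:\mathcal A\to\mathcal A'$ is a $\Bbbk$-linear functor with natural isomorphisms $\beta_F:\Pi'F\Rightarrow F\Pi$ and $\gamma_F:Q'F\Rightarrow FQ$ such that $$\xi'F\xi^{-1}=\beta_F\Pi\circ\Pi'\beta_F,\qquad F\beta_Q\circ\beta_FQ\circ\Pi'\gamma_F=\gamma_F\Pi\circ Q'\beta_F\circ\beta_{Q'}F .$$ A $(Q,\Pi)$-natural transformation $x:F\Rightarrow G$ is a natural transformation with $x\Pi\circ\beta_F=\beta_G\circ\Pi'x$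 and $xQ\circ\gamma_F=\gamma_G\circ Q'x$. With $\beta_I=1$, $\gamma_I=1$, $\beta_{GF}=G\beta_F\circ\beta_GF$ and $\gamma_{GF}=G\gamma_F\circ\gamma_GF$ these form a strict 2-category $(Q,\Pi)\text{-}\mathfrak{Cat}$. There is a strict 2-functor $$\mathbb E:(Q,\Pi)\text{-}\underline{\mathfrak{GSCat}}\to(Q,\Pi)\text{-}\mathfrak{Cat}$$ sending $\mathcal A$ to its underlying category $\underline{\mathcal A}$ (same objects, even morphisms of degree $0$) with the restrictions of $\Pi,Q,Q^{-1}$ and with $\xi=\zeta\zeta$, $\imath=\bar\sigma\sigma$, $\jmath=\sigma\bar\sigma$, $\beta_Q=-\zeta Q\zeta^{-1}$; sending a graded superfunctor $F$ to its restriction $\underline F$ with $\beta_F=-\zeta'F\zeta^{-1}$ and $\gamma_F=\sigma'F\sigma^{-1}$; and sending $x$ to $\underline x$ with $\underline x_\lambda=x_\lambda$. **Theorem.** $\mathbb E$ is a 2-equivalence: there is a 2-functor (pseudofunctor) $\mathbb D:(Q,\Pi)\text{-}\mathfrak{Cat}\to(Q,\Pi)\text{-}\underline{\mathfrak{GSCat}}$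 such that $\mathbb E\circ\mathbb D$ and $\mathbb D\circ\mathbb E$ are equivalent to the identity 2-functors in the respective 2-categories of 2-functors, strong (pseudonatural) transformations and modifications. -/

import Mathlib

open CategoryTheory
open scoped Bicategory Pseudofunctor.StrongTrans

universe w w₁ w₂ v v₁ v₂ u u₁ u₂

namespace QPi

noncomputable section

/-! ## Graded supercategories -/

/-- A graded supercategory over `k`: a `k`-linear category whose morphism modules are graded by
`ℤ × ℤ/2` (degree, parity), with identities even of degree zero and composition additive on
degrees and parities. -/
class GradedSupercategory (k : Type w) [CommRing k] (C : Type u) [Category.{v} C]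
    [Preadditive C] [Linear k C] where
  /-- `homog X Y (n, p)` consists of the morphisms of degree `n` and parity `p`. -/
  homog : ∀ X Y : C, ℤ × ZMod 2 → Submodule k (X ⟶ Y)
  isInternal : ∀ X Y : C, DirectSum.IsInternal (homog X Y)
  id_mem : ∀ X : C, 𝟙 X ∈ homog X X 0
  comp_mem : ∀ {X Y Z : C} {i j : ℤ × ZMod 2} {f : X ⟶ Y} {g : Y ⟶ Z},
    f ∈ homog X Y i → g ∈ homog Y Z j → f ≫ g ∈ homog X Z (i + j)

/-- The submodule of homogeneous morphisms of given degree and parity. -/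
abbrev homog (k : Type w) [CommRing k] {C : Type u} [Category.{v} C]
    [Preadditive C] [Linear k C] [GradedSupercategory k C] (X Y : C) (i : ℤ × ZMod 2) :
    Submodule k (X ⟶ Y) :=
  GradedSupercategory.homog X Y i

/-- A graded superfunctor: a `k`-linear functor preserving degrees and parities of morphisms. -/
structure IsGradedSuperfunctor (k : Type w) [CommRing k]
    {C : Type u₁} [Category.{v₁} C] [Preadditive C] [Linear k C] [GradedSupercategory k C]
    {D : Type u₂} [Category.{v₂} D] [Preadditive D] [Linear k D] [GradedSupercategory k D]
    (F : C ⥤ D) : Prop where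
  additive : F.Additive
  linear : F.Linear k
  map_mem : ∀ {X Y : C} {i : ℤ × ZMod 2} {f : X ⟶ Y},
    f ∈ homog k X Y i → F.map f ∈ homog k (F.obj X) (F.obj Y) i

/-- `x` is a supernatural transformation `F ⇒ G` that is homogeneous of degree `n` and
parity `p`: `x_Y ∘ F f = (-1)^{p|f|} G f ∘ x_X`. -/
structure IsSupernatural (k : Type w) [CommRing k]
    {C : Type u₁} [Category.{v₁} C] [Preadditive C] [Linear k C] [GradedSupercategory k C]
    {D : Type u₂} [Category.{v₂} D] [Preadditive D] [Linear k D] [GradedSupercategory k D]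
    (F G : C ⥤ D) (n : ℤ) (p : ZMod 2) (x : ∀ X, F.obj X ⟶ G.obj X) : Prop where
  mem : ∀ X, x X ∈ homog k (F.obj X) (G.obj X) (n, p)
  comm : ∀ {X Y : C} {m : ℤ} {q : ZMod 2} {f : X ⟶ Y}, f ∈ homog k X Y (m, q) →
    F.map f ≫ x Y = (-1 : ℤ) ^ (p.val * q.val) • (x X ≫ G.map f)

lemma IsSupernatural.of_natural {k : Type w} [CommRing k]
    {C : Type u₁} [Category.{v₁} C] [Preadditive C] [Linear k C] [GradedSupercategory k C]
    {D : Type u₂} [Category.{v₂} D] [Preadditive D] [Linear k D] [GradedSupercategory k D]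
    {F G : C ⥤ D} {x : ∀ X, F.obj X ⟶ G.obj X}
    (hx : ∀ X, x X ∈ homog k (F.obj X) (G.obj X) 0)
    (h : ∀ {X Y : C} (f : X ⟶ Y), F.map f ≫ x Y = x X ≫ G.map f) :
    IsSupernatural k F G 0 0 x where
  mem := hx
  comm {X Y m q f} _ := by simp [h f]

section Homogeneous

variable {k : Type w} [CommRing k] {C : Type u} [Category.{v} C]
    [Preadditive C] [Linear k C] [GradedSupercategory k C]

lemma hom_induction {X Y : C} {P : (X ⟶ Y) → Prop} (h0 : P 0)
    (hadd : ∀ f g, P f → P g → P (f + g)) (hh : ∀ i, ∀ f ∈ homog k X Y i, P f)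
    (f : X ⟶ Y) : P f := by
  have hf : f ∈ iSup (homog k X Y) := by
    rw [(GradedSupercategory.isInternal (k := k) X Y).submodule_iSup_eq_top]
    trivial
  exact Submodule.iSup_induction _ (motive := P) hf hh h0 hadd

/-- The inverse of a homogeneous isomorphism is homogeneous. -/
lemma inv_mem {X Y : C} (e : X ≅ Y) {i : ℤ × ZMod 2} (he : e.hom ∈ homog k X Y i) :
    e.inv ∈ homog k Y X (-i) := by
  classical
  let d1 := (GradedSupercategory.isInternal (k := k) Y X).chooseDecomposition
  let d2 := (GradedSupercategory.isInternal (k := k) X X).chooseDecomposition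
  have key : ∀ g : Y ⟶ X,
      ((DirectSum.decompose (homog k X X) (e.hom ≫ g)) 0 : X ⟶ X) =
        e.hom ≫ ((DirectSum.decompose (homog k Y X) g) (-i) : Y ⟶ X) := by
    intro g
    refine hom_induction (k := k) (P := fun g =>
      ((DirectSum.decompose (homog k X X) (e.hom ≫ g)) 0 : X ⟶ X) =
        e.hom ≫ ((DirectSum.decompose (homog k Y X) g) (-i) : Y ⟶ X)) ?_ (fun f g hf hg => ?_) (fun j g hg => ?_) g
    · simp
    · simp only [Preadditive.comp_add, DirectSum.decompose_add, DirectSum.add_apply,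
        Submodule.coe_add, hf, hg]
    · have hc := GradedSupercategory.comp_mem he hg
      by_cases hj : j = -i
      · subst hj
        rw [add_neg_cancel] at hc
        rw [DirectSum.decompose_of_mem_same _ hc, DirectSum.decompose_of_mem_same _ hg]
      · rw [DirectSum.decompose_of_mem_ne _ hc, DirectSum.decompose_of_mem_ne _ hg hj,
          Limits.comp_zero]
        intro h
        exact hj (eq_neg_of_add_eq_zero_right h)
  have h1 := key e.inv
  rw [e.hom_inv_id,
    DirectSum.decompose_of_mem_same _ (GradedSupercategory.id_mem (k := k) X)] at h1
  have h2 : e.inv = ((DirectSum.decompose (homog k Y X) e.inv) (-i) : Y ⟶ X) := by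
    rw [← cancel_epi e.hom, ← h1, e.hom_inv_id]
  rw [h2]
  exact SetLike.coe_mem _

end Homogeneous

/-! ### The underlying category -/

/-- The underlying category of a graded supercategory: same objects, but only the even morphisms
of degree zero. -/
structure Underlying (k : Type w) [CommRing k] (C : Type u) : Type u where
  /-- An object of the graded supercategory, viewed in its underlying category. -/
  of ::
  /-- The corresponding object of the graded supercategory. -/
  as : C

namespace Underlying

variable {k : Type w} [CommRing k] {C : Type u} [Category.{v} C]
    [Preadditive C] [Linear k C] [GradedSupercategory k C]

instance : Category.{v} (Underlying k C) where
  Hom X Y := homog k X.as Y.as 0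
  id X := ⟨𝟙 X.as, GradedSupercategory.id_mem X.as⟩
  comp f g := ⟨f.1 ≫ g.1, by simpa using GradedSupercategory.comp_mem f.2 g.2⟩
  id_comp f := Subtype.ext (Category.id_comp f.1)
  comp_id f := Subtype.ext (Category.comp_id f.1)
  assoc f g h := Subtype.ext (Category.assoc f.1 g.1 h.1)

instance : Preadditive (Underlying k C) where
  homGroup X Y := inferInstanceAs (AddCommGroup (homog k X.as Y.as 0))
  add_comp _ _ _ f f' g := Subtype.ext (Preadditive.add_comp _ _ _ f.1 f'.1 g.1)
  comp_add _ _ _ f g g' := Subtype.ext (Preadditive.comp_add _ _ _ f.1 g.1 g'.1)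

instance : Linear k (Underlying k C) where
  homModule X Y := inferInstanceAs (Module k (homog k X.as Y.as 0))
  smul_comp _ _ _ r f g := Subtype.ext (Linear.smul_comp _ _ _ r f.1 g.1)
  comp_smul _ _ _ f r g := Subtype.ext (Linear.comp_smul _ _ _ f.1 r g.1)

/-- The morphism of the ambient graded supercategory underlying a morphism of its underlying
category. -/
def val {X Y : Underlying k C} (f : X ⟶ Y) : X.as ⟶ Y.as := f.1

lemma val_mem {X Y : Underlying k C} (f : X ⟶ Y) : val f ∈ homog k X.as Y.as 0 := f.2

/-- An even morphism of degree zero, viewed in the underlying category. -/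
def mk {X Y : Underlying k C} (f : X.as ⟶ Y.as) (hf : f ∈ homog k X.as Y.as 0) : X ⟶ Y :=
  ⟨f, hf⟩

@[simp] lemma val_mk {X Y : Underlying k C} (f : X.as ⟶ Y.as) (hf : f ∈ homog k X.as Y.as 0) :
    val (mk f hf : X ⟶ Y) = f := rfl

@[simp] lemma val_id (X : Underlying k C) : val (𝟙 X) = 𝟙 X.as := rfl

@[simp] lemma val_comp {X Y Z : Underlying k C} (f : X ⟶ Y) (g : Y ⟶ Z) :
    val (f ≫ g) = val f ≫ val g := rfl

lemma hom_ext {X Y : Underlying k C} {f g : X ⟶ Y} (h : val f = val g) : f = g :=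
  Subtype.ext h

/-- An even isomorphism of degree zero gives an isomorphism in the underlying category. -/
def isoMk {X Y : Underlying k C} (e : X.as ≅ Y.as) (he : e.hom ∈ homog k X.as Y.as 0) :
    X ≅ Y where
  hom := mk e.hom he
  inv := mk e.inv (by simpa using inv_mem e he)
  hom_inv_id := hom_ext e.hom_inv_id
  inv_hom_id := hom_ext e.inv_hom_id

@[simp] lemma val_isoMk_hom {X Y : Underlying k C} (e : X.as ≅ Y.as)
    (he : e.hom ∈ homog k X.as Y.as 0) : val (isoMk e he : X ≅ Y).hom = e.hom := rfl

@[simp] lemma val_isoMk_inv {X Y : Underlying k C} (e : X.as ≅ Y.as)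
    (he : e.hom ∈ homog k X.as Y.as 0) : val (isoMk e he : X ≅ Y).inv = e.inv := rfl

variable {D : Type u₂} [Category.{v₂} D] [Preadditive D] [Linear k D]
  [GradedSupercategory k D]

/-- The restriction of a graded superfunctor to the underlying categories. -/
def functor (F : C ⥤ D) (hF : IsGradedSuperfunctor k F) :
    Underlying k C ⥤ Underlying k D where
  obj X := of (F.obj X.as)
  map f := mk (F.map (val f)) (hF.map_mem (val_mem f))
  map_id X := hom_ext (F.map_id X.as)
  map_comp f g := hom_ext (F.map_comp (val f) (val g))

@[simp] lemma functor_obj_as (F : C ⥤ D) (hF : IsGradedSuperfunctor k F)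
    (X : Underlying k C) : ((functor F hF).obj X).as = F.obj X.as := rfl

@[simp] lemma val_functor_map (F : C ⥤ D) (hF : IsGradedSuperfunctor k F)
    {X Y : Underlying k C} (f : X ⟶ Y) :
    val ((functor F hF).map f) = F.map (val f) := rfl

lemma functor_additive (F : C ⥤ D) (hF : IsGradedSuperfunctor k F) :
    (functor F hF).Additive where
  map_add {_ _ f g} := hom_ext (by have := hF.additive; exact F.map_add (f := val f) (g := val g))

lemma functor_linear (F : C ⥤ D) (hF : IsGradedSuperfunctor k F) :
    (functor F hF).Linear k where
  map_smul f r := hom_ext (by have := hF.linear; exact F.map_smul r (val f))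

end Underlying

/-! ## The 2-category of graded `(Q, Π)`-supercategories -/

/-- A graded `(Q, Π)`-supercategory: a graded supercategory with graded superfunctors
`Q`, `Q⁻¹`, `Π`, an odd supernatural isomorphism `ζ : Π ⇒ I` of degree `0` and even supernatural
isomorphisms `σ : Q ⇒ I`, `σ' : Q⁻¹ ⇒ I` of degrees `-1` and `1`. -/
structure QPSupercat (k : Type w) [CommRing k] where
  carrier : Type u
  [cat : Category.{v} carrier]
  [preadditive : Preadditive carrier]
  [linear : Linear k carrier]
  [graded : GradedSupercategory k carrier]
  Q : carrier ⥤ carrier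
  Qinv : carrier ⥤ carrier
  P : carrier ⥤ carrier
  hQ : IsGradedSuperfunctor k Q
  hQinv : IsGradedSuperfunctor k Qinv
  hP : IsGradedSuperfunctor k P
  ζ : ∀ X, P.obj X ≅ X
  σ : ∀ X, Q.obj X ≅ X
  σ' : ∀ X, Qinv.obj X ≅ X
  hζ : IsSupernatural k P (𝟭 carrier) 0 1 fun X => (ζ X).hom
  hσ : IsSupernatural k Q (𝟭 carrier) (-1) 0 fun X => (σ X).hom
  hσ' : IsSupernatural k Qinv (𝟭 carrier) 1 0 fun X => (σ' X).hom

attribute [instance] QPSupercat.cat QPSupercat.preadditive QPSupercat.linear QPSupercat.graded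

/-- Graded superfunctors between graded `(Q, Π)`-supercategories; no compatibility with `Q`, `Π`
is required. -/
@[ext]
structure GSFunctor {k : Type w} [CommRing k] (A B : QPSupercat.{w, v, u} k) where
  functor : A.carrier ⥤ B.carrier
  isSuper : IsGradedSuperfunctor k functor

/-- Even supernatural transformations of degree zero. -/
@[ext]
structure GSTrans {k : Type w} [CommRing k] {A B : QPSupercat.{w, v, u} k}
    (F G : GSFunctor A B) where
  app : ∀ X, F.functor.obj X ⟶ G.functor.obj X
  isSupernatural : IsSupernatural k F.functor G.functor 0 0 app

section Supercat

variable {k : Type w} [CommRing k]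

lemma isSupernatural_id {A B : QPSupercat.{w, v, u} k} (F : GSFunctor A B) :
    IsSupernatural k F.functor F.functor 0 0 fun X => 𝟙 (F.functor.obj X) where
  mem X := GradedSupercategory.id_mem _
  comm _ := by simp

lemma isSupernatural_comp {A B : QPSupercat.{w, v, u} k} {F G H : GSFunctor A B}
    (x : GSTrans F G) (y : GSTrans G H) :
    IsSupernatural k F.functor H.functor 0 0 fun X => x.app X ≫ y.app X where
  mem X := by
    simpa using GradedSupercategory.comp_mem (x.isSupernatural.mem X) (y.isSupernatural.mem X)
  comm hf := by
    have h1 := x.isSupernatural.comm hf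
    have h2 := y.isSupernatural.comm hf
    simp only [ZMod.val_zero, zero_mul, pow_zero, one_smul] at h1 h2 ⊢
    rw [← Category.assoc, h1, Category.assoc, h2, Category.assoc]

/-- An even supernatural transformation of degree zero is natural with respect to all
morphisms. -/
lemma GSTrans.naturality {A B : QPSupercat.{w, v, u} k} {F G : GSFunctor A B} (x : GSTrans F G)
    {X Y : A.carrier} (f : X ⟶ Y) :
    F.functor.map f ≫ x.app Y = x.app X ≫ G.functor.map f := by
  have := F.isSuper.additive
  have := G.isSuper.additive
  refine hom_induction (k := k)
    (P := fun f => F.functor.map f ≫ x.app Y = x.app X ≫ G.functor.map f) ?_ (fun f g hf hg => ?_) (fun i f hf => ?_) f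
  · simp
  · simp [hf, hg]
  · have := x.isSupernatural.comm (m := i.1) (q := i.2) hf
    simpa using this

instance (A B : QPSupercat.{w, v, u} k) : Category (GSFunctor A B) where
  Hom F G := GSTrans F G
  id F := ⟨_, isSupernatural_id F⟩
  comp x y := ⟨_, isSupernatural_comp x y⟩

@[ext]
lemma GSTrans.hom_ext {A B : QPSupercat.{w, v, u} k} {F G : GSFunctor A B} {x y : F ⟶ G}
    (h : ∀ X, GSTrans.app x X = GSTrans.app y X) : x = y :=
  GSTrans.ext (funext h)

@[simp] lemma GSTrans.id_app {A B : QPSupercat.{w, v, u} k} (F : GSFunctor A B) (X) :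
    GSTrans.app (𝟙 F) X = 𝟙 (F.functor.obj X) := rfl

@[simp] lemma GSTrans.comp_app {A B : QPSupercat.{w, v, u} k} {F G H : GSFunctor A B}
    (x : F ⟶ G) (y : G ⟶ H) (X) :
    GSTrans.app (x ≫ y) X = GSTrans.app x X ≫ GSTrans.app y X := rfl

/-- The identity graded superfunctor. -/
def GSFunctor.id (A : QPSupercat.{w, v, u} k) : GSFunctor A A where
  functor := 𝟭 _
  isSuper := { additive := inferInstance, linear := inferInstance, map_mem := fun h => h }

/-- Composition of graded superfunctors, in diagrammatic order. -/
def GSFunctor.comp {A B C : QPSupercat.{w, v, u} k} (F : GSFunctor A B) (G : GSFunctor B C) :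
    GSFunctor A C where
  functor := F.functor ⋙ G.functor
  isSuper :=
    { additive := by have := F.isSuper.additive; have := G.isSuper.additive; infer_instance
      linear := by have := F.isSuper.linear; have := G.isSuper.linear; infer_instance
      map_mem := fun h => G.isSuper.map_mem (F.isSuper.map_mem h) }

/-- `Gx` for a superfunctor `G` and a transformation `x`. -/
def GSTrans.postcomp {A B C : QPSupercat.{w, v, u} k} {F G : GSFunctor A B} (x : F ⟶ G)
    (H : GSFunctor B C) : F.comp H ⟶ G.comp H where
  app X := H.functor.map (GSTrans.app x X)
  isSupernatural := .of_natural (fun X => H.isSuper.map_mem (x.isSupernatural.mem X))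
    (fun f => by
      have := congrArg H.functor.map (GSTrans.naturality x f)
      simpa [GSFunctor.comp] using this)

/-- `xF` for a superfunctor `F` and a transformation `x`. -/
def GSTrans.precomp {A B C : QPSupercat.{w, v, u} k} (F : GSFunctor A B)
    {G H : GSFunctor B C} (x : G ⟶ H) : F.comp G ⟶ F.comp H where
  app X := GSTrans.app x (F.functor.obj X)
  isSupernatural := .of_natural (fun _ => x.isSupernatural.mem _)
    (fun f => GSTrans.naturality x (F.functor.map f))

/-- The strict 2-category of graded `(Q, Π)`-supercategories, graded superfunctors and even
supernatural transformations of degree zero. -/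
instance : Bicategory (QPSupercat.{w, v, u} k) where
  Hom A B := GSFunctor A B
  homCategory A B := inferInstanceAs (Category (GSFunctor A B))
  id A := GSFunctor.id A
  comp F G := GSFunctor.comp F G
  whiskerLeft F _ _ x := GSTrans.precomp F x
  whiskerRight x H := GSTrans.postcomp x H
  associator F G H := Iso.refl (GSFunctor.comp F (GSFunctor.comp G H))
  leftUnitor F := Iso.refl F
  rightUnitor F := Iso.refl F
  whisker_exchange x y := by
    apply GSTrans.hom_ext
    intro X
    exact (GSTrans.naturality y (GSTrans.app x X)).symm
  whiskerLeft_id _ _ := rfl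
  whiskerLeft_comp _ _ _ _ _ _ := rfl
  id_whiskerLeft x := by
    apply GSTrans.hom_ext; intro X
    exact ((Category.id_comp _).trans (Category.comp_id _)).symm
  comp_whiskerLeft F G _ _ x := by
    apply GSTrans.hom_ext; intro X
    exact ((Category.id_comp _).trans (Category.comp_id _)).symm
  id_whiskerRight _ G := by
    apply GSTrans.hom_ext; intro X
    exact G.functor.map_id _
  comp_whiskerRight x y H := by
    apply GSTrans.hom_ext; intro X
    exact H.functor.map_comp _ _
  whiskerRight_id x := by
    apply GSTrans.hom_ext; intro X
    exact ((Category.id_comp _).trans (Category.comp_id _)).symm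
  whiskerRight_comp x G H := by
    apply GSTrans.hom_ext; intro X
    exact ((Category.id_comp _).trans (Category.comp_id _)).symm
  whisker_assoc F _ _ x H := by
    apply GSTrans.hom_ext; intro X
    exact ((Category.id_comp _).trans (Category.comp_id _)).symm
  pentagon F G H K := by
    apply GSTrans.hom_ext; intro X
    change K.functor.map (𝟙 _) ≫ 𝟙 _ ≫ 𝟙 _ = 𝟙 _ ≫ 𝟙 _
    simp
  triangle F G := by
    apply GSTrans.hom_ext; intro X
    change 𝟙 _ ≫ 𝟙 _ = G.functor.map (𝟙 _)
    simp

instance : Bicategory.Strict (QPSupercat.{w, v, u} k) where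
  id_comp _ := rfl
  comp_id _ := rfl
  assoc _ _ _ := rfl
  leftUnitor_eqToIso _ := rfl
  rightUnitor_eqToIso _ := rfl
  associator_eqToIso _ _ _ := rfl

end Supercat

/-! ## The 2-category of `(Q, Π)`-categories -/

/-- A `(Q, Π)`-category. The adjoint pair of autoequivalences `(Q, Q⁻¹)` with unit `ı⁻¹` and
counit `ȷ` is the equivalence `Q`, so `ı = Q.unitIso.symm` and `ȷ = Q.counitIso`. -/
structure QPCat (k : Type w) [CommRing k] where
  carrier : Type u
  [cat : Category.{v} carrier]
  [preadditive : Preadditive carrier]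
  [linear : Linear k carrier]
  P : carrier ⥤ carrier
  P_additive : P.Additive
  P_linear : P.Linear k
  /-- `ξ : Π² ⇒ I` -/
  ξ : P ⋙ P ≅ 𝟭 carrier
  /-- `ξ Π = Π ξ` -/
  ξ_comm : ∀ X, ξ.hom.app (P.obj X) = P.map (ξ.hom.app X)
  Q : carrier ≌ carrier
  Q_additive : Q.functor.Additive
  Q_linear : Q.functor.Linear k
  /-- `β_Q : Π Q ⇒ Q Π` -/
  βQ : Q.functor ⋙ P ≅ P ⋙ Q.functor
  /-- `ξ Q ξ⁻¹ = β_Q Π ∘ Π β_Q` -/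
  βQ_ξ : ∀ X, ξ.hom.app (Q.functor.obj X) ≫ Q.functor.map (ξ.inv.app X) =
    P.map (βQ.hom.app X) ≫ βQ.hom.app (P.obj X)

attribute [instance] QPCat.cat QPCat.preadditive QPCat.linear

/-- A `(Q, Π)`-functor. -/
structure QPFunctor {k : Type w} [CommRing k] (A B : QPCat.{w, v, u} k) where
  functor : A.carrier ⥤ B.carrier
  additive : functor.Additive
  linear : functor.Linear k
  /-- `β_F : Π' F ⇒ F Π` -/
  β : functor ⋙ B.P ≅ A.P ⋙ functor
  /-- `γ_F : Q' F ⇒ F Q` -/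
  γ : functor ⋙ B.Q.functor ≅ A.Q.functor ⋙ functor
  /-- `ξ' F ξ⁻¹ = β_F Π ∘ Π' β_F` -/
  β_ξ : ∀ X, B.ξ.hom.app (functor.obj X) ≫ functor.map (A.ξ.inv.app X) =
    B.P.map (β.hom.app X) ≫ β.hom.app (A.P.obj X)
  /-- `F β_Q ∘ β_F Q ∘ Π' γ_F = γ_F Π ∘ Q' β_F ∘ β_{Q'} F`, i.e. `γ_F : Q' F ⇒ F Q` is
  compatible with the isomorphisms `β` of `Q' F` and `F Q`. -/
  β_γ : ∀ X, B.P.map (γ.hom.app X) ≫ β.hom.app (A.Q.functor.obj X) ≫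
      functor.map (A.βQ.hom.app X) =
    B.βQ.hom.app (functor.obj X) ≫ B.Q.functor.map (β.hom.app X) ≫ γ.hom.app (A.P.obj X)

/-- A `(Q, Π)`-natural transformation. -/
@[ext]
structure QPTrans {k : Type w} [CommRing k] {A B : QPCat.{w, v, u} k} (F G : QPFunctor A B) where
  trans : F.functor ⟶ G.functor
  /-- `x Π ∘ β_F = β_G ∘ Π' x` -/
  comm_β : ∀ X, F.β.hom.app X ≫ trans.app (A.P.obj X) =
    B.P.map (trans.app X) ≫ G.β.hom.app X
  /-- `x Q ∘ γ_F = γ_G ∘ Q' x` -/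
  comm_γ : ∀ X, F.γ.hom.app X ≫ trans.app (A.Q.functor.obj X) =
    B.Q.functor.map (trans.app X) ≫ G.γ.hom.app X

section Cat

variable {k : Type w} [CommRing k]

instance (A B : QPCat.{w, v, u} k) : Category (QPFunctor A B) where
  Hom F G := QPTrans F G
  id F := { trans := 𝟙 _, comm_β := by simp, comm_γ := by simp }
  comp x y :=
    { trans := x.trans ≫ y.trans
      comm_β := fun X => by
        rw [NatTrans.comp_app, ← Category.assoc, x.comm_β, Category.assoc, y.comm_β]; simp
      comm_γ := fun X => by
        rw [NatTrans.comp_app, ← Category.assoc, x.comm_γ, Category.assoc, y.comm_γ]; simp }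
  id_comp x := QPTrans.ext (Category.id_comp _)
  comp_id x := QPTrans.ext (Category.comp_id _)
  assoc x y z := QPTrans.ext (Category.assoc _ _ _)

@[ext]
lemma QPTrans.hom_ext {A B : QPCat.{w, v, u} k} {F G : QPFunctor A B} {x y : F ⟶ G}
    (h : ∀ X, (QPTrans.trans x).app X = (QPTrans.trans y).app X) : x = y :=
  QPTrans.ext (NatTrans.ext (funext h))

@[simp] lemma QPTrans.id_trans {A B : QPCat.{w, v, u} k} (F : QPFunctor A B) :
    QPTrans.trans (𝟙 F) = 𝟙 F.functor := rfl

@[simp] lemma QPTrans.comp_trans {A B : QPCat.{w, v, u} k} {F G H : QPFunctor A B}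
    (x : F ⟶ G) (y : G ⟶ H) :
    QPTrans.trans (x ≫ y) = QPTrans.trans x ≫ QPTrans.trans y := rfl

/-- The identity `(Q, Π)`-functor: `β_I = 1`, `γ_I = 1`. -/
def QPFunctor.id (A : QPCat.{w, v, u} k) : QPFunctor A A where
  functor := 𝟭 _
  additive := inferInstance
  linear := inferInstance
  β := Iso.refl A.P
  γ := Iso.refl A.Q.functor
  β_ξ X := by simp
  β_γ X := by simp

/-- Composition of `(Q, Π)`-functors, in diagrammatic order:
`β_{GF} = G β_F ∘ β_G F` and `γ_{GF} = G γ_F ∘ γ_G F`. -/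
def QPFunctor.comp {A B C : QPCat.{w, v, u} k} (F : QPFunctor A B) (G : QPFunctor B C) :
    QPFunctor A C where
  functor := F.functor ⋙ G.functor
  additive := by have := F.additive; have := G.additive; infer_instance
  linear := by have := F.linear; have := G.linear; infer_instance
  β := NatIso.ofComponents
    (fun X => G.β.app (F.functor.obj X) ≪≫ G.functor.mapIso (F.β.app X))
    (fun {X Y} f => by
      have h1 := G.β.hom.naturality (F.functor.map f)
      have h2 := congrArg G.functor.map (F.β.hom.naturality f)
      simp only [Functor.comp_obj, Functor.comp_map, Functor.map_comp] at h1 h2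
      simp only [Functor.comp_obj, Functor.comp_map, Iso.trans_hom, Iso.app_hom,
        Functor.mapIso_hom, Category.assoc]
      rw [← Category.assoc, h1, Category.assoc, h2])
  γ := NatIso.ofComponents
    (fun X => G.γ.app (F.functor.obj X) ≪≫ G.functor.mapIso (F.γ.app X))
    (fun {X Y} f => by
      have h1 := G.γ.hom.naturality (F.functor.map f)
      have h2 := congrArg G.functor.map (F.γ.hom.naturality f)
      simp only [Functor.comp_obj, Functor.comp_map, Functor.map_comp] at h1 h2
      simp only [Functor.comp_obj, Functor.comp_map, Iso.trans_hom, Iso.app_hom,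
        Functor.mapIso_hom, Category.assoc]
      rw [← Category.assoc, h1, Category.assoc, h2])
  β_ξ X := by
    have h1 := G.β_ξ (F.functor.obj X)
    have h2 := congrArg G.functor.map (F.β_ξ X)
    have h3 := G.β.hom.naturality (F.β.hom.app X)
    simp only [Functor.comp_obj, Functor.comp_map, Functor.map_comp] at h1 h2 h3
    simp only [Functor.comp_obj, Functor.comp_map, NatIso.ofComponents_hom_app, Iso.trans_hom,
      Iso.app_hom, Functor.mapIso_hom, Category.assoc, Functor.map_comp]
    rw [reassoc_of% h3, ← h2, ← reassoc_of% h1, ← Functor.map_comp_assoc]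
    simp
  β_γ X := by
    have h1 := G.β_γ (F.functor.obj X)
    have h2 := congrArg G.functor.map (F.β_γ X)
    have h3 := G.β.hom.naturality (F.γ.hom.app X)
    have h4 := G.γ.hom.naturality (F.β.hom.app X)
    simp only [Functor.comp_obj, Functor.comp_map, Functor.map_comp] at h1 h2 h3 h4
    simp only [Functor.comp_obj, Functor.comp_map, NatIso.ofComponents_hom_app, Iso.trans_hom,
      Iso.app_hom, Functor.mapIso_hom, Category.assoc, Functor.map_comp]
    rw [reassoc_of% h3, h2, reassoc_of% h1, reassoc_of% h4]

/-- `Gx` for a `(Q, Π)`-functor `G` and a `(Q, Π)`-natural transformation `x`. -/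
def QPTrans.postcomp {A B C : QPCat.{w, v, u} k} {F G : QPFunctor A B} (x : F ⟶ G)
    (H : QPFunctor B C) : F.comp H ⟶ G.comp H where
  trans := Functor.whiskerRight (QPTrans.trans x) H.functor
  comm_β X := by
    have h1 := congrArg H.functor.map (QPTrans.comm_β x X)
    have h2 := H.β.hom.naturality ((QPTrans.trans x).app X)
    simp only [Functor.comp_obj, Functor.comp_map, Functor.map_comp] at h1 h2
    simp [QPFunctor.comp, h1, reassoc_of% h2]
  comm_γ X := by
    have h1 := congrArg H.functor.map (QPTrans.comm_γ x X)
    have h2 := H.γ.hom.naturality ((QPTrans.trans x).app X)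
    simp only [Functor.comp_obj, Functor.comp_map, Functor.map_comp] at h1 h2
    simp [QPFunctor.comp, h1, reassoc_of% h2]

/-- `xF` for a `(Q, Π)`-functor `F` and a `(Q, Π)`-natural transformation `x`. -/
def QPTrans.precomp {A B C : QPCat.{w, v, u} k} (F : QPFunctor A B)
    {G H : QPFunctor B C} (x : G ⟶ H) : F.comp G ⟶ F.comp H where
  trans := Functor.whiskerLeft F.functor (QPTrans.trans x)
  comm_β X := by
    have h1 := QPTrans.comm_β x (F.functor.obj X)
    have h2 := (QPTrans.trans x).naturality (F.β.hom.app X)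
    simp only [Functor.comp_obj] at h1 h2
    simp [QPFunctor.comp, ← reassoc_of% h1, h2]
  comm_γ X := by
    have h1 := QPTrans.comm_γ x (F.functor.obj X)
    have h2 := (QPTrans.trans x).naturality (F.γ.hom.app X)
    simp only [Functor.comp_obj] at h1 h2
    simp [QPFunctor.comp, ← reassoc_of% h1, h2]

/-- The associator, with identity components. -/
def QPFunctor.associator {A B C D : QPCat.{w, v, u} k} (F : QPFunctor A B) (G : QPFunctor B C)
    (H : QPFunctor C D) : (F.comp G).comp H ≅ F.comp (G.comp H) where
  hom :=
    { trans := (Functor.associator _ _ _).hom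
      comm_β := fun X => by simp [QPFunctor.comp]
      comm_γ := fun X => by simp [QPFunctor.comp] }
  inv :=
    { trans := (Functor.associator _ _ _).inv
      comm_β := fun X => by simp [QPFunctor.comp]
      comm_γ := fun X => by simp [QPFunctor.comp] }
  hom_inv_id := QPTrans.ext (Functor.associator _ _ _).hom_inv_id
  inv_hom_id := QPTrans.ext (Functor.associator _ _ _).inv_hom_id

/-- The left unitor, with identity components. -/
def QPFunctor.leftUnitor {A B : QPCat.{w, v, u} k} (F : QPFunctor A B) :
    (QPFunctor.id A).comp F ≅ F where
  hom :=
    { trans := F.functor.leftUnitor.hom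
      comm_β := fun X => by simp [QPFunctor.comp, QPFunctor.id]
      comm_γ := fun X => by simp [QPFunctor.comp, QPFunctor.id] }
  inv :=
    { trans := F.functor.leftUnitor.inv
      comm_β := fun X => by simp [QPFunctor.comp, QPFunctor.id]
      comm_γ := fun X => by simp [QPFunctor.comp, QPFunctor.id] }
  hom_inv_id := QPTrans.ext F.functor.leftUnitor.hom_inv_id
  inv_hom_id := QPTrans.ext F.functor.leftUnitor.inv_hom_id

/-- The right unitor, with identity components. -/
def QPFunctor.rightUnitor {A B : QPCat.{w, v, u} k} (F : QPFunctor A B) :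
    F.comp (QPFunctor.id B) ≅ F where
  hom :=
    { trans := F.functor.rightUnitor.hom
      comm_β := fun X => by simp [QPFunctor.comp, QPFunctor.id]
      comm_γ := fun X => by simp [QPFunctor.comp, QPFunctor.id] }
  inv :=
    { trans := F.functor.rightUnitor.inv
      comm_β := fun X => by simp [QPFunctor.comp, QPFunctor.id]
      comm_γ := fun X => by simp [QPFunctor.comp, QPFunctor.id] }
  hom_inv_id := QPTrans.ext F.functor.rightUnitor.hom_inv_id
  inv_hom_id := QPTrans.ext F.functor.rightUnitor.inv_hom_id

/-- The strict 2-category of `(Q, Π)`-categories, `(Q, Π)`-functors and `(Q, Π)`-natural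
transformations. -/
instance : Bicategory (QPCat.{w, v, u} k) where
  Hom A B := QPFunctor A B
  homCategory A B := inferInstanceAs (Category (QPFunctor A B))
  id A := QPFunctor.id A
  comp F G := QPFunctor.comp F G
  whiskerLeft F _ _ x := QPTrans.precomp F x
  whiskerRight x H := QPTrans.postcomp x H
  associator F G H := QPFunctor.associator F G H
  leftUnitor F := QPFunctor.leftUnitor F
  rightUnitor F := QPFunctor.rightUnitor F
  whisker_exchange x y := by
    apply QPTrans.hom_ext
    intro X
    exact ((QPTrans.trans y).naturality ((QPTrans.trans x).app X)).symm
  whiskerLeft_id _ _ := rfl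
  whiskerLeft_comp _ _ _ _ _ _ := rfl
  id_whiskerLeft x := by
    apply QPTrans.hom_ext; intro X
    exact ((Category.id_comp _).trans (Category.comp_id _)).symm
  comp_whiskerLeft F G _ _ x := by
    apply QPTrans.hom_ext; intro X
    exact ((Category.id_comp _).trans (Category.comp_id _)).symm
  id_whiskerRight _ G := by
    apply QPTrans.hom_ext; intro X
    exact G.functor.map_id _
  comp_whiskerRight x y H := by
    apply QPTrans.hom_ext; intro X
    exact H.functor.map_comp _ _
  whiskerRight_id x := by
    apply QPTrans.hom_ext; intro X
    exact ((Category.id_comp _).trans (Category.comp_id _)).symm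
  whiskerRight_comp x G H := by
    apply QPTrans.hom_ext; intro X
    exact ((Category.id_comp _).trans (Category.comp_id _)).symm
  whisker_assoc F _ _ x H := by
    apply QPTrans.hom_ext; intro X
    exact ((Category.id_comp _).trans (Category.comp_id _)).symm
  pentagon F G H K := by
    apply QPTrans.hom_ext; intro X
    change K.functor.map (𝟙 _) ≫ 𝟙 _ ≫ 𝟙 _ = 𝟙 _ ≫ 𝟙 _
    simp
  triangle F G := by
    apply QPTrans.hom_ext; intro X
    change 𝟙 _ ≫ 𝟙 _ = G.functor.map (𝟙 _)
    simp

lemma QPFunctor.ext_of_app {A B : QPCat.{w, v, u} k} {F G : QPFunctor A B}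
    (h : F.functor = G.functor)
    (hβ : ∀ X, F.β.hom.app X ≫ eqToHom (by rw [h]) =
      B.P.map (eqToHom (by rw [h])) ≫ G.β.hom.app X)
    (hγ : ∀ X, F.γ.hom.app X ≫ eqToHom (by rw [h]) =
      B.Q.functor.map (eqToHom (by rw [h])) ≫ G.γ.hom.app X) : F = G := by
  obtain ⟨F, _, _, β, γ, _, _⟩ := F
  obtain ⟨G, _, _, β', γ', _, _⟩ := G
  obtain rfl : F = G := h
  obtain rfl : β = β' := by ext X; simpa using hβ X
  obtain rfl : γ = γ' := by ext X; simpa using hγ X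
  rfl

lemma QPFunctor.ext_of_heq {A B : QPCat.{w, v, u} k} {F G : QPFunctor A B}
    (h : F.functor = G.functor) (hβ : ∀ X, F.β.hom.app X ≍ G.β.hom.app X)
    (hγ : ∀ X, F.γ.hom.app X ≍ G.γ.hom.app X) : F = G := by
  obtain ⟨F, _, _, β, γ, _, _⟩ := F
  obtain ⟨G, _, _, β', γ', _, _⟩ := G
  obtain rfl : F = G := h
  obtain rfl : β = β' := by ext X; exact eq_of_heq (hβ X)
  obtain rfl : γ = γ' := by ext X; exact eq_of_heq (hγ X)
  rfl

lemma QPFunctor.ext_of_iso {A B : QPCat.{w, v, u} k} {F G : QPFunctor A B} (e : F ≅ G)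
    (h : F.functor = G.functor)
    (he : ∀ X, (QPTrans.trans e.hom).app X = eqToHom (by rw [h])) : F = G := by
  have hβ := QPTrans.comm_β e.hom
  have hγ := QPTrans.comm_γ e.hom
  simp only [he] at hβ hγ
  exact QPFunctor.ext_of_app h hβ hγ

lemma QPTrans.eqToHom_app {A B : QPCat.{w, v, u} k} {F G : QPFunctor A B} (h : F = G) (X) :
    (QPTrans.trans (eqToHom h)).app X = eqToHom (by rw [h]) := by
  subst h; rfl

instance : Bicategory.Strict (QPCat.{w, v, u} k) where
  id_comp F := QPFunctor.ext_of_iso (QPFunctor.leftUnitor F) rfl (fun _ => rfl)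
  comp_id F := QPFunctor.ext_of_iso (QPFunctor.rightUnitor F) rfl (fun _ => rfl)
  assoc F G H := QPFunctor.ext_of_iso (QPFunctor.associator F G H) rfl (fun _ => rfl)
  leftUnitor_eqToIso F := Iso.ext <| QPTrans.hom_ext fun X =>
    (QPTrans.eqToHom_app (QPFunctor.ext_of_iso (QPFunctor.leftUnitor F) rfl (fun _ => rfl)) X).symm
  rightUnitor_eqToIso F := Iso.ext <| QPTrans.hom_ext fun X =>
    (QPTrans.eqToHom_app (QPFunctor.ext_of_iso (QPFunctor.rightUnitor F) rfl (fun _ => rfl)) X).symm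
  associator_eqToIso F G H := Iso.ext <| QPTrans.hom_ext fun X =>
    (QPTrans.eqToHom_app
      (QPFunctor.ext_of_iso (QPFunctor.associator F G H) rfl (fun _ => rfl)) X).symm

end Cat

/-! ## The 2-functor `E` -/

section E

variable {k : Type w} [CommRing k]

section Object

variable (A : QPSupercat.{w, v, u} k)

lemma zmod_val_one : (1 : ZMod 2).val = 1 := rfl

lemma map_ζ {X Y : A.carrier} {n : ℤ} {p : ZMod 2} {f : X ⟶ Y} (hf : f ∈ homog k X Y (n, p)) :
    A.P.map f ≫ (A.ζ Y).hom = (-1 : ℤ) ^ p.val • ((A.ζ X).hom ≫ f) := by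
  simpa [zmod_val_one] using A.hζ.comm hf

lemma map_ζ_even {X Y : A.carrier} {f : X ⟶ Y} (hf : f ∈ homog k X Y 0) :
    A.P.map f ≫ (A.ζ Y).hom = (A.ζ X).hom ≫ f := by
  simpa using map_ζ A (n := 0) (p := 0) hf

lemma map_ζ_odd {X Y : A.carrier} {n : ℤ} {f : X ⟶ Y} (hf : f ∈ homog k X Y (n, 1)) :
    A.P.map f ≫ (A.ζ Y).hom = -((A.ζ X).hom ≫ f) := by
  simpa [zmod_val_one] using map_ζ A hf

/-- An even supernatural transformation of any degree is natural for all morphisms. -/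
lemma map_σ {X Y : A.carrier} (f : X ⟶ Y) :
    A.Q.map f ≫ (A.σ Y).hom = (A.σ X).hom ≫ f := by
  have := A.hQ.additive
  refine hom_induction (k := k)
    (P := fun f => A.Q.map f ≫ (A.σ Y).hom = (A.σ X).hom ≫ f) ?_
    (fun f g hf hg => ?_) (fun i f hf => ?_) f
  · simp
  · simp [hf, hg]
  · simpa using A.hσ.comm (m := i.1) (q := i.2) hf

lemma map_σ' {X Y : A.carrier} (f : X ⟶ Y) :
    A.Qinv.map f ≫ (A.σ' Y).hom = (A.σ' X).hom ≫ f := by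
  have := A.hQinv.additive
  refine hom_induction (k := k)
    (P := fun f => A.Qinv.map f ≫ (A.σ' Y).hom = (A.σ' X).hom ≫ f) ?_
    (fun f g hf hg => ?_) (fun i f hf => ?_) f
  · simp
  · simp [hf, hg]
  · simpa using A.hσ'.comm (m := i.1) (q := i.2) hf

lemma map_σ_assoc {X Y Z : A.carrier} (f : X ⟶ Y) (g : Y ⟶ Z) :
    A.Q.map f ≫ (A.σ Y).hom ≫ g = (A.σ X).hom ≫ f ≫ g := by
  rw [← Category.assoc, map_σ, Category.assoc]

lemma map_σ'_assoc {X Y Z : A.carrier} (f : X ⟶ Y) (g : Y ⟶ Z) :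
    A.Qinv.map f ≫ (A.σ' Y).hom ≫ g = (A.σ' X).hom ≫ f ≫ g := by
  rw [← Category.assoc, map_σ', Category.assoc]

/-- `ξ := ζ ζ : Π² ⇒ I`, the horizontal composite `ξ_X = ζ_X ∘ Π ζ_X`. -/
def xiIso (X : A.carrier) : A.P.obj (A.P.obj X) ≅ X :=
  A.P.mapIso (A.ζ X) ≪≫ A.ζ X

/-- `ı := σ' σ : Q⁻¹ Q ⇒ I`, the horizontal composite `ı_X = σ'_X ∘ Q⁻¹ σ_X`. -/
def iIso (X : A.carrier) : A.Qinv.obj (A.Q.obj X) ≅ X :=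
  A.Qinv.mapIso (A.σ X) ≪≫ A.σ' X

/-- `ȷ := σ σ' : Q Q⁻¹ ⇒ I`, the horizontal composite `ȷ_X = σ_X ∘ Q σ'_X`. -/
def jIso (X : A.carrier) : A.Q.obj (A.Qinv.obj X) ≅ X :=
  A.Q.mapIso (A.σ' X) ≪≫ A.σ X

lemma xiIso_mem (X : A.carrier) : (xiIso A X).hom ∈ homog k (A.P.obj (A.P.obj X)) X 0 :=
  GradedSupercategory.comp_mem (A.hP.map_mem (A.hζ.mem X)) (A.hζ.mem X)

lemma iIso_mem (X : A.carrier) : (iIso A X).hom ∈ homog k (A.Qinv.obj (A.Q.obj X)) X 0 :=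
  GradedSupercategory.comp_mem (A.hQinv.map_mem (A.hσ.mem X)) (A.hσ'.mem X)

lemma jIso_mem (X : A.carrier) : (jIso A X).hom ∈ homog k (A.Q.obj (A.Qinv.obj X)) X 0 :=
  GradedSupercategory.comp_mem (A.hQ.map_mem (A.hσ'.mem X)) (A.hσ.mem X)

end Object

section Functor

lemma P_map_ζ (A : QPSupercat.{w, v, u} k) (X : A.carrier) :
    A.P.map (A.ζ X).hom = -(A.ζ (A.P.obj X)).hom := by
  have h : A.P.map (A.ζ X).hom ≫ (A.ζ X).hom = -((A.ζ (A.P.obj X)).hom ≫ (A.ζ X).hom) :=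
    map_ζ_odd A (A.hζ.mem X)
  rw [← cancel_mono (A.ζ X).hom, h]
  simp

lemma P_map_ζ_inv (A : QPSupercat.{w, v, u} k) (X : A.carrier) :
    A.P.map (A.ζ X).inv = -(A.ζ (A.P.obj X)).inv := by
  rw [← cancel_mono (A.P.map (A.ζ X).hom), ← A.P.map_comp, P_map_ζ]
  simp

variable {A B : QPSupercat.{w, v, u} k}

/-- `β_F := -ζ' F ζ⁻¹ : Π' F ⇒ F Π` (horizontal composite). -/
def betaIso (F : A.carrier ⥤ B.carrier) (X : A.carrier) :
    B.P.obj (F.obj X) ≅ F.obj (A.P.obj X) :=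
  -(B.P.mapIso (F.mapIso (A.ζ X).symm) ≪≫ B.ζ (F.obj (A.P.obj X)))

/-- `γ_F := σ' F σ⁻¹ : Q' F ⇒ F Q` (horizontal composite). -/
def gammaIso (F : A.carrier ⥤ B.carrier) (X : A.carrier) :
    B.Q.obj (F.obj X) ≅ F.obj (A.Q.obj X) :=
  B.Q.mapIso (F.mapIso (A.σ X).symm) ≪≫ B.σ (F.obj (A.Q.obj X))

variable {F : A.carrier ⥤ B.carrier}

lemma betaIso_mem (hF : IsGradedSuperfunctor k F) (X : A.carrier) : (betaIso F X).hom ∈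
    homog k (B.P.obj (F.obj X)) (F.obj (A.P.obj X)) 0 :=
  Submodule.neg_mem _ (GradedSupercategory.comp_mem (i := (0, 1)) (j := (0, 1))
    (B.hP.map_mem (hF.map_mem (inv_mem (A.ζ X) (A.hζ.mem X)))) (B.hζ.mem _))

lemma gammaIso_mem (hF : IsGradedSuperfunctor k F) (X : A.carrier) : (gammaIso F X).hom ∈
    homog k (B.Q.obj (F.obj X)) (F.obj (A.Q.obj X)) 0 :=
  GradedSupercategory.comp_mem (i := (1, 0)) (j := (-1, 0))
    (B.hQ.map_mem (hF.map_mem (inv_mem (A.σ X) (A.hσ.mem X)))) (B.hσ.mem _)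

lemma betaIso_hom (hF : IsGradedSuperfunctor k F) (X : A.carrier) :
    (betaIso F X).hom = (B.ζ (F.obj X)).hom ≫ F.map (A.ζ X).inv := by
  have h := map_ζ_odd B (n := 0) (hF.map_mem (i := (0, 1)) (inv_mem (A.ζ X) (A.hζ.mem X)))
  simp [betaIso, h]

lemma gammaIso_hom (X : A.carrier) :
    (gammaIso F X).hom = (B.σ (F.obj X)).hom ≫ F.map (A.σ X).inv := by
  simp [gammaIso, map_σ]

lemma betaIso_natural (hF : IsGradedSuperfunctor k F) {X Y : A.carrier} {f : X ⟶ Y} (hf : f ∈ homog k X Y 0) :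
    B.P.map (F.map f) ≫ (betaIso F Y).hom = (betaIso F X).hom ≫ F.map (A.P.map f) := by
  have h1 := map_ζ_even B (hF.map_mem hf)
  have h2 : f ≫ (A.ζ Y).inv = (A.ζ X).inv ≫ A.P.map f := by
    rw [Iso.comp_inv_eq, Category.assoc, map_ζ_even A hf, Iso.inv_hom_id_assoc]
  rw [betaIso_hom hF, betaIso_hom hF, reassoc_of% h1, ← F.map_comp, h2, F.map_comp,
    Category.assoc]

lemma gammaIso_natural {X Y : A.carrier} (f : X ⟶ Y) :
    B.Q.map (F.map f) ≫ (gammaIso F Y).hom = (gammaIso F X).hom ≫ F.map (A.Q.map f) := by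
  have h2 : f ≫ (A.σ Y).inv = (A.σ X).inv ≫ A.Q.map f := by
    rw [Iso.comp_inv_eq, Category.assoc, map_σ, Iso.inv_hom_id_assoc]
  rw [gammaIso_hom, gammaIso_hom, map_σ_assoc, ← F.map_comp, h2, F.map_comp,
    Category.assoc]

lemma beta_xi (hF : IsGradedSuperfunctor k F) (X : A.carrier) :
    (xiIso B (F.obj X)).hom ≫ F.map (xiIso A X).inv =
      B.P.map (betaIso F X).hom ≫ (betaIso F (A.P.obj X)).hom := by
  have h1 := map_ζ_even B (betaIso_mem hF X)
  have hadd := hF.additive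
  rw [betaIso_hom hF (A.P.obj X), reassoc_of% h1, betaIso_hom hF X]
  simp [xiIso, P_map_ζ, P_map_ζ_inv]

lemma beta_gamma (hF : IsGradedSuperfunctor k F) (X : A.carrier) :
    B.P.map (gammaIso F X).hom ≫ (betaIso F (A.Q.obj X)).hom ≫
        F.map (betaIso A.Q X).hom =
      (betaIso B.Q (F.obj X)).hom ≫ B.Q.map (betaIso F X).hom ≫
        (gammaIso F (A.P.obj X)).hom := by
  have h1 := map_ζ_even B (gammaIso_mem hF X)
  have h2 : (A.σ X).inv ≫ A.Q.map (A.ζ X).inv = (A.ζ X).inv ≫ (A.σ (A.P.obj X)).inv := by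
    rw [Iso.inv_comp_eq, ← Category.assoc, Iso.eq_comp_inv, map_σ]
  rw [betaIso_hom hF (A.Q.obj X), Category.assoc, reassoc_of% h1, gammaIso_hom X,
    betaIso_hom A.hQ, betaIso_hom B.hQ, gammaIso_hom (A.P.obj X), map_σ_assoc,
    betaIso_hom hF X]
  simp only [Functor.map_comp, Category.assoc]
  rw [← map_σ_assoc B (B.ζ (F.obj X)).hom, ← B.Q.map_comp_assoc, Iso.inv_hom_id,
    B.Q.map_id, Category.id_comp,
    ← F.map_comp_assoc (A.ζ (A.Q.obj X)).inv, Iso.inv_hom_id, F.map_id, Category.id_comp,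
    ← F.map_comp, h2, F.map_comp]

lemma betaIso_comp {C : QPSupercat.{w, v, u} k} {F : A.carrier ⥤ B.carrier}
    {G : B.carrier ⥤ C.carrier} (hF : IsGradedSuperfunctor k F)
    (hG : IsGradedSuperfunctor k G) (X : A.carrier) :
    (betaIso (F ⋙ G) X).hom = (betaIso G (F.obj X)).hom ≫ G.map (betaIso F X).hom := by
  have h : IsGradedSuperfunctor k (F ⋙ G) := (GSFunctor.comp ⟨F, hF⟩ ⟨G, hG⟩).isSuper
  rw [betaIso_hom h, betaIso_hom hF, betaIso_hom hG]
  simp [← Functor.map_comp]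

lemma gammaIso_comp {C : QPSupercat.{w, v, u} k} {F : A.carrier ⥤ B.carrier}
    {G : B.carrier ⥤ C.carrier} (X : A.carrier) :
    (gammaIso (F ⋙ G) X).hom = (gammaIso G (F.obj X)).hom ≫ G.map (gammaIso F X).hom := by
  rw [gammaIso_hom, gammaIso_hom, gammaIso_hom]
  simp [← Functor.map_comp]

end Functor

section Object

variable (A : QPSupercat.{w, v, u} k)

lemma xi_natural {X Y : A.carrier} {f : X ⟶ Y} (hf : f ∈ homog k X Y 0) :
    A.P.map (A.P.map f) ≫ (xiIso A Y).hom = (xiIso A X).hom ≫ f := by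
  have h1 := map_ζ_even A hf
  have h2 := map_ζ_even A (A.hP.map_mem hf)
  simp [xiIso, P_map_ζ, h1, reassoc_of% h2]

lemma i_natural {X Y : A.carrier} (f : X ⟶ Y) :
    A.Qinv.map (A.Q.map f) ≫ (iIso A Y).hom = (iIso A X).hom ≫ f := by
  simp only [iIso, Iso.trans_hom, Functor.mapIso_hom, map_σ', map_σ'_assoc, map_σ, Category.assoc]

lemma j_natural {X Y : A.carrier} (f : X ⟶ Y) :
    A.Q.map (A.Qinv.map f) ≫ (jIso A Y).hom = (jIso A X).hom ≫ f := by
  simp only [jIso, Iso.trans_hom, Functor.mapIso_hom, map_σ', map_σ_assoc, map_σ, Category.assoc]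

lemma xi_comm (X : A.carrier) : (xiIso A (A.P.obj X)).hom = A.P.map (xiIso A X).hom := by
  have := A.hP.additive
  simp [xiIso, P_map_ζ]

lemma i_j (X : A.carrier) :
    A.Q.map (iIso A X).inv ≫ (jIso A (A.Q.obj X)).hom = 𝟙 (A.Q.obj X) := by
  have h : (jIso A (A.Q.obj X)).hom = A.Q.map (iIso A X).hom := by
    rw [← cancel_mono (A.σ X).hom, map_σ]
    simp [jIso, iIso, map_σ, map_σ']
  rw [h, ← A.Q.map_comp, Iso.inv_hom_id, A.Q.map_id]

end Object

/-- The `(Q, Π)`-category underlying a graded `(Q, Π)`-supercategory. -/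
def E.obj (A : QPSupercat.{w, v, u} k) : QPCat.{w, v, u} k where
  carrier := Underlying k A.carrier
  P := Underlying.functor A.P A.hP
  P_additive := Underlying.functor_additive A.P A.hP
  P_linear := Underlying.functor_linear A.P A.hP
  ξ := NatIso.ofComponents (fun X => Underlying.isoMk (xiIso A X.as) (xiIso_mem A X.as))
    (fun f => Underlying.hom_ext (xi_natural A (Underlying.val_mem f)))
  ξ_comm X := Underlying.hom_ext (xi_comm A X.as)
  Q :=
    { functor := Underlying.functor A.Q A.hQ
      inverse := Underlying.functor A.Qinv A.hQinv
      unitIso := (NatIso.ofComponents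
        (fun X => Underlying.isoMk (iIso A X.as) (iIso_mem A X.as))
        (fun f => Underlying.hom_ext (i_natural A (Underlying.val f))) :
          Underlying.functor A.Q A.hQ ⋙ Underlying.functor A.Qinv A.hQinv ≅
            𝟭 (Underlying k A.carrier)).symm
      counitIso := NatIso.ofComponents
        (fun X => Underlying.isoMk (jIso A X.as) (jIso_mem A X.as))
        (fun f => Underlying.hom_ext (j_natural A (Underlying.val f)))
      functor_unitIso_comp := fun X => Underlying.hom_ext (i_j A X.as) }
  Q_additive := Underlying.functor_additive A.Q A.hQ
  Q_linear := Underlying.functor_linear A.Q A.hQ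
  βQ := NatIso.ofComponents
    (fun X => Underlying.isoMk (betaIso A.Q X.as) (betaIso_mem A.hQ X.as))
    (fun f => Underlying.hom_ext (betaIso_natural A.hQ (Underlying.val_mem f)))
  βQ_ξ X := Underlying.hom_ext (beta_xi A.hQ X.as)

/-- The `(Q, Π)`-functor underlying a graded superfunctor. -/
def E.map {A B : QPSupercat.{w, v, u} k} (F : GSFunctor A B) :
    QPFunctor (E.obj A) (E.obj B) where
  functor := Underlying.functor F.functor F.isSuper
  additive := Underlying.functor_additive F.functor F.isSuper
  linear := Underlying.functor_linear F.functor F.isSuper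
  β := NatIso.ofComponents
    (fun X => Underlying.isoMk (betaIso F.functor X.as) (betaIso_mem F.isSuper X.as))
    (fun f => Underlying.hom_ext (betaIso_natural F.isSuper (Underlying.val_mem f)))
  γ := NatIso.ofComponents
    (fun X => Underlying.isoMk (gammaIso F.functor X.as) (gammaIso_mem F.isSuper X.as))
    (fun f => Underlying.hom_ext (gammaIso_natural (Underlying.val f)))
  β_ξ X := Underlying.hom_ext (beta_xi F.isSuper X.as)
  β_γ X := Underlying.hom_ext (beta_gamma F.isSuper X.as)

/-- The `(Q, Π)`-natural transformation underlying an even supernatural transformation of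
degree zero. -/
def E.map₂ {A B : QPSupercat.{w, v, u} k} {F G : GSFunctor A B} (x : F ⟶ G) :
    E.map F ⟶ E.map G where
  trans :=
    { app := fun X => Underlying.mk (GSTrans.app x X.as) (x.isSupernatural.mem X.as)
      naturality := fun _ _ f =>
        Underlying.hom_ext (GSTrans.naturality x (Underlying.val f)) }
  comm_β X := Underlying.hom_ext (by
    change (betaIso F.functor X.as).hom ≫ GSTrans.app x (A.P.obj X.as) =
      B.P.map (GSTrans.app x X.as) ≫ (betaIso G.functor X.as).hom
    have h := map_ζ_even B (x.isSupernatural.mem X.as)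
    rw [betaIso_hom F.isSuper, betaIso_hom G.isSuper, reassoc_of% h, Category.assoc,
      GSTrans.naturality])
  comm_γ X := Underlying.hom_ext (by
    change (gammaIso F.functor X.as).hom ≫ GSTrans.app x (A.Q.obj X.as) =
      B.Q.map (GSTrans.app x X.as) ≫ (gammaIso G.functor X.as).hom
    rw [gammaIso_hom, gammaIso_hom, map_σ_assoc, Category.assoc, GSTrans.naturality])

lemma E.map_id (A : QPSupercat.{w, v, u} k) :
    E.map (GSFunctor.id A) = QPFunctor.id (E.obj A) := by
  refine QPFunctor.ext_of_heq rfl (fun X => heq_of_eq (Underlying.hom_ext ?_))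
    (fun X => heq_of_eq (Underlying.hom_ext ?_))
  · exact (betaIso_hom (GSFunctor.id A).isSuper X.as).trans (Iso.hom_inv_id _)
  · exact (gammaIso_hom X.as).trans (Iso.hom_inv_id _)

lemma E.map_comp {A B C : QPSupercat.{w, v, u} k} (F : GSFunctor A B) (G : GSFunctor B C) :
    E.map (F.comp G) = (E.map F).comp (E.map G) := by
  refine QPFunctor.ext_of_heq rfl (fun X => heq_of_eq (Underlying.hom_ext ?_))
    (fun X => heq_of_eq (Underlying.hom_ext ?_))
  · exact betaIso_comp F.isSuper G.isSuper X.as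
  · exact gammaIso_comp X.as

variable (k) in
/-- The strict 2-functor `E` from graded `(Q, Π)`-supercategories to `(Q, Π)`-categories. -/
def E : StrictPseudofunctor (QPSupercat.{w, v, u} k) (QPCat.{w, v, u} k) :=
  StrictPseudofunctor.mk''
    { obj := E.obj
      map := E.map
      map₂ := E.map₂
      map₂_id := fun _ => rfl
      map₂_comp := fun _ _ => rfl
      map_id := E.map_id
      map_comp := E.map_comp
      map₂_whisker_left := fun F G H x => by
        apply QPTrans.hom_ext; intro X
        erw [QPTrans.comp_trans, QPTrans.comp_trans, NatTrans.comp_app, NatTrans.comp_app,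
          QPTrans.eqToHom_app, QPTrans.eqToHom_app]
        exact ((Category.id_comp _).trans (Category.comp_id _)).symm
      map₂_whisker_right := fun x H => by
        apply QPTrans.hom_ext; intro X
        erw [QPTrans.comp_trans, QPTrans.comp_trans, NatTrans.comp_app, NatTrans.comp_app,
          QPTrans.eqToHom_app, QPTrans.eqToHom_app]
        exact ((Category.id_comp _).trans (Category.comp_id _)).symm }

end E

/-- A pseudofunctor is a 2-equivalence if it has an inverse up to equivalence: a pseudofunctor
`D` such that `E ∘ D` and `D ∘ E` are equivalent to the identities in the bicategories of
pseudofunctors, strong transformations and modifications. -/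
def IsTwoEquivalence {B : Type u₁} [Bicategory.{w₁, v₁} B] {C : Type u₂} [Bicategory.{w₂, v₂} C]
    (E : B ⥤ᵖ C) : Prop :=
  ∃ D : C ⥤ᵖ B, Nonempty (D.comp E ≌ Pseudofunctor.id C) ∧ Nonempty (E.comp D ≌ Pseudofunctor.id B)

end

end QPi

namespace QPi

noncomputable section

/-! ## The grading group -/

/-! In a graded `(Q, Π)`-supercategory the isomorphisms `ζ`, `σ`, `σ'` trade bidegrees for objects.
If `Y_i` denotes `Π^p Q⁻ⁿ Y` for `i = (n, p)`, they provide an isomorphism `c_i : Y_i ≅ Y` of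
bidegree `i`, so a morphism `f : X ⟶ Y` of bidegree `i` amounts to the even degree-zero morphism `f
≫ c_i⁻¹ : X ⟶ Y_i`. Hence the supercategory can be rebuilt from its underlying `(Q, Π)`-category.

For a `(Q, Π)`-category `A`, the supercategory `D A` has the objects of `A`, and its morphisms of
bidegree `i` should be the morphisms `X ⟶ Y_i` of `A`. To make composition strictly associative,
such a morphism is stored as the whole family of its shifts `X_a ⟶ Y_{a+i}`, compatible with `Q`
and, up to the sign of the parity of `i`, with `Π`. By `ShiftFamily.hom_ext` and
`ShiftFamily.exists_hom` a family is determined by its component at `0`, which is arbitrary. The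
existence is a descent along the generators `e₁`, `e₂` of the group of bidegrees: the relation `2 e₂
= 0` is handled by `ξ`, the commutation of `e₁` and `e₂` by `β_Q`.

The even degree-zero morphisms of `D A` are those of `A`, so `A` and `E (D A)` are strictly
isomorphic through `toED` and `fromED`.

On morphisms, `E` is bijective on the nose. A `(Q, Π)`-functor `F` between underlying categories
sends the objects `Y_a` to objects that the target's `ζ` and `σ` identify with `F Y` by isomorphisms
`d_a` of bidegree `a`. Its lift sends `f` of bidegree `i` to `F (f ≫ c_i⁻¹) ≫ d_i`. Functoriality
rests on `val_map_conj`, and `map_lift` says that the lift restricts to `F`. Conversely, every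
morphism is generated by even degree-zero ones, `ζ` and `σ`, and compatibility with `β` and `γ`
amounts to naturality with respect to `ζ` and `σ`. This gives `transVal_naturality` and
`map_injective`.

So `D F` is the lift of `F` transported along `toED` and `fromED`, and identities between
superfunctors can be checked after applying `E`. The comparison of `D (E A)` with `A` is the lift of
that of `E (D (E A))` with `E A`. Both comparisons are strictly invertible and strictly natural. -/

/-- The group of bidegrees (degree, parity). -/
abbrev Deg := ℤ × ZMod 2

/-- The generator of the degrees. -/
abbrev e₁ : Deg := (1, 0)

/-- The generator of the parities. -/
abbrev e₂ : Deg := (0, 1)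

/-- The sign `(-1)^p`. -/
def sgn (p : ZMod 2) : ℤ := (-1) ^ p.val

@[simp] lemma sgn_zero : sgn 0 = 1 := rfl

@[simp] lemma sgn_one : sgn 1 = -1 := rfl

lemma sgn_add (p q : ZMod 2) : sgn (p + q) = sgn p * sgn q := by
  revert p q; decide

lemma sgn_mul_self (p : ZMod 2) : sgn p * sgn p = 1 := by
  revert p; decide

/-- Recursion upwards by `e` and downwards by its inverse. No compatibility is needed, because `ℤ`
is free on one generator. -/
lemma exists_int_descent {P : ℤ → Type v} (e : ∀ n, P n ≃ P (n + 1)) (x : P 0) :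
    ∃ g : ∀ n, P n, g 0 = x ∧ ∀ n, g (n + 1) = e n (g n) := by
  let g₁ : ∀ k : ℕ, P (Int.ofNat k) := fun k =>
    Nat.rec x (fun k (y : P (Int.ofNat k)) => (e (Int.ofNat k) y : P (Int.ofNat k + 1))) k
  let g₂ : ∀ k : ℕ, P (Int.negSucc k) := fun k =>
    Nat.rec ((e (Int.negSucc 0)).symm x) (fun k (y : P (Int.negSucc k)) =>
      (e (Int.negSucc (k + 1))).symm y) k
  refine ⟨fun n => match n with
    | Int.ofNat k => g₁ k
    | Int.negSucc k => g₂ k, rfl, fun n => ?_⟩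
  match n with
  | Int.ofNat k => rfl
  | Int.negSucc 0 => exact ((e (Int.negSucc 0)).apply_symm_apply x).symm
  | Int.negSucc (k + 1) => exact ((e (Int.negSucc (k + 1))).apply_symm_apply (g₂ k)).symm

/-- A family over the group of bidegrees with compatible transition maps is determined by an
arbitrary value at `0`. -/
lemma exists_descent {P : Deg → Type v} (R₁ : ∀ {a b}, b + e₁ = a → (P a ≃ P b))
    (R₂ : ∀ {a b}, a + e₂ = b → P a → P b)
    (h₂₂ : ∀ {a b} (h : a + e₂ = b) (h' : b + e₂ = a) (x : P a), R₂ h' (R₂ h x) = x)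
    (h₁₂ : ∀ {a b a' b'} (h : b + e₁ = a) (h' : b' + e₁ = a') (l : a + e₂ = a')
      (l' : b + e₂ = b') (x : P a), R₁ h' (R₂ l x) = R₂ l' (R₁ h x)) (x : P 0) :
    ∃ f : ∀ a, P a, f 0 = x ∧ (∀ {a b} (h : b + e₁ = a), R₁ h (f a) = f b) ∧
      ∀ {a b} (h : a + e₂ = b), R₂ h (f a) = f b := by
  have hs : ∀ (n : ℤ) (p : ZMod 2), ((n, p) : Deg) + e₁ = (n + 1, p) := fun n p => by simp
  have ht : ∀ n : ℤ, ((n, 0) : Deg) + e₂ = (n, 1) := fun n => by simp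
  have ht' : ∀ n : ℤ, ((n, 1) : Deg) + e₂ = (n, 0) := fun n => by
    rw [Prod.mk_add_mk, add_zero]; rfl
  obtain ⟨g, hg0, hg⟩ := exists_int_descent (P := fun n => P (n, 0))
    (fun n => (R₁ (hs n 0)).symm) x
  -- `ZMod 2` unfolds to `Fin 2`, so the parity can be matched on. The value at `(n, 1)` is forced
  -- by the value at `(n, 0)`.
  let F : ∀ (n : ℤ) (p : Fin 2), P (n, p) := fun n p => match p with
    | 0 => g n
    | 1 => R₂ (ht n) (g n)
  have hF0 : ∀ n, F n 0 = g n := fun _ => rfl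
  have hF1 : ∀ n, F n 1 = R₂ (ht n) (g n) := fun _ => rfl
  refine ⟨fun a => F a.1 a.2, hg0, ?_, ?_⟩
  · rintro ⟨m, p⟩ ⟨n, q⟩ h
    obtain ⟨rfl, rfl⟩ : n + 1 = m ∧ q = p := by simpa using h
    have h0 : R₁ (hs n 0) (g (n + 1)) = g n := by rw [hg]; simp
    match q with
    | 0 => exact h0
    | 1 =>
      change R₁ _ (R₂ _ (g (n + 1))) = R₂ _ (g n)
      rw [h₁₂ (hs n 0) _ _ (ht n), h0]
  · rintro ⟨m, p⟩ ⟨n, q⟩ h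
    obtain ⟨rfl, rfl⟩ : m = n ∧ p + 1 = q := by simpa using h
    match p with
    | 0 => rfl
    | 1 => exact h₂₂ (ht m) _ (g m)

/-- The equivalence along `e₁` is needed to reach both positive and negative degrees; along `e₂` one
implication suffices, since `e₂` has order two. -/
lemma deg_induction {P : Deg → Prop} (h0 : P 0) (h1 : ∀ {a b}, b + e₁ = a → (P a ↔ P b))
    (h2 : ∀ {a b}, a + e₂ = b → P a → P b) (a : Deg) : P a := by
  have hs : ∀ n : ℤ, ((n, 0) : Deg) + e₁ = (n + 1, 0) := fun n => by simp
  have h : ∀ n : ℤ, P (n, 0) := fun n => by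
    induction n with
    | zero => exact h0
    | succ n ih => exact (h1 (hs _)).2 ih
    | pred n ih => exact (h1 (by simp)).1 ih
  obtain ⟨n, p⟩ := a
  have hp : p = 0 ∨ p = 1 := by revert p; decide
  obtain rfl | rfl := hp
  · exact h n
  · exact h2 (by simp) (h n)

lemma add_e₁ {a b i : Deg} (h : b + e₁ = a) : b + i + e₁ = a + i := by
  rw [← h]; abel

lemma add_e₂ {a b i : Deg} (h : a + e₂ = b) : a + i + e₂ = b + i := by
  rw [← h]; abel

lemma sgn_of_add_e₂ {a b : Deg} (h : a + e₂ = b) : sgn b.2 = - sgn a.2 := by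
  rw [← h, Prod.snd_add, sgn_add]; simp

/-! ## Shift families -/

section ShiftFamily

variable {k : Type w} [CommRing k]

/-- A family of objects of a `(Q, Π)`-category on which `Q` and `Π` act by shifting the index. -/
structure ShiftFamily (A : QPCat.{w, v, u} k) where
  obj : Deg → A.carrier
  -- `Q` lowers the degree by one, so `obj (n, p)` plays the role of `Π^p Q⁻ⁿ X`. Relations between
  -- indices are hypotheses, which avoids casts along identities of the group.
  s : ∀ {a b}, b + e₁ = a → (A.Q.functor.obj (obj a) ≅ obj b)
  t : ∀ {a b}, a + e₂ = b → (A.P.obj (obj a) ≅ obj b)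
  t_t : ∀ {a b} (h : a + e₂ = b) (h' : b + e₂ = a),
    A.P.map (t h).hom ≫ (t h').hom = A.ξ.hom.app (obj a)
  s_t : ∀ {a b a' b'} (h : b + e₁ = a) (h' : b' + e₁ = a') (l : a + e₂ = a') (l' : b + e₂ = b'),
    A.P.map (s h).hom ≫ (t l').hom =
      A.βQ.hom.app (obj a) ≫ A.Q.functor.map (t l).hom ≫ (s h').hom

namespace ShiftFamily

variable {A : QPCat.{w, v, u} k}

/-- The morphisms of bidegree `i` between shift families: families of morphisms raising the index
by `i`, compatible with `Q`, and compatible with `Π` up to the sign given by the parity. -/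
def hom (U V : ShiftFamily A) (i : Deg) : Submodule k (∀ a b : Deg, U.obj a ⟶ V.obj b) where
  -- A matrix over all pairs of indices, zero off the graph of translation by `i`: its ambient type
  -- does not depend on `i`, so morphisms of provably equal bidegrees can be compared without casts.
  carrier := {f | (∀ a b, a + i ≠ b → f a b = 0) ∧
    (∀ {a b a' b'} (h : b + e₁ = a) (h' : b' + e₁ = a'),
      A.Q.functor.map (f a a') ≫ (V.s h').hom = (U.s h).hom ≫ f b b') ∧
    (∀ {a b a' b'} (h : a + e₂ = b) (h' : a' + e₂ = b'),
      A.P.map (f a a') ≫ (V.t h').hom = sgn i.2 • ((U.t h).hom ≫ f b b'))}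
  zero_mem' := by
    have := A.Q_additive; have := A.P_additive
    refine ⟨fun _ _ _ => rfl, fun _ _ => ?_, fun _ _ => ?_⟩ <;> simp
  add_mem' := by
    have := A.Q_additive; have := A.P_additive
    rintro f g ⟨hf, hf₁, hf₂⟩ ⟨hg, hg₁, hg₂⟩
    refine ⟨fun a b h => ?_, fun h h' => ?_, fun h h' => ?_⟩
    · simp [hf a b h, hg a b h]
    · simp [hf₁ h h', hg₁ h h']
    · simp [hf₂ h h', hg₂ h h']
  smul_mem' := by
    have := A.Q_additive; have := A.P_additive; have := A.Q_linear; have := A.P_linear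
    rintro r f ⟨hf, hf₁, hf₂⟩
    refine ⟨fun a b h => ?_, fun h h' => ?_, fun h h' => ?_⟩
    · simp [hf a b h]
    · simp [hf₁ h h']
    · simp [hf₂ h h', smul_comm r]

variable {U V W Z : ShiftFamily A} {i j l : Deg}

lemma hom_apply_eq_zero (f : hom U V i) {a b : Deg} (h : a + i ≠ b) : f.1 a b = 0 := f.2.1 a b h

lemma hom_s (f : hom U V i) {a b a' b' : Deg} (h : b + e₁ = a) (h' : b' + e₁ = a') :
    A.Q.functor.map (f.1 a a') ≫ (V.s h').hom = (U.s h).hom ≫ f.1 b b' := f.2.2.1 h h'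

lemma hom_t (f : hom U V i) {a b a' b' : Deg} (h : a + e₂ = b) (h' : a' + e₂ = b') :
    A.P.map (f.1 a a') ≫ (V.t h').hom = sgn i.2 • ((U.t h).hom ≫ f.1 b b') := f.2.2.2 h h'

/-- To give a morphism of shift families it suffices to give its possibly nonzero components. -/
def homMk (f : ∀ a b, a + i = b → (U.obj a ⟶ V.obj b))
    (hs : ∀ {a b a' b'} (h : b + e₁ = a) (h' : b' + e₁ = a') (l : a + i = a') (l' : b + i = b'),
      A.Q.functor.map (f a a' l) ≫ (V.s h').hom = (U.s h).hom ≫ f b b' l')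
    (ht : ∀ {a b a' b'} (h : a + e₂ = b) (h' : a' + e₂ = b') (l : a + i = a') (l' : b + i = b'),
      A.P.map (f a a' l) ≫ (V.t h').hom = sgn i.2 • ((U.t h).hom ≫ f b b' l')) :
    hom U V i := by
  classical
  refine ⟨fun a b => if h : a + i = b then f a b h else 0,
    fun a b h => dif_neg h, fun {a b a' b'} h h' => ?_, fun {a b a' b'} h h' => ?_⟩ <;> beta_reduce
  · by_cases l : b + i = b'
    · have l' : a + i = a' := by rw [← h', ← l, ← h]; abel
      rw [dif_pos l, dif_pos l', hs h h' l' l]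
    · have l' : ¬ a + i = a' := fun l' => l (by
        rw [← h', ← h] at l'
        exact add_right_cancel (b := e₁) (by rw [← l']; abel))
      have := A.Q_additive
      rw [dif_neg l, dif_neg l', Functor.map_zero, Limits.zero_comp, Limits.comp_zero]
  · by_cases l : a + i = a'
    · have l' : b + i = b' := by rw [← h', ← l, ← h]; abel
      rw [dif_pos l, dif_pos l', ht h h' l l']
    · have l' : ¬ b + i = b' := fun l' => l (by
        rw [← h', ← h] at l'
        exact add_right_cancel (b := e₂) (by rw [← l']; abel))
      have := A.P_additive
      rw [dif_neg l, dif_neg l', Functor.map_zero, Limits.zero_comp, Limits.comp_zero, smul_zero]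

lemma homMk_apply {f : ∀ a b, a + i = b → (U.obj a ⟶ V.obj b)} {hs ht} {a b : Deg}
    (h : a + i = b) : (homMk f hs ht : hom U V i).1 a b = f a b h := dif_pos h

/-- The compatibilities tie each component to its neighbours, so vanishing spreads from index `0`
through the whole group. Faithfulness of `Q` allows steps in both directions along `e₁`. -/
lemma hom_eq_zero {f : hom U V i} (hf : f.1 0 i = 0) : f = 0 := by
  have := A.Q_additive; have := A.P_additive
  have key : ∀ a b, a + i = b → f.1 a b = 0 := fun a => by
    refine deg_induction (P := fun a => ∀ b, a + i = b → f.1 a b = 0) ?_ ?_ ?_ a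
    · rintro b rfl
      rwa [zero_add]
    · intro a b h
      have e := hom_s f h (add_e₁ (i := i) h)
      constructor
      · rintro h0 _ rfl
        rw [h0 _ rfl, Functor.map_zero, Limits.zero_comp] at e
        rw [← cancel_epi (U.s h).hom, ← e, Limits.comp_zero]
      · rintro h0 _ rfl
        rw [h0 _ rfl, Limits.comp_zero] at e
        apply A.Q.functor.map_injective
        rw [← cancel_mono (V.s (add_e₁ (i := i) h)).hom, e, Functor.map_zero, Limits.zero_comp]
    · rintro a b h h0 _ rfl
      have e := hom_t f h (add_e₂ (i := i) h)
      rw [h0 _ rfl, Functor.map_zero, Limits.zero_comp] at e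
      rw [← cancel_epi (U.t h).hom, Limits.comp_zero]
      have := congrArg (sgn i.2 • ·) e.symm
      simpa [smul_smul, sgn_mul_self] using this
  apply Subtype.ext
  funext a b
  by_cases h : a + i = b
  · exact key a b h
  · exact hom_apply_eq_zero f h

lemma hom_ext {f g : hom U V i} (h : f.1 0 i = g.1 0 i) : f = g := by
  rw [← sub_eq_zero]
  exact hom_eq_zero (by simp [h])

/-- Transport of components along `Q`. -/
def homEquivS (U V : ShiftFamily A) {a b a' b' : Deg} (h : b + e₁ = a) (h' : b' + e₁ = a') :
    (U.obj a ⟶ V.obj a') ≃ (U.obj b ⟶ V.obj b') :=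
  (A.Q.fullyFaithfulFunctor.homEquiv).trans (Iso.homCongr (U.s h) (V.s h'))

lemma homEquivS_apply {a b a' b' : Deg} (h : b + e₁ = a) (h' : b' + e₁ = a')
    (f : U.obj a ⟶ V.obj a') :
    homEquivS U V h h' f = (U.s h).inv ≫ A.Q.functor.map f ≫ (V.s h').hom := rfl

/-- Together with `hom_ext`, this identifies the morphisms of bidegree `i` with the morphisms `U_0 ⟶
V_i`. The component is propagated by descent: along `e₁` because `Q` is an equivalence, along `e₂`
by applying `Π` with the sign of `i`. -/
lemma exists_hom (f : U.obj 0 ⟶ V.obj i) : ∃ g : hom U V i, g.1 0 i = f := by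
  have := A.Q_additive; have := A.P_additive
  let f₀ : U.obj 0 ⟶ V.obj (0 + i) := f ≫ eqToHom (by rw [zero_add])
  obtain ⟨g, hg0, hg₁, hg₂⟩ := exists_descent (P := fun a => U.obj a ⟶ V.obj (a + i))
    (fun h => homEquivS U V h (add_e₁ h))
    (fun h x => sgn i.2 • ((U.t h).inv ≫ A.P.map x ≫ (V.t (add_e₂ h)).hom))
    -- The relation `2 e₂ = 0`: moving twice conjugates by `ξ`, which disappears by naturality, and
    -- the two signs cancel.
    (fun {a b} h h' x => by
      have h1 : A.P.map (U.t h).inv ≫ A.ξ.hom.app (U.obj a) = (U.t h').hom := by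
        rw [← U.t_t h h', ← Functor.map_comp_assoc]; simp
      have h2 := A.ξ.hom.naturality x
      simp only [Functor.comp_map, Functor.id_map] at h2
      rw [← cancel_epi (U.t h').hom]
      simp only [Functor.map_zsmul, Functor.map_comp, Category.assoc, Preadditive.comp_zsmul,
        Preadditive.zsmul_comp, smul_smul, sgn_mul_self, one_smul, Iso.hom_inv_id_assoc, t_t, h2,
        reassoc_of% h1])
    -- The commutation of `e₁` and `e₂`: naturality of `β_Q` combined with `s_t`, the form with
    -- inverted isomorphisms being `h4`.
    (fun {a b a' b'} h h' l l' x => by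
      have h1 := U.s_t h h' l l'
      have h2 := V.s_t (add_e₁ h) (add_e₁ h') (add_e₂ (i := i) l) (add_e₂ (i := i) l')
      have h3 := A.βQ.hom.naturality x
      simp only [Functor.comp_map] at h3
      have h4 : (U.t l').inv ≫ A.P.map (U.s h).inv ≫ A.βQ.hom.app (U.obj a) =
          (U.s h').inv ≫ A.Q.functor.map (U.t l).inv := by
        have h5 : A.P.map (U.s h).hom ≫ (U.t l').hom ≫ (U.s h').inv ≫
            A.Q.functor.map (U.t l).inv = A.βQ.hom.app (U.obj a) := by
          rw [reassoc_of% h1]; simp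
        rw [← cancel_epi (U.t l').hom, ← cancel_epi (A.P.map (U.s h).hom), h5]
        simp
      simp only [homEquivS_apply, Functor.map_zsmul, Functor.map_comp, Category.assoc,
        Preadditive.comp_zsmul, Preadditive.zsmul_comp, h2, reassoc_of% h3]
      rw [reassoc_of% h4]) f₀
  refine ⟨homMk (fun a b h => g a ≫ eqToHom (by rw [h])) ?_ ?_, ?_⟩
  · rintro a b _ b' h h' rfl rfl
    simp [← hg₁ h, homEquivS_apply]
  · rintro a b _ b' h h' rfl rfl
    simp [← hg₂ h, smul_smul, sgn_mul_self]
  · rw [homMk_apply (zero_add i), hg0]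
    simp [f₀]

end ShiftFamily

end ShiftFamily

/-! ### Composition of morphisms of shift families -/

section ShiftFamily

variable {k : Type w} [CommRing k]

namespace ShiftFamily

variable {A : QPCat.{w, v, u} k} {U V W Z : ShiftFamily A} {i j l : Deg}

/-- The identity morphism of a shift family. -/
def homId (U : ShiftFamily A) : hom U U 0 :=
  homMk (fun a b h => eqToHom (by rw [← h, add_zero]))
    (fun {a b a' b'} h h' l l' => by
      obtain rfl : a = a' := by rw [← l, add_zero]
      obtain rfl : b = b' := by rw [← l', add_zero]
      simp)
    (fun {a b a' b'} h h' l l' => by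
      obtain rfl : a = a' := by rw [← l, add_zero]
      obtain rfl : b = b' := by rw [← l', add_zero]
      simp)

lemma homId_apply (U : ShiftFamily A) (a : Deg) : (homId U).1 a a = 𝟙 _ :=
  homMk_apply (add_zero a)

/-- Composition of morphisms of shift families. -/
def homComp (f : hom U V i) (g : hom V W j) : hom U W (i + j) where
  -- In the matrix product only the middle index `a + i` can contribute.
  val a c := f.1 a (a + i) ≫ g.1 (a + i) c
  property := by
    refine ⟨fun a c h => ?_, fun {a b a' b'} h h' => ?_, fun {a b a' b'} h h' => ?_⟩ <;> beta_reduce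
    · rw [hom_apply_eq_zero g (by rwa [add_assoc]), Limits.comp_zero]
    · rw [Functor.map_comp, Category.assoc, hom_s g (add_e₁ h) h', reassoc_of% (hom_s f h (add_e₁ h))]
    · rw [Functor.map_comp, Category.assoc, hom_t g (add_e₂ h) h', Preadditive.comp_zsmul,
        reassoc_of% (hom_t f h (add_e₂ h)), Preadditive.zsmul_comp, smul_smul, Category.assoc,
        Prod.snd_add, sgn_add, mul_comm]

lemma homComp_apply (f : hom U V i) (g : hom V W j) {a b : Deg} (h : a + i = b) (c : Deg) :
    (homComp f g).1 a c = f.1 a b ≫ g.1 b c := by subst h; rfl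

/-- Composition of morphisms of shift families, as a bilinear map. -/
def homCompₗ (U V W : ShiftFamily A) (i j : Deg) :
    hom U V i →ₗ[k] hom V W j →ₗ[k] hom U W (i + j) :=
  LinearMap.mk₂ k homComp
    (fun _ _ _ => Subtype.ext (by funext a c; exact Preadditive.add_comp _ _ _ _ _ _))
    (fun _ _ _ => Subtype.ext (by funext a c; exact Linear.smul_comp _ _ _ _ _ _))
    (fun _ _ _ => Subtype.ext (by funext a c; exact Preadditive.comp_add _ _ _ _ _ _))
    (fun _ _ _ => Subtype.ext (by funext a c; exact Linear.comp_smul _ _ _ _ _ _))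

end ShiftFamily

/-! ### The shift family of an object -/

namespace QPCat

variable (A : QPCat.{w, v, u} k)

/-- The objects `Q⁻ⁿ X`. -/
def shiftZ (X : A.carrier) : ℤ → A.carrier
  | Int.ofNat n => A.Q.inverse.obj^[n] X
  | Int.negSucc n => A.Q.functor.obj^[n + 1] X

/-- The isomorphisms `Q Q⁻ⁿ⁻¹ X ≅ Q⁻ⁿ X`. -/
def shiftZIso (X : A.carrier) : ∀ n : ℤ,
    A.Q.functor.obj (A.shiftZ X (n + 1)) ≅ A.shiftZ X n
  -- Iterates unfold at the innermost application, whereas here the outermost one has to be split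
  -- off; hence the casts.
  | Int.ofNat n => A.Q.functor.mapIso (eqToIso (Function.iterate_succ_apply' _ _ _)) ≪≫
      A.Q.counitIso.app (A.shiftZ X n)
  | Int.negSucc 0 => Iso.refl (A.Q.functor.obj X)
  | Int.negSucc (_ + 1) => eqToIso (Function.iterate_succ_apply' _ _ _).symm

/-- The object `X` or `Π X`, depending on the parity. -/
def shiftP (X : A.carrier) : Fin 2 → A.carrier
  | 0 => X
  | 1 => A.P.obj X

/-- The isomorphisms `Π Π^p X ≅ Π^{p+1} X`. -/
def shiftPIso (X : A.carrier) : ∀ p : Fin 2, A.P.obj (A.shiftP X p) ≅ A.shiftP X (p + 1)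
  | 0 => Iso.refl (A.P.obj X)
  -- Here `1 + 1` reduces to `0` in `Fin 2`, so the target is `X` itself.
  | 1 => A.ξ.app X

/-- The isomorphisms `Q Π^p X ≅ Π^p Y` induced by an isomorphism `Q X ≅ Y`. -/
def shiftSIso {X Y : A.carrier} (e : A.Q.functor.obj X ≅ Y) :
    ∀ p : Fin 2, A.Q.functor.obj (A.shiftP X p) ≅ A.shiftP Y p
  | 0 => e
  | 1 => (A.βQ.app X).symm ≪≫ A.P.mapIso e

/-- Immediate at parity `0`; at parity `1` this is the axiom `ξ Π = Π ξ`. -/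
lemma shiftPIso_comp (X : A.carrier) : ∀ p : Fin 2, ∀ h : A.shiftP X (p + 1 + 1) = A.shiftP X p,
    A.P.map (A.shiftPIso X p).hom ≫ (A.shiftPIso X (p + 1)).hom ≫ eqToHom h =
      A.ξ.hom.app (A.shiftP X p)
  | 0, h => by
    change A.P.map (𝟙 _) ≫ A.ξ.hom.app X ≫ 𝟙 _ = A.ξ.hom.app X
    simp
  | 1, h => by
    change A.P.map (A.ξ.hom.app X) ≫ 𝟙 _ ≫ 𝟙 _ = A.ξ.hom.app (A.P.obj X)
    simp [A.ξ_comm]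

/-- At parity `0` the isomorphism `β_Q` cancels the inverse built into `shiftSIso`; at parity `1`
this is the axiom `ξ Q ξ⁻¹ = β_Q Π ∘ Π β_Q` with naturality of `ξ`. -/
lemma shiftPIso_shiftSIso {X Y : A.carrier} (e : A.Q.functor.obj X ≅ Y) : ∀ p : Fin 2,
    A.P.map (A.shiftSIso e p).hom ≫ (A.shiftPIso Y p).hom =
      A.βQ.hom.app (A.shiftP X p) ≫ A.Q.functor.map (A.shiftPIso X p).hom ≫
        (A.shiftSIso e (p + 1)).hom
  | 0 => by
    change A.P.map e.hom ≫ 𝟙 _ = A.βQ.hom.app X ≫ A.Q.functor.map (𝟙 _) ≫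
      A.βQ.inv.app X ≫ A.P.map e.hom
    simp
  | 1 => by
    change A.P.map (A.βQ.inv.app X ≫ A.P.map e.hom) ≫ A.ξ.hom.app Y =
      A.βQ.hom.app (A.P.obj X) ≫ A.Q.functor.map (A.ξ.hom.app X) ≫ e.hom
    have h := A.ξ.hom.naturality e.hom
    simp only [Functor.comp_map, Functor.id_map] at h
    have h' := A.βQ_ξ X
    rw [Functor.map_comp, Category.assoc, h, ← cancel_epi (A.P.map (A.βQ.hom.app X)),
      ← Functor.map_comp_assoc]
    simp [← reassoc_of% h', ← Functor.map_comp_assoc]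

/-- The shift family of an object. -/
def family (X : A.carrier) : ShiftFamily A where
  obj a := A.shiftP (A.shiftZ X a.1) a.2
  s {a b} h := A.shiftSIso (A.Q.functor.mapIso (eqToIso (by rw [← h]; simp)) ≪≫
      A.shiftZIso X b.1) a.2 ≪≫ eqToIso (by rw [← h]; simp)
  t {a b} h := A.shiftPIso (A.shiftZ X a.1) a.2 ≪≫ eqToIso (by rw [← h]; simp; rfl)
  t_t {a b} h h' := by
    obtain ⟨m, p⟩ := a
    obtain rfl : (m, p + 1) = b := by rw [← h]; simp
    rw [Iso.trans_hom, Iso.trans_hom, eqToIso_refl, Iso.refl_hom, Category.comp_id]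
    exact A.shiftPIso_comp (A.shiftZ X m) p (congrArg (A.shiftP _) (congrArg Prod.snd h'))
  s_t {a b a' b'} h h' l l' := by
    obtain ⟨n, p⟩ := b
    obtain rfl : (n + 1, p) = a := by rw [← h]; simp
    obtain rfl : (n, p + 1) = b' := by rw [← l']; simp
    obtain rfl : (n + 1, p + 1) = a' := by rw [← l]; simp
    simp only [eqToIso_refl, Iso.trans_hom, Functor.mapIso_refl, Iso.refl_trans, Iso.refl_hom,
      Category.comp_id]
    exact A.shiftPIso_shiftSIso (A.shiftZIso X n) p

end QPCat

end ShiftFamily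

/-! ## The graded supercategory of a `(Q, Π)`-category -/

section Super

variable {k : Type w} [CommRing k]

/-- The objects of the graded supercategory associated with a `(Q, Π)`-category. -/
structure Super (A : QPCat.{w, v, u} k) : Type u where
  /-- An object of a `(Q, Π)`-category, viewed in the associated graded supercategory. -/
  of ::
  /-- The corresponding object of the `(Q, Π)`-category. -/
  as : A.carrier

namespace Super

variable {A : QPCat.{w, v, u} k}

/-- The morphisms of a given bidegree. -/
abbrev Homog (X Y : Super A) (i : Deg) :
    Submodule k (∀ a b : Deg, (A.family X.as).obj a ⟶ (A.family Y.as).obj b) :=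
  ShiftFamily.hom (A.family X.as) (A.family Y.as) i

/-- All morphisms. -/
abbrev Hom (X Y : Super A) : Type v := DirectSum Deg fun i => Homog X Y i

/-- The inclusion of the homogeneous morphisms. -/
abbrev incl (X Y : Super A) (i : Deg) : Homog X Y i →ₗ[k] Hom X Y :=
  DirectSum.lof k Deg (fun i => Homog X Y i) i

/-- Category laws relate bidegrees such as `0 + i` and `i` that are only provably equal; comparing
the components at index `0` avoids transporting morphisms. -/
lemma incl_congr {X Y : Super A} {i j : Deg} {f : Homog X Y i} {g : Homog X Y j} (h : i = j)
    (hfg : f.1 0 i = g.1 0 i) : incl X Y i f = incl X Y j g := by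
  subst h
  rw [ShiftFamily.hom_ext hfg]

/-- Composition of morphisms, as a bilinear map. -/
def compₗ (X Y Z : Super A) : Hom X Y →ₗ[k] Hom Y Z →ₗ[k] Hom X Z :=
  DirectSum.toModule k Deg _ fun i => LinearMap.flip <| DirectSum.toModule k Deg _ fun j =>
    LinearMap.flip <| (ShiftFamily.homCompₗ _ _ _ i j).compr₂ (incl X Z (i + j))

lemma compₗ_incl {X Y Z : Super A} {i j : Deg} (f : Homog X Y i) (g : Homog Y Z j) :
    compₗ X Y Z (incl X Y i f) (incl Y Z j g) = incl X Z (i + j) (ShiftFamily.homComp f g) := by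
  simp [compₗ, ShiftFamily.homCompₗ, incl]

lemma induction {X Y : Super A} {P : Hom X Y → Prop} (h0 : P 0)
    (hadd : ∀ f g, P f → P g → P (f + g)) (hh : ∀ i f, P (incl X Y i f)) (f : Hom X Y) : P f :=
  DirectSum.induction_on f h0 hh hadd

instance : Category.{v} (Super A) where
  Hom := Hom
  id X := incl X X 0 (ShiftFamily.homId _)
  comp {X Y Z} f g := compₗ X Y Z f g
  id_comp {X Y} f := by
    refine induction (P := fun f => compₗ X X Y _ f = f) (by simp) (fun f g hf hg => ?_)
      (fun i f => ?_) f
    · simp only [map_add, hf, hg]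
    · rw [compₗ_incl]
      exact incl_congr (zero_add i) (by
        rw [ShiftFamily.homComp_apply _ _ (add_zero 0), ShiftFamily.homId_apply, zero_add]
        exact Category.id_comp _)
  comp_id {X Y} f := by
    refine induction (P := fun f => compₗ X Y Y f _ = f) (by simp) (fun f g hf hg => ?_)
      (fun i f => ?_) f
    · simp only [map_add, LinearMap.add_apply, hf, hg]
    · rw [compₗ_incl]
      exact incl_congr (add_zero i) (by
        rw [ShiftFamily.homComp_apply _ _ (zero_add i), add_zero, ShiftFamily.homId_apply]
        exact Category.comp_id _)
  assoc {X Y Z W} f g h := by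
    refine induction (P := fun f => compₗ X Z W (compₗ X Y Z f g) h =
      compₗ X Y W f (compₗ Y Z W g h)) (by simp) (fun f f' hf hf' => ?_) (fun i f => ?_) f
    · simp only [map_add, LinearMap.add_apply, hf, hf']
    refine induction (P := fun g => compₗ X Z W (compₗ X Y Z _ g) h =
      compₗ X Y W _ (compₗ Y Z W g h)) (by simp) (fun g g' hg hg' => ?_) (fun j g => ?_) g
    · simp only [map_add, LinearMap.add_apply, hg, hg']
    refine induction (P := fun h => compₗ X Z W (compₗ X Y Z _ _) h =
      compₗ X Y W _ (compₗ Y Z W _ h)) (by simp) (fun h h' hh hh' => ?_) (fun l h => ?_) h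
    · simp only [map_add, hh, hh']
    · simp only [compₗ_incl]
      exact incl_congr (add_assoc i j l) (by
        rw [ShiftFamily.homComp_apply _ _ (zero_add (i + j)),
          ShiftFamily.homComp_apply _ _ (zero_add i), ShiftFamily.homComp_apply _ _ (zero_add i),
          ShiftFamily.homComp_apply _ _ rfl, Category.assoc])

instance : Preadditive (Super A) where
  homGroup X Y := inferInstanceAs (AddCommGroup (Hom X Y))
  add_comp X Y Z f f' g := LinearMap.map_add₂ (compₗ X Y Z) f f' g
  comp_add X Y Z f g g' := LinearMap.map_add (compₗ X Y Z f) g g'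

instance : Linear k (Super A) where
  homModule X Y := inferInstanceAs (Module k (Hom X Y))
  smul_comp X Y Z r f g := LinearMap.map_smul₂ (compₗ X Y Z) r f g
  comp_smul X Y Z f r g := LinearMap.map_smul (compₗ X Y Z f) r g

/-- A homogeneous morphism given by a morphism of shift families. -/
def ofHomog {X Y : Super A} {i : Deg} (f : Homog X Y i) : X ⟶ Y := incl X Y i f

lemma ofHomog_comp {X Y Z : Super A} {i j : Deg} (f : Homog X Y i) (g : Homog Y Z j) :
    ofHomog f ≫ ofHomog g = ofHomog (ShiftFamily.homComp f g) :=
  compₗ_incl f g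

lemma id_eq (X : Super A) : 𝟙 X = ofHomog (ShiftFamily.homId _) := rfl

/-- The inclusion of the homogeneous morphisms, as a linear map to the morphisms. -/
def inclₗ (X Y : Super A) (i : Deg) : Homog X Y i →ₗ[k] (X ⟶ Y) := incl X Y i

/-- An external direct sum is the internal sum of its summands: the inverse of summation is given on
each summand by restricting the inclusion to its range. -/
lemma isInternal_range (X Y : Super A) :
    DirectSum.IsInternal fun i => LinearMap.range (incl X Y i) := by
  classical
  let d : Hom X Y →ₗ[k] DirectSum Deg fun i => LinearMap.range (incl X Y i) :=
    DirectSum.toModule k Deg _ fun i =>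
      (DirectSum.lof k Deg (fun i => LinearMap.range (incl X Y i)) i) ∘ₗ (incl X Y i).rangeRestrict
  have hd : ∀ i f, d (incl X Y i f) = DirectSum.lof k Deg (fun i => LinearMap.range (incl X Y i)) i
      ⟨incl X Y i f, f, rfl⟩ := fun i f => by
    simp [d, incl]; rfl
  let D : DirectSum.Decomposition fun i => LinearMap.range (incl X Y i) :=
    { decompose' := d
      left_inv := fun f => by
        refine induction (P := fun f => DirectSum.coeAddMonoidHom _ (d f) = f) (by simp)
          (fun f g hf hg => ?_) (fun i f => ?_) f
        · rw [map_add, map_add, hf, hg]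
        · rw [hd]; exact DirectSum.coeAddMonoidHom_of _ _ _
      right_inv := fun f => by
        refine DirectSum.induction_on f (by simp) (fun i f => ?_) (fun f g hf hg => ?_)
        · obtain ⟨_, f, rfl⟩ := f
          rw [DirectSum.coeAddMonoidHom_of]
          exact hd i f
        · rw [map_add, map_add, hf, hg] }
  exact DirectSum.Decomposition.isInternal _

instance : GradedSupercategory k (Super A) where
  homog X Y i := LinearMap.range (inclₗ X Y i)
  isInternal X Y := isInternal_range X Y
  id_mem X := ⟨_, rfl⟩
  comp_mem := by
    rintro X Y Z i j _ _ ⟨f, rfl⟩ ⟨g, rfl⟩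
    exact ⟨_, (ofHomog_comp f g).symm⟩

lemma ofHomog_mem {X Y : Super A} {i : Deg} (f : Homog X Y i) : ofHomog f ∈ homog k X Y i :=
  ⟨f, rfl⟩

lemma ofHomog_congr {X Y : Super A} {i j : Deg} {f : Homog X Y i} {g : Homog X Y j} (h : i = j)
    (hfg : f.1 0 i = g.1 0 i) : ofHomog f = ofHomog g := incl_congr h hfg

lemma ofHomog_injective {X Y : Super A} {i : Deg} :
    Function.Injective (ofHomog : Homog X Y i → (X ⟶ Y)) :=
  DirectSum.of_injective (β := fun i => Homog X Y i) i

lemma exists_of_mem {X Y : Super A} {i : Deg} {f : X ⟶ Y} (hf : f ∈ homog k X Y i) :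
    ∃ g : Homog X Y i, ofHomog g = f := hf

/-- The homogeneous morphism with a given component. -/
def ext (X Y : Super A) (i : Deg) (f : (A.family X.as).obj 0 ⟶ (A.family Y.as).obj i) :
    Homog X Y i := (ShiftFamily.exists_hom f).choose

lemma ext_apply {X Y : Super A} {i : Deg} (f : (A.family X.as).obj 0 ⟶ (A.family Y.as).obj i) :
    (ext X Y i f).1 0 i = f := (ShiftFamily.exists_hom f).choose_spec

end Super

end Super

/-! ## Functors given on homogeneous morphisms -/

section Homogeneous

variable {k : Type w} [CommRing k] {C : Type u₁} [Category.{v₁} C] [Preadditive C] [Linear k C]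
  [GradedSupercategory k C]

/-- The decomposition of morphisms into homogeneous components. -/
def homogEquiv (X Y : C) : (DirectSum Deg fun i => homog k X Y i) ≃ₗ[k] (X ⟶ Y) :=
  LinearEquiv.ofBijective (DirectSum.coeLinearMap (homog k X Y))
    (GradedSupercategory.isInternal (k := k) X Y)

lemma homogEquiv_lof {X Y : C} {i : Deg} (f : homog k X Y i) :
    homogEquiv X Y (DirectSum.lof k Deg (fun i => homog k X Y i) i f) = f.1 :=
  DirectSum.coeLinearMap_lof _ _ _

/-- The linear map on all morphisms with given restrictions to the homogeneous ones. -/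
def homogLift {X Y : C} {M : Type v₂} [AddCommGroup M] [Module k M]
    (m : ∀ i, homog k X Y i →ₗ[k] M) : (X ⟶ Y) →ₗ[k] M :=
  DirectSum.toModule k Deg M m ∘ₗ (homogEquiv X Y).symm.toLinearMap

lemma homogLift_apply {X Y : C} {M : Type v₂} [AddCommGroup M] [Module k M]
    (m : ∀ i, homog k X Y i →ₗ[k] M) {i : Deg} {f : X ⟶ Y} (hf : f ∈ homog k X Y i) :
    homogLift m f = m i ⟨f, hf⟩ := by
  have h : (homogEquiv X Y).symm f =
      DirectSum.lof k Deg (fun i => homog k X Y i) i ⟨f, hf⟩ := by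
    rw [LinearEquiv.symm_apply_eq, homogEquiv_lof]
  simp [homogLift, h]

variable {D : Type u₂} [Category.{v₂} D] [Preadditive D] [Linear k D]

/-- The functor with a given action on homogeneous morphisms. -/
def functorOfHomog (obj : C → D) (m : ∀ X Y i, homog k X Y i →ₗ[k] (obj X ⟶ obj Y))
    (hid : ∀ X, m X X 0 ⟨𝟙 X, GradedSupercategory.id_mem X⟩ = 𝟙 _)
    (hcomp : ∀ {X Y Z i j} (f : X ⟶ Y) (hf : f ∈ homog k X Y i) (g : Y ⟶ Z)
      (hg : g ∈ homog k Y Z j),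
      m X Z (i + j) ⟨f ≫ g, GradedSupercategory.comp_mem hf hg⟩ =
        m X Y i ⟨f, hf⟩ ≫ m Y Z j ⟨g, hg⟩) : C ⥤ D where
  obj := obj
  map {X Y} := homogLift (m X Y)
  map_id X := by rw [homogLift_apply _ (GradedSupercategory.id_mem X), hid]
  map_comp {X Y Z} f g := by
    refine hom_induction (k := k) (P := fun f => homogLift (m X Z) (f ≫ g) =
      homogLift (m X Y) f ≫ homogLift (m Y Z) g) (by simp) (fun f f' hf hf' => ?_)
      (fun i f hf => ?_) f
    · simp only [Preadditive.add_comp, map_add, hf, hf']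
    refine hom_induction (k := k) (P := fun g => homogLift (m X Z) (f ≫ g) =
      homogLift (m X Y) f ≫ homogLift (m Y Z) g) (by simp) (fun g g' hg hg' => ?_)
      (fun j g hg => ?_) g
    · simp only [Preadditive.comp_add, map_add, hg, hg']
    · rw [homogLift_apply _ hf, homogLift_apply _ hg,
        homogLift_apply _ (GradedSupercategory.comp_mem hf hg), hcomp]

section

variable {obj : C → D} {m : ∀ X Y i, homog k X Y i →ₗ[k] (obj X ⟶ obj Y)} {hid hcomp}

lemma functorOfHomog_map {X Y : C} {i : Deg} {f : X ⟶ Y} (hf : f ∈ homog k X Y i) :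
    (functorOfHomog obj m hid hcomp).map f = m X Y i ⟨f, hf⟩ :=
  homogLift_apply (m X Y) hf

lemma isGradedSuperfunctor_functorOfHomog [GradedSupercategory k D]
    (hm : ∀ X Y i f, m X Y i f ∈ homog k (obj X) (obj Y) i) :
    IsGradedSuperfunctor k (functorOfHomog obj m hid hcomp) where
  additive := ⟨by intro X Y f g; exact (homogLift (m X Y)).map_add f g⟩
  linear := ⟨by intro X Y f r; exact (homogLift (m X Y)).map_smul r f⟩
  map_mem hf := by rw [functorOfHomog_map hf]; exact hm _ _ _ _

end

/-! ### Conjugation by homogeneous isomorphisms -/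

lemma neg_one_pow_val_mul_add (q p p' : ZMod 2) : (-1 : ℤ) ^ (q.val * (p + p').val) =
    (-1) ^ (q.val * p.val) * (-1) ^ (q.val * p'.val) := by
  revert q p p'; decide

/-- The superfunctor with given values on objects that makes given homogeneous isomorphisms into
a supernatural transformation to the identity. -/
def conjFunctor {obj : C → C} (z : ∀ X, obj X ≅ X) (q : ZMod 2) : C ⥤ C :=
  functorOfHomog obj
    -- The sign rule for transformations of parity `q` forces this sign; it respects composition
    -- because parities add.
    (fun X Y i => ((-1 : ℤ) ^ (q.val * i.2.val)) • ((Linear.leftComp k _ (z X).hom) ∘ₗ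
      (Linear.rightComp k _ (z Y).inv) ∘ₗ (homog k X Y i).subtype))
    (fun X => by simp)
    (fun {X Y Z i j} f hf g hg => by
      simp [neg_one_pow_val_mul_add, smul_smul, mul_comm])

variable (k) in
lemma conjFunctor_map {obj : C → C} (z : ∀ X, obj X ≅ X) (q : ZMod 2) {X Y : C} {i : Deg}
    {f : X ⟶ Y} (hf : f ∈ homog k X Y i) : (conjFunctor (k := k) z q).map f =
      (((-1 : ℤ) ^ (q.val * i.2.val)) • ((z X).hom ≫ f ≫ (z Y).inv) : obj X ⟶ obj Y) :=
  functorOfHomog_map hf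

variable {obj : C → C} {z : ∀ X, obj X ≅ X} {n : ℤ} {q : ZMod 2}
  (hz : ∀ X, (z X).hom ∈ homog k (obj X) X (n, q))

include hz

lemma isGradedSuperfunctor_conjFunctor : IsGradedSuperfunctor k (conjFunctor (k := k) z q) :=
  isGradedSuperfunctor_functorOfHomog fun X Y i f => by
    have h := GradedSupercategory.comp_mem (hz X)
      (GradedSupercategory.comp_mem f.2 (inv_mem (z Y) (hz Y)))
    rw [add_neg_cancel_comm_assoc] at h
    exact zsmul_mem h _

lemma isSupernatural_conjFunctor :
    IsSupernatural k (conjFunctor (k := k) z q) (𝟭 C) n q fun X => (z X).hom where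
  mem := hz
  comm {X Y m p f} hf := by
    rw [conjFunctor_map k z q hf]
    exact (Preadditive.zsmul_comp _ _ _).trans (congrArg (_ • ·)
      (by simp : ((z X).hom ≫ f ≫ (z Y).inv) ≫ (z Y).hom = (z X).hom ≫ f))

end Homogeneous

/-! ### Isomorphisms of shift families -/

namespace ShiftFamily

variable {k : Type w} [CommRing k] {A : QPCat.{w, v, u} k} {U V : ShiftFamily A} {i : Deg}

/-- Invertibility spreads from index `0` as vanishing does in `hom_eq_zero`, now because `Q`
reflects isomorphisms. -/
lemma isIso_hom_apply (f : hom U V i) [IsIso (f.1 0 i)] (a b : Deg) (h : a + i = b) :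
    IsIso (f.1 a b) := by
  refine deg_induction (P := fun a => ∀ b, a + i = b → IsIso (f.1 a b)) ?_ ?_ ?_ a b h
  · rintro b rfl
    rwa [zero_add]
  · intro a b h
    have e := hom_s f h (add_e₁ (i := i) h)
    constructor
    · rintro h0 _ rfl
      have := h0 _ rfl
      have e' : f.1 b (b + i) = (U.s h).inv ≫ A.Q.functor.map (f.1 a (a + i)) ≫
        (V.s (add_e₁ (i := i) h)).hom := by rw [e, Iso.inv_hom_id_assoc]
      rw [e']; infer_instance
    · rintro h0 _ rfl
      have := h0 _ rfl
      have e' : A.Q.functor.map (f.1 a (a + i)) = (U.s h).hom ≫ f.1 b (b + i) ≫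
        (V.s (add_e₁ (i := i) h)).inv := by rw [← reassoc_of% e]; simp
      have : IsIso (A.Q.functor.map (f.1 a (a + i))) := by rw [e']; infer_instance
      exact isIso_of_reflects_iso _ A.Q.functor
  · rintro a b h h0 _ rfl
    have := h0 _ rfl
    have e := hom_t f h (add_e₂ (i := i) h)
    have e' : f.1 b (b + i) = sgn i.2 • ((U.t h).inv ≫ A.P.map (f.1 a (a + i)) ≫
        (V.t (add_e₂ (i := i) h)).hom) := by
      rw [e]; simp [smul_smul, sgn_mul_self]
    rw [e']
    let E := (U.t h).symm ≪≫ A.P.mapIso (asIso (f.1 a (a + i))) ≪≫ V.t (add_e₂ (i := i) h)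
    exact ⟨sgn i.2 • E.inv,
      by
        rw [Preadditive.zsmul_comp, Preadditive.comp_zsmul, smul_smul, sgn_mul_self, one_smul]
        exact E.hom_inv_id,
      by
        rw [Preadditive.zsmul_comp, Preadditive.comp_zsmul, smul_smul, sgn_mul_self, one_smul]
        exact E.inv_hom_id⟩

lemma neg_add_eq {a b i : Deg} (h : b + -i = a) : a + i = b := by rw [← h]; abel

lemma sgn_neg (p : ZMod 2) : sgn (-p) = sgn p := by revert p; decide

/-- The components of a morphism of shift families with an invertible component. -/
def homIso (f : hom U V i) [IsIso (f.1 0 i)] (a b : Deg) (h : a + i = b) : U.obj a ≅ V.obj b :=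
  @asIso _ _ _ _ _ (isIso_hom_apply f a b h)

@[simp] lemma homIso_hom (f : hom U V i) [IsIso (f.1 0 i)] (a b : Deg) (h : a + i = b) :
    (homIso f a b h).hom = f.1 a b := rfl

/-- The inverse of a morphism of shift families with an invertible component. -/
def homInv (f : hom U V i) [IsIso (f.1 0 i)] : hom V U (-i) :=
  homMk (fun b a h => (homIso f a b (neg_add_eq h)).inv)
    (fun {a b a' b'} h h' l l' => by
      have e := hom_s f h' h
      rw [← homIso_hom f _ _ (neg_add_eq l), ← homIso_hom f _ _ (neg_add_eq l')] at e
      rw [← cancel_epi (A.Q.functor.map (homIso f _ _ (neg_add_eq l)).hom), reassoc_of% e]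
      simp [-homIso_hom])
    (fun {a b a' b'} h h' l l' => by
      have e := hom_t f h' h
      rw [← homIso_hom f _ _ (neg_add_eq l), ← homIso_hom f _ _ (neg_add_eq l')] at e
      rw [← cancel_epi (A.P.map (homIso f _ _ (neg_add_eq l)).hom), Preadditive.comp_zsmul,
        reassoc_of% e, Preadditive.zsmul_comp, smul_smul, Prod.snd_neg, sgn_neg, sgn_mul_self]
      simp [-homIso_hom])

lemma homComp_homInv (f : hom U V i) [IsIso (f.1 0 i)] (a : Deg) :
    (homComp f (homInv f)).1 a a = 𝟙 _ := by
  rw [homComp_apply _ _ rfl, homInv, homMk_apply (by abel)]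
  exact (homIso f a (a + i) rfl).hom_inv_id

lemma homInv_homComp (f : hom U V i) [IsIso (f.1 0 i)] (a : Deg) :
    (homComp (homInv f) f).1 a a = 𝟙 _ := by
  rw [homComp_apply _ _ rfl, homInv, homMk_apply rfl]
  exact (homIso f (a + -i) a (by abel)).inv_hom_id

end ShiftFamily

/-- The component of index `0` of the shift family of an object. -/
def QPCat.familyZero {k : Type w} [CommRing k] (A : QPCat.{w, v, u} k) (X : A.carrier) :
    (A.family X).obj 0 ≅ X :=
  Iso.refl X

/-! ### The graded `(Q, Π)`-supercategory of a `(Q, Π)`-category -/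

namespace Super

variable {k : Type w} [CommRing k] {A : QPCat.{w, v, u} k}

lemma ofHomog_congr' {X Y : Super A} {i j : Deg} {f : Homog X Y i} {g : Homog X Y j} (h : i = j)
    (hfg : f.1 0 j = g.1 0 j) : ofHomog f = ofHomog g := by
  subst h; exact ofHomog_congr rfl hfg

/-- Composites are compared at index `0`, where the second factor enters through its component at
index `i`. That component is then computed from the one at `0` by `hom_s` or `hom_t`, which is where
signs arise. -/
lemma ofHomog_comp_eq {X Y Y' Z : Super A} {i j i' j' : Deg} {f : Homog X Y i} {g : Homog Y Z j}
    {f' : Homog X Y' i'} {g' : Homog Y' Z j'} (h : i + j = i' + j')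
    (hfg : f.1 0 i ≫ g.1 i (i + j) = f'.1 0 i' ≫ g'.1 i' (i + j)) :
    ofHomog f ≫ ofHomog g = ofHomog f' ≫ ofHomog g' := by
  rw [ofHomog_comp, ofHomog_comp]
  refine ofHomog_congr h ?_
  rw [ShiftFamily.homComp_apply _ _ (zero_add i), ShiftFamily.homComp_apply _ _ (zero_add i'), hfg]

lemma ofHomog_comp_eq' {X Y Z : Super A} {i j l : Deg} {f : Homog X Y i} {g : Homog Y Z j}
    {e : Homog X Z l} (h : i + j = l) (hfg : f.1 0 i ≫ g.1 i l = e.1 0 l) :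
    ofHomog f ≫ ofHomog g = ofHomog e := by
  subst h
  rw [ofHomog_comp]
  refine ofHomog_congr rfl ?_
  rw [ShiftFamily.homComp_apply _ _ (zero_add i), hfg]

/-- The homogeneous isomorphism with a given component. -/
def isoOf {X Y : Super A} {i : Deg} (e : (A.family X.as).obj 0 ≅ (A.family Y.as).obj i) :
    X ≅ Y :=
  haveI : IsIso ((ext X Y i e.hom).1 0 i) := by rw [ext_apply]; infer_instance
  { hom := ofHomog (ext X Y i e.hom)
    inv := ofHomog (ShiftFamily.homInv (ext X Y i e.hom))
    hom_inv_id := by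
      rw [ofHomog_comp, id_eq]
      exact ofHomog_congr' (add_neg_cancel i) (by
        rw [ShiftFamily.homComp_homInv, ShiftFamily.homId_apply])
    inv_hom_id := by
      rw [ofHomog_comp, id_eq]
      exact ofHomog_congr' (neg_add_cancel i) (by
        rw [ShiftFamily.homInv_homComp, ShiftFamily.homId_apply]) }

variable (A)

/-- The isomorphism `Π X ≅ X`, of odd parity. -/
def zeta (X : Super A) : of (A.P.obj X.as) ≅ X :=
  -- The component at index `0` is the structure isomorphism `Π X_0 ≅ X_{e₂}`.
  isoOf (i := e₂) (A.familyZero _ ≪≫ A.P.mapIso (A.familyZero X.as).symm ≪≫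
    (A.family X.as).t (zero_add e₂))

/-- The isomorphism `Q X ≅ X`, of degree `-1`. -/
def sigma (X : Super A) : of (A.Q.functor.obj X.as) ≅ X :=
  isoOf (i := -e₁) (A.familyZero _ ≪≫ A.Q.functor.mapIso (A.familyZero X.as).symm ≪≫
    (A.family X.as).s (neg_add_cancel e₁))

/-- The isomorphism `Q⁻¹ X ≅ X`, of degree `1`. -/
def sigma' (X : Super A) : of (A.Q.inverse.obj X.as) ≅ X :=
  -- The object of index `e₁` reduces to `Q⁻¹ X`, so no structure isomorphism is needed.
  isoOf (i := e₁) (A.familyZero _ ≪≫ Iso.refl (A.Q.inverse.obj X.as))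

end Super

/-- The graded `(Q, Π)`-supercategory associated with a `(Q, Π)`-category. -/
abbrev D.obj {k : Type w} [CommRing k] (A : QPCat.{w, v, u} k) : QPSupercat.{w, v, u} k where
  carrier := Super A
  P := conjFunctor (k := k) (Super.zeta A) 1
  Q := conjFunctor (k := k) (Super.sigma A) 0
  Qinv := conjFunctor (k := k) (Super.sigma' A) 0
  ζ := Super.zeta A
  σ := Super.sigma A
  σ' := Super.sigma' A
  hP := isGradedSuperfunctor_conjFunctor (n := 0) fun _ => Super.ofHomog_mem _
  hQ := isGradedSuperfunctor_conjFunctor (n := -1) fun _ => Super.ofHomog_mem _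
  hQinv := isGradedSuperfunctor_conjFunctor (n := 1) fun _ => Super.ofHomog_mem _
  hζ := isSupernatural_conjFunctor fun _ => Super.ofHomog_mem _
  hσ := isSupernatural_conjFunctor fun _ => Super.ofHomog_mem _
  hσ' := isSupernatural_conjFunctor fun _ => Super.ofHomog_mem _

/-! ## A `(Q, Π)`-category is isomorphic to the underlying one of its graded supercategory -/

section Comparison

variable {k : Type w} [CommRing k]

/-- Since `ζ` is odd, `Π ζ = -ζ Π`. This minus sign is the one to be matched by the signs of shift
families and trivializations. -/
lemma xiIso_hom (A : QPSupercat.{w, v, u} k) (X : A.carrier) :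
    (xiIso A X).hom = -((A.ζ (A.P.obj X)).hom ≫ (A.ζ X).hom) := by
  simp [xiIso, P_map_ζ]

/-- A form of the definition of `β_Q` free of inverses: it reconciles the two orders of removing `Π`
and `Q`. -/
lemma betaIso_Q_comp (A : QPSupercat.{w, v, u} k) (X : A.carrier) :
    (betaIso A.Q X).hom ≫ (A.σ (A.P.obj X)).hom ≫ (A.ζ X).hom =
      (A.ζ (A.Q.obj X)).hom ≫ (A.σ X).hom := by
  rw [betaIso_hom A.hQ, Category.assoc, map_σ_assoc, Iso.inv_hom_id, Category.comp_id]

namespace Super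

variable {A : QPCat.{w, v, u} k}

/-- The homogeneous morphism of bidegree zero given by a morphism of the `(Q, Π)`-category. -/
def evHomog {X Y : A.carrier} (f : X ⟶ Y) : Homog (of X) (of Y) 0 :=
  ext (of X) (of Y) 0 ((A.familyZero X).hom ≫ f ≫ (A.familyZero Y).inv)

lemma evHomog_apply {X Y : A.carrier} (f : X ⟶ Y) :
    (evHomog f).1 0 0 = (A.familyZero X).hom ≫ f ≫ (A.familyZero Y).inv := ext_apply _

/-- The even morphism of degree zero given by a morphism of the `(Q, Π)`-category. -/
def ev {X Y : A.carrier} (f : X ⟶ Y) : of X ⟶ of Y := ofHomog (evHomog f)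

lemma ev_mem {X Y : A.carrier} (f : X ⟶ Y) : ev f ∈ homog k (of X) (of Y) 0 := ofHomog_mem _

lemma ev_eq_ofHomog {X Y : A.carrier} {f : X ⟶ Y} {g : Homog (of X) (of Y) 0}
    (h : g.1 0 0 = (A.familyZero X).hom ≫ f ≫ (A.familyZero Y).inv) : ev f = ofHomog g :=
  ofHomog_congr rfl ((evHomog_apply f).trans h.symm)

lemma ev_id (X : A.carrier) : ev (𝟙 X) = 𝟙 (of X) :=
  ev_eq_ofHomog ((ShiftFamily.homId_apply _ _).trans (by simp))

lemma ev_comp {X Y Z : A.carrier} (f : X ⟶ Y) (g : Y ⟶ Z) : ev (f ≫ g) = ev f ≫ ev g :=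
  (ofHomog_comp_eq' (zero_add 0) (by simp [evHomog_apply])).symm

lemma ev_add {X Y : A.carrier} (f g : X ⟶ Y) : ev (f + g) = ev f + ev g := by
  have h : ev f + ev g = ofHomog (evHomog f + evHomog g) :=
    ((inclₗ (of X) (of Y) 0).map_add _ _).symm
  rw [h]
  exact ev_eq_ofHomog (by simp [evHomog_apply])

lemma ev_smul {X Y : A.carrier} (r : k) (f : X ⟶ Y) : ev (r • f) = r • ev f := by
  have h : r • ev f = ofHomog (r • evHomog f) := ((inclₗ (of X) (of Y) 0).map_smul _ _).symm
  rw [h]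
  exact ev_eq_ofHomog (by simp [evHomog_apply])

lemma ev_neg {X Y : A.carrier} (f : X ⟶ Y) : ev (-f) = -ev f := by
  simpa using ev_smul (-1 : k) f

lemma ev_injective {X Y : A.carrier} : Function.Injective (ev : (X ⟶ Y) → (of X ⟶ of Y)) := by
  intro f g h
  have h' := congrArg (fun e : Homog (of X) (of Y) 0 => e.1 0 0) (ofHomog_injective h)
  simpa [evHomog_apply] using h'

/-- With `ev_injective`, the even degree-zero morphisms are exactly those of `A`, because a morphism
of bidegree `0` is determined by its arbitrary component at `(0, 0)`. -/
lemma exists_ev {X Y : Super A} {f : X ⟶ Y} (hf : f ∈ homog k X Y 0) :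
    ∃ g : X.as ⟶ Y.as, ev g = f := by
  obtain ⟨g, rfl⟩ := exists_of_mem hf
  exact ⟨(A.familyZero X.as).inv ≫ g.1 0 0 ≫ (A.familyZero Y.as).hom, ev_eq_ofHomog (by simp)⟩

lemma e₂_add_e₂ : e₂ + e₂ = 0 := by decide

/-- The component of `evHomog f` at `e₂` is `Π f` conjugated by `t`, without a sign because the
parity is even. -/
lemma ev_zeta {X Y : A.carrier} (f : X ⟶ Y) :
    ev (A.P.map f) ≫ (zeta A (of Y)).hom = (zeta A (of X)).hom ≫ ev f := by
  refine ofHomog_comp_eq (add_comm _ _) ?_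
  rw [ext_apply, evHomog_apply, zero_add, ext_apply]
  have h := ShiftFamily.hom_t (evHomog f) (zero_add e₂) (zero_add e₂)
  rw [evHomog_apply] at h
  simp only [Functor.map_comp, Category.assoc, Prod.snd_zero, sgn_zero, one_smul] at h
  simp [← h]

lemma ev_sigma {X Y : A.carrier} (f : X ⟶ Y) :
    ev (A.Q.functor.map f) ≫ (sigma A (of Y)).hom = (sigma A (of X)).hom ≫ ev f := by
  refine ofHomog_comp_eq (add_comm _ _) ?_
  rw [ext_apply, evHomog_apply, zero_add, ext_apply]
  have h := ShiftFamily.hom_s (evHomog f) (neg_add_cancel e₁) (neg_add_cancel e₁)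
  rw [evHomog_apply] at h
  simp only [Functor.map_comp, Category.assoc] at h
  simp [-Prod.neg_mk, ← h]

/-- Moving the odd morphism `ζ` from index `0` to `e₂` costs a sign; what remains is the composite
of two maps `t`, which is `ξ`. -/
lemma zeta_zeta (X : A.carrier) :
    (zeta A (of (A.P.obj X))).hom ≫ (zeta A (of X)).hom = -ev (A.ξ.hom.app X) := by
  have := A.P_additive
  rw [← ev_neg]
  refine ofHomog_comp_eq' e₂_add_e₂ ?_
  rw [evHomog_apply, ext_apply]
  have h := ShiftFamily.hom_t (ext _ _ _ (A.familyZero _ ≪≫ A.P.mapIso (A.familyZero X).symm ≪≫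
    (A.family X).t (zero_add e₂)).hom : Homog (of (A.P.obj X)) (of X) e₂)
    (zero_add e₂) e₂_add_e₂
  rw [ext_apply] at h
  have h1 := (A.family X).t_t (zero_add e₂) e₂_add_e₂
  have h2 := A.ξ.hom.naturality (A.familyZero X).inv
  simp only [Functor.comp_map, Functor.id_map] at h2
  simp only [Iso.trans_hom, Functor.mapIso_hom, Iso.symm_hom, Functor.map_comp, Category.assoc,
    h1, sgn_one, h2] at h
  have h3 := congrArg Neg.neg h
  simp only [neg_smul, one_smul, neg_neg] at h3
  simp [← h3, ← Functor.map_comp_assoc]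

/-- Evaluated at index `0`, both sides are composites of structure maps `s` and `t`, and they agree
by `s_t` and naturality of `β_Q`. -/
lemma ev_beta (X : A.carrier) :
    ev (A.βQ.hom.app X) ≫ (sigma A (of (A.P.obj X))).hom ≫ (zeta A (of X)).hom =
      (zeta A (of (A.Q.functor.obj X))).hom ≫ (sigma A (of X)).hom := by
  let S (Y : A.carrier) : Homog (of (A.Q.functor.obj Y)) (of Y) (-e₁) :=
    ext _ _ _ (A.familyZero _ ≪≫ A.Q.functor.mapIso (A.familyZero Y).symm ≪≫
      (A.family Y).s (neg_add_cancel e₁)).hom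
  let Z (Y : A.carrier) : Homog (of (A.P.obj Y)) (of Y) e₂ :=
    ext _ _ _ (A.familyZero _ ≪≫ A.P.mapIso (A.familyZero Y).symm ≪≫
      (A.family Y).t (zero_add e₂)).hom
  have hS : ∀ Y, (S Y).1 0 (-e₁) = _ := fun Y => ext_apply _
  have hZ : ∀ Y, (Z Y).1 0 e₂ = _ := fun Y => ext_apply _
  change ofHomog (evHomog _) ≫ ofHomog (S _) ≫ ofHomog (Z _) = ofHomog (Z _) ≫ ofHomog (S _)
  rw [ofHomog_comp (S _)]
  refine ofHomog_comp_eq (by abel) ?_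
  have h₀ : e₂ + -e₁ = -e₁ + e₂ := add_comm _ _
  have h₁ : 0 + (-e₁ + e₂) = -e₁ + e₂ := zero_add _
  rw [h₁, ShiftFamily.homComp_apply _ _ (zero_add (-e₁)), evHomog_apply]
  have hs := ShiftFamily.hom_s (Z X) (a' := e₂) (b' := -e₁ + e₂) (neg_add_cancel e₁) (by abel)
  have ht := ShiftFamily.hom_t (S X) (a' := -e₁) (b' := -e₁ + e₂) (zero_add e₂) rfl
  have hst := (A.family X).s_t (a' := e₂) (b' := -e₁ + e₂) (neg_add_cancel e₁) (by abel)
    (zero_add e₂) rfl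
  have hβ := A.βQ.hom.naturality (A.familyZero X).inv
  rw [hS, Prod.snd_neg, neg_zero, sgn_zero, one_smul] at ht
  rw [hZ] at hs
  rw [hS, hZ]
  simp only [Functor.comp_map, Iso.trans_hom, Functor.mapIso_hom, Iso.symm_hom,
    Functor.map_comp, Category.assoc] at hs ht hβ ⊢
  rw [Iso.inv_hom_id_assoc, ← ht, ← hs, hst, reassoc_of% hβ, Iso.map_inv_hom_id_assoc,
    Iso.map_inv_hom_id_assoc]

end Super

end Comparison

/-! ### The comparison functors and `(Q, Π)`-functors into underlying categories -/

section Comparison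

variable {k : Type w} [CommRing k]

variable (A : QPCat.{w, v, u} k)

open Super

/-- The morphism corresponding to an even morphism of degree zero. -/
def Super.unev {A : QPCat.{w, v, u} k} {X Y : Super A} (f : X ⟶ Y) (hf : f ∈ homog k X Y 0) :
    X.as ⟶ Y.as :=
  (exists_ev hf).choose

lemma Super.ev_unev {A : QPCat.{w, v, u} k} {X Y : Super A} (f : X ⟶ Y)
    (hf : f ∈ homog k X Y 0) : ev (unev f hf) = f :=
  (exists_ev hf).choose_spec

/-- The comparison functor from a `(Q, Π)`-category. -/
def toUnderlying : A.carrier ⥤ Underlying k (Super A) where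
  obj X := .of (.of X)
  map f := Underlying.mk (ev f) (ev_mem f)
  map_id X := Underlying.hom_ext (ev_id X)
  map_comp f g := Underlying.hom_ext (ev_comp f g)

/-- The comparison functor to a `(Q, Π)`-category. -/
def fromUnderlying : Underlying k (Super A) ⥤ A.carrier where
  obj X := X.as.as
  map f := unev (Underlying.val f) (Underlying.val_mem f)
  map_id X := ev_injective ((ev_unev _ _).trans (ev_id _).symm)
  map_comp f g := ev_injective ((ev_unev _ _).trans (by rw [ev_comp, ev_unev, ev_unev]; rfl))

variable {A}

lemma ev_fromUnderlying_map {X Y : Underlying k (Super A)} (f : X ⟶ Y) :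
    ev ((fromUnderlying A).map f) = Underlying.val f :=
  ev_unev _ (Underlying.val_mem f)

lemma fromUnderlying_map_eq {X Y : Underlying k (Super A)} {f : X ⟶ Y} {g : X.as.as ⟶ Y.as.as}
    (h : Underlying.val f = ev g) : (fromUnderlying A).map f = g :=
  ev_injective ((ev_fromUnderlying_map f).trans h)

/-- A functor into the underlying category of a supercategory that carries `Π` and `Q` to objects
identified by homogeneous isomorphisms of the right bidegrees is a `(Q, Π)`-functor. -/
def QPFunctor.toE {B : QPSupercat.{w, v, u} k}
    (F : A.carrier ⥤ Underlying k B.carrier) (hadd : F.Additive) (hlin : F.Linear k)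
    (z : ∀ X, (F.obj (A.P.obj X)).as ≅ (F.obj X).as)
    (y : ∀ X, (F.obj (A.Q.functor.obj X)).as ≅ (F.obj X).as)
    (hz : ∀ X, (z X).hom ∈ homog k (F.obj (A.P.obj X)).as (F.obj X).as (0, 1))
    (hy : ∀ X, (y X).hom ∈ homog k (F.obj (A.Q.functor.obj X)).as (F.obj X).as (-1, 0))
    (z_nat : ∀ {X Y} (f : X ⟶ Y), Underlying.val (F.map (A.P.map f)) ≫ (z Y).hom =
      (z X).hom ≫ Underlying.val (F.map f))
    (y_nat : ∀ {X Y} (f : X ⟶ Y), Underlying.val (F.map (A.Q.functor.map f)) ≫ (y Y).hom =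
      (y X).hom ≫ Underlying.val (F.map f))
    (z_z : ∀ X, (z (A.P.obj X)).hom ≫ (z X).hom = -Underlying.val (F.map (A.ξ.hom.app X)))
    (z_y : ∀ X, Underlying.val (F.map (A.βQ.hom.app X)) ≫ (y (A.P.obj X)).hom ≫ (z X).hom =
      (z (A.Q.functor.obj X)).hom ≫ (y X).hom) :
    QPFunctor A (E.obj B) :=
  -- The structure isomorphisms are `ζ ≫ z⁻¹` and `σ ≫ y⁻¹`, whose bidegrees cancel.
  have hβ : ∀ X, (B.ζ (F.obj X).as ≪≫ (z X).symm).hom ∈ homog k _ _ 0 := fun X =>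
    GradedSupercategory.comp_mem (i := (0, 1)) (j := (0, 1)) (B.hζ.mem _) (inv_mem (z X) (hz X))
  have hγ : ∀ X, (B.σ (F.obj X).as ≪≫ (y X).symm).hom ∈ homog k _ _ 0 := fun X =>
    GradedSupercategory.comp_mem (i := (-1, 0)) (j := (1, 0)) (B.hσ.mem _) (inv_mem (y X) (hy X))
  { functor := F
    additive := hadd
    linear := hlin
    β := NatIso.ofComponents
      (fun X => Underlying.isoMk (B.ζ (F.obj X).as ≪≫ (z X).symm) (hβ X))
      (fun {X Y} f => Underlying.hom_ext (by
        change B.P.map (Underlying.val (F.map f)) ≫ (B.ζ (F.obj Y).as).hom ≫ (z Y).inv =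
          ((B.ζ (F.obj X).as).hom ≫ (z X).inv) ≫ Underlying.val (F.map (A.P.map f))
        rw [← Category.assoc, map_ζ_even B (Underlying.val_mem (F.map f)), Iso.comp_inv_eq]
        simp [z_nat]))
    γ := NatIso.ofComponents
      (fun X => Underlying.isoMk (B.σ (F.obj X).as ≪≫ (y X).symm) (hγ X))
      (fun {X Y} f => Underlying.hom_ext (by
        change B.Q.map (Underlying.val (F.map f)) ≫ (B.σ (F.obj Y).as).hom ≫ (y Y).inv =
          ((B.σ (F.obj X).as).hom ≫ (y X).inv) ≫ Underlying.val (F.map (A.Q.functor.map f))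
        rw [map_σ_assoc, ← Category.assoc, Iso.comp_inv_eq]
        simp [y_nat]))
    β_ξ := fun X => Underlying.hom_ext (by
      change (xiIso B (F.obj X).as).hom ≫ Underlying.val (F.map (A.ξ.inv.app X)) =
        B.P.map ((B.ζ (F.obj X).as).hom ≫ (z X).inv) ≫
          (B.ζ (F.obj (A.P.obj X)).as).hom ≫ (z (A.P.obj X)).inv
      have h := map_ζ_even B (hβ X)
      -- Inverting `z_z`; its minus sign cancels the one in `xiIso_hom`.
      have h' : Underlying.val (F.map (A.ξ.inv.app X)) =
          -((z X).inv ≫ (z (A.P.obj X)).inv) := by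
        have h₁ : Underlying.val (F.map (A.ξ.hom.app X)) ≫
            Underlying.val (F.map (A.ξ.inv.app X)) = 𝟙 _ := by
          rw [← Underlying.val_comp, ← F.map_comp, Iso.hom_inv_id_app, F.map_id]; rfl
        have h₂ : Underlying.val (F.map (A.ξ.hom.app X)) =
            -((z (A.P.obj X)).hom ≫ (z X).hom) := by rw [z_z, neg_neg]
        rw [h₂] at h₁
        rw [← cancel_epi (z X).hom, ← cancel_epi (z (A.P.obj X)).hom, ← neg_inj]
        simpa using h₁
      rw [Iso.trans_hom, Iso.symm_hom] at h
      rw [reassoc_of% h, xiIso_hom, h']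
      simp)
    β_γ := fun X => Underlying.hom_ext (by
      change B.P.map ((B.σ (F.obj X).as).hom ≫ (y X).inv) ≫
          ((B.ζ (F.obj (A.Q.functor.obj X)).as).hom ≫ (z (A.Q.functor.obj X)).inv) ≫
            Underlying.val (F.map (A.βQ.hom.app X)) =
        (betaIso B.Q (F.obj X).as).hom ≫ B.Q.map ((B.ζ (F.obj X).as).hom ≫ (z X).inv) ≫
          (B.σ (F.obj (A.P.obj X)).as).hom ≫ (y (A.P.obj X)).inv
      have h := map_ζ_even B (hγ X)
      have h₁ := betaIso_Q_comp B (F.obj X).as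
      rw [Iso.trans_hom, Iso.symm_hom] at h
      simp only [Category.assoc] at h ⊢
      rw [map_σ_assoc, Category.assoc, reassoc_of% h₁, reassoc_of% h]
      congr 2
      rw [Iso.inv_comp_eq, Iso.inv_comp_eq, ← reassoc_of% z_y]
      simp) }

/-! ### Inverses of fully faithful `(Q, Π)`-functors -/

/-- The inverse of a fully faithful `(Q, Π)`-functor. -/
def QPFunctor.inverse {B : QPCat.{w, v, u} k} (F : QPFunctor A B) (hF : F.functor.FullyFaithful)
    (G : B.carrier ⥤ A.carrier) (η : ∀ X, F.functor.obj (G.obj X) ≅ X)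
    (hη : ∀ X Y (f : X ⟶ Y), F.functor.map (G.map f) ≫ (η Y).hom = (η X).hom ≫ f) :
    QPFunctor B A :=
  -- Every axiom for the inverse is verified after applying the faithful functor `F`, where `h₁`,
  -- `hβ` and `hγ` express everything through `η` and the structure of `F`.
  have h₁ : ∀ {X Y} (f : X ⟶ Y), F.functor.map (G.map f) = (η X).hom ≫ f ≫ (η Y).inv :=
    fun {X Y} f => by rw [← reassoc_of% hη X Y f]; simp
  have hβ : ∀ {X Y} (f : X ⟶ Y), F.functor.map (A.P.map f) =
      F.β.inv.app X ≫ B.P.map (F.functor.map f) ≫ F.β.hom.app Y := fun {X Y} f => by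
    have := F.β.hom.naturality f
    simp only [Functor.comp_map] at this
    rw [this]; simp
  have hγ : ∀ {X Y} (f : X ⟶ Y), F.functor.map (A.Q.functor.map f) =
      F.γ.inv.app X ≫ B.Q.functor.map (F.functor.map f) ≫ F.γ.hom.app Y := fun {X Y} f => by
    have := F.γ.hom.naturality f
    simp only [Functor.comp_map] at this
    rw [this]; simp
  { functor := G
    additive := ⟨fun {X Y f g} => hF.map_injective (by
      have := F.additive
      simp [h₁])⟩
    linear := ⟨fun {X Y} f r => hF.map_injective (by
      have := F.linear
      simp [h₁])⟩
    -- Forced by the requirement that `η` be compatible with `β`; likewise for `γ`.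
    β := NatIso.ofComponents (fun X => hF.preimageIso ((F.β.app (G.obj X)).symm ≪≫
        B.P.mapIso (η X) ≪≫ (η (B.P.obj X)).symm)) (fun {X Y} f => hF.map_injective (by
      have h := F.β.inv.naturality (G.map f)
      simp only [Functor.comp_map] at h
      simp [h₁, reassoc_of% h]))
    γ := NatIso.ofComponents (fun X => hF.preimageIso ((F.γ.app (G.obj X)).symm ≪≫
        B.Q.functor.mapIso (η X) ≪≫ (η (B.Q.functor.obj X)).symm))
        (fun {X Y} f => hF.map_injective (by
      have h := F.γ.inv.naturality (G.map f)
      simp only [Functor.comp_map] at h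
      simp [h₁, reassoc_of% h]))
    β_ξ := fun X => hF.map_injective (by
      have h := F.β_ξ (G.obj X)
      have h₂ := B.ξ.hom.naturality ((η X).hom)
      rw [← cancel_epi (F.β.hom.app (A.P.obj (G.obj X))),
        ← cancel_epi (B.P.map (F.β.hom.app (G.obj X)))]
      simp only [Functor.comp_obj, Functor.comp_map, Functor.id_map] at h h₂
      rw [← reassoc_of% h, F.functor.map_comp]
      have h₃ := congrArg F.functor.map (A.ξ.inv_hom_id_app (G.obj X))
      simp only [Functor.map_comp, Functor.id_obj] at h₃
      simp [reassoc_of% h₃, h₁, hβ, ← reassoc_of% h₂])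
    β_γ := fun X => hF.map_injective (by
      have h := F.β_γ (G.obj X)
      have h₂ := B.βQ.hom.naturality ((η X).hom)
      rw [← cancel_epi (F.β.hom.app (A.Q.functor.obj (G.obj X))),
        ← cancel_epi (B.P.map (F.γ.hom.app (G.obj X)))]
      simp only [Functor.comp_obj, Functor.comp_map] at h h₂
      simp [h₁, hβ, hγ, reassoc_of% h, reassoc_of% h₂]) }

section

variable {B : QPCat.{w, v, u} k} (F : QPFunctor A B) (hF : F.functor.FullyFaithful)
  (G : B.carrier ⥤ A.carrier) (η : ∀ X, F.functor.obj (G.obj X) ≅ X)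
  (hη : ∀ X Y (f : X ⟶ Y), F.functor.map (G.map f) ≫ (η Y).hom = (η X).hom ≫ f)

lemma QPFunctor.map_inverse_β (X : B.carrier) :
    F.functor.map ((F.inverse hF G η hη).β.hom.app X) =
      F.β.inv.app (G.obj X) ≫ B.P.map (η X).hom ≫ (η (B.P.obj X)).inv := by
  simp [QPFunctor.inverse]

lemma QPFunctor.map_inverse_γ (X : B.carrier) :
    F.functor.map ((F.inverse hF G η hη).γ.hom.app X) =
      F.γ.inv.app (G.obj X) ≫ B.Q.functor.map (η X).hom ≫ (η (B.Q.functor.obj X)).inv := by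
  simp [QPFunctor.inverse]

end

section

variable {B : QPCat.{w, v, u} k} (F : QPFunctor A B) (hF : F.functor.FullyFaithful)
  (G : QPFunctor B A) (η : ∀ X, F.functor.obj (G.functor.obj X) ≅ X)
  (hη : ∀ X Y (f : X ⟶ Y), F.functor.map (G.functor.map f) ≫ (η Y).hom = (η X).hom ≫ f)
  (hβ : ∀ X, F.functor.map (G.β.hom.app X) =
      F.β.inv.app (G.functor.obj X) ≫ B.P.map (η X).hom ≫ (η (B.P.obj X)).inv)
  (hγ : ∀ X, F.functor.map (G.γ.hom.app X) =
      F.γ.inv.app (G.functor.obj X) ≫ B.Q.functor.map (η X).hom ≫ (η (B.Q.functor.obj X)).inv)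

include hβ hγ

/-- The counit of the inverse of a fully faithful `(Q, Π)`-functor. -/
def QPFunctor.inverseCounit : QPTrans (G.comp F) (QPFunctor.id B) where
  trans := { app := fun X => (η X).hom, naturality := fun _ _ f => hη _ _ f }
  comm_β X := by
    change (F.β.hom.app (G.functor.obj X) ≫ F.functor.map (G.β.hom.app X)) ≫
      (η (B.P.obj X)).hom = B.P.map (η X).hom ≫ 𝟙 _
    rw [hβ]
    simp
  comm_γ X := by
    change (F.γ.hom.app (G.functor.obj X) ≫ F.functor.map (G.γ.hom.app X)) ≫
      (η (B.Q.functor.obj X)).hom = B.Q.functor.map (η X).hom ≫ 𝟙 _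
    rw [hγ]
    simp

/-- The inverse of the unit of the inverse of a fully faithful `(Q, Π)`-functor. -/
def QPFunctor.inverseUnit : QPTrans (F.comp G) (QPFunctor.id A) where
  trans :=
    { app := fun X => hF.preimage (η (F.functor.obj X)).hom
      naturality := fun X Y f => hF.map_injective (by
        change F.functor.map (G.functor.map (F.functor.map f) ≫
          hF.preimage (η (F.functor.obj Y)).hom) =
            F.functor.map (hF.preimage (η (F.functor.obj X)).hom ≫ f)
        simp [hη]) }
  comm_β X := hF.map_injective (by
    change F.functor.map ((G.β.hom.app (F.functor.obj X) ≫ G.functor.map (F.β.hom.app X)) ≫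
      hF.preimage (η (F.functor.obj (A.P.obj X))).hom) =
        F.functor.map (A.P.map (hF.preimage (η (F.functor.obj X)).hom) ≫ 𝟙 _)
    have h := F.β.hom.naturality (hF.preimage (η (F.functor.obj X)).hom)
    have h' := hη _ _ (F.β.hom.app X)
    simp only [Functor.comp_map, Functor.comp_obj, hF.map_preimage] at h h'
    simp [hβ, h, h'])
  comm_γ X := hF.map_injective (by
    change F.functor.map ((G.γ.hom.app (F.functor.obj X) ≫ G.functor.map (F.γ.hom.app X)) ≫
      hF.preimage (η (F.functor.obj (A.Q.functor.obj X))).hom) =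
        F.functor.map (A.Q.functor.map (hF.preimage (η (F.functor.obj X)).hom) ≫ 𝟙 _)
    have h := F.γ.hom.naturality (hF.preimage (η (F.functor.obj X)).hom)
    have h' := hη _ _ (F.γ.hom.app X)
    simp only [Functor.comp_map, Functor.comp_obj, hF.map_preimage] at h h'
    simp [hγ, h, h'])

end

/-- For a transformation whose components are casts, `(Q, Π)`-naturality says precisely that the `β`
and `γ` of both functors agree. -/
lemma QPFunctor.ext_of_trans {B : QPCat.{w, v, u} k} {F G : QPFunctor A B} (x : QPTrans F G)
    (h : F.functor = G.functor) (hx : ∀ X, x.trans.app X = eqToHom (by rw [h])) : F = G := by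
  have hβ := x.comm_β
  have hγ := x.comm_γ
  simp only [hx] at hβ hγ
  exact QPFunctor.ext_of_app h hβ hγ

/-! ### The strict isomorphism between `A` and `E (D A)` -/

variable (A)

/-- The comparison `(Q, Π)`-functor from a `(Q, Π)`-category to the underlying `(Q, Π)`-category
of its graded supercategory. -/
def toED : QPFunctor A (E.obj (D.obj A)) :=
  QPFunctor.toE (B := D.obj A) (toUnderlying A)
    ⟨Underlying.hom_ext (ev_add _ _)⟩
    ⟨fun _ _ => Underlying.hom_ext (ev_smul _ _)⟩
    (fun X => zeta A (of X)) (fun X => sigma A (of X))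
    (fun _ => ofHomog_mem _) (fun _ => ofHomog_mem _) ev_zeta ev_sigma zeta_zeta ev_beta

/-- The comparison functor to the underlying category is fully faithful. -/
def toUnderlyingFullyFaithful : (toUnderlying A).FullyFaithful where
  preimage f := (fromUnderlying A).map f
  map_preimage f := Underlying.hom_ext (ev_fromUnderlying_map f)
  preimage_map _ := fromUnderlying_map_eq rfl

/-- The comparison `(Q, Π)`-functor to a `(Q, Π)`-category from the underlying `(Q, Π)`-category
of its graded supercategory. -/
def fromED : QPFunctor (E.obj (D.obj A)) A :=
  QPFunctor.inverse (toED A) (toUnderlyingFullyFaithful A) (fromUnderlying A)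
    (fun _ => Iso.refl _)
    (fun _ _ f => (Category.comp_id _).trans <|
      ((toUnderlyingFullyFaithful A).map_preimage f).trans (Category.id_comp _).symm)

lemma toED_map_fromED_map {X Y : (E.obj (D.obj A)).carrier} (f : X ⟶ Y) :
    (toED A).functor.map ((fromED A).functor.map f) = f :=
  (toUnderlyingFullyFaithful A).map_preimage f

/-- The comparison functors are inverse to each other definitionally on objects, and the unit has
identity components, so the isomorphism is an equality. -/
lemma toED_comp_fromED : (toED A).comp (fromED A) = QPFunctor.id A :=
  QPFunctor.ext_of_trans (QPFunctor.inverseUnit (toED A) (toUnderlyingFullyFaithful A) (fromED A)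
      (fun _ => Iso.refl _)
      (fun _ _ f => (Category.comp_id _).trans <|
        (toED_map_fromED_map A f).trans (Category.id_comp _).symm)
      (QPFunctor.map_inverse_β _ _ _ _ _) (QPFunctor.map_inverse_γ _ _ _ _ _))
    (CategoryTheory.Functor.ext (fun _ => rfl) (fun _ _ _ =>
      (fromUnderlying_map_eq rfl).trans ((Category.id_comp _).trans (Category.comp_id _)).symm))
    (fun X => fromUnderlying_map_eq (X := .of (.of X)) (Y := .of (.of X)) (ev_id X).symm)

lemma fromED_comp_toED : (fromED A).comp (toED A) = QPFunctor.id (E.obj (D.obj A)) :=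
  QPFunctor.ext_of_trans (QPFunctor.inverseCounit (toED A) (fromED A) (fun _ => Iso.refl _)
      (fun _ _ f => (Category.comp_id _).trans <|
        (toED_map_fromED_map A f).trans (Category.id_comp _).symm)
      (QPFunctor.map_inverse_β _ _ _ _ _) (QPFunctor.map_inverse_γ _ _ _ _ _))
    (CategoryTheory.Functor.ext (fun _ => rfl) (fun _ _ f =>
      (toED_map_fromED_map A f).trans
        ((Category.id_comp _).trans (Category.comp_id _)).symm))
    (fun _ => rfl)
end Comparison

/-! ## Functors and shift families -/

section Image

variable {k : Type w} [CommRing k] {A B : QPCat.{w, v, u} k}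

namespace QPFunctor

variable (F : QPFunctor A B)

/-- The image of a shift family under a `(Q, Π)`-functor. -/
def mapFamily (U : ShiftFamily A) : ShiftFamily B where
  obj a := F.functor.obj (U.obj a)
  s {a b} h := F.γ.app (U.obj a) ≪≫ F.functor.mapIso (U.s h)
  t {a b} h := F.β.app (U.obj a) ≪≫ F.functor.mapIso (U.t h)
  -- Here the axiom on `β_F` and `ξ` enters; `s_t` below uses the one relating `β_F`, `γ_F` and
  -- `β_Q`.
  t_t {a b} h h' := by
    have h1 := F.β.hom.naturality (U.t h).hom
    have h2 := F.β_ξ (U.obj a)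
    have h3 := congrArg F.functor.map (U.t_t h h')
    have h4 := congrArg F.functor.map (A.ξ.inv_hom_id_app (U.obj a))
    simp only [Functor.comp_obj, Functor.comp_map, Functor.map_comp, Functor.id_obj] at h1 h2 h3 h4
    simp only [Functor.comp_obj, Iso.trans_hom, Iso.app_hom, Functor.mapIso_hom, Functor.map_comp,
      Category.assoc]
    rw [reassoc_of% h1, ← reassoc_of% h2, h3, h4]
    simp
  s_t {a b a' b'} h h' l l' := by
    have h1 := F.β.hom.naturality (U.s h).hom
    have h2 := F.β_γ (U.obj a)
    have h3 := congrArg F.functor.map (U.s_t h h' l l')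
    have h4 := F.γ.hom.naturality (U.t l).hom
    simp only [Functor.comp_obj, Functor.comp_map, Functor.map_comp] at h1 h2 h3 h4
    simp only [Functor.comp_obj, Iso.trans_hom, Iso.app_hom, Functor.mapIso_hom, Functor.map_comp,
      Category.assoc]
    rw [reassoc_of% h1, h3, reassoc_of% h2, reassoc_of% h4]

/-- The image of a morphism of shift families under a `(Q, Π)`-functor. -/
def mapHom {U V : ShiftFamily A} {i : Deg} (f : ShiftFamily.hom U V i) :
    ShiftFamily.hom (F.mapFamily U) (F.mapFamily V) i where
  val a b := F.functor.map (f.1 a b)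
  property := by
    have := F.additive
    refine ⟨fun a b h => ?_, fun {a b a' b'} h h' => ?_, fun {a b a' b'} h h' => ?_⟩ <;>
      beta_reduce
    · rw [ShiftFamily.hom_apply_eq_zero f h, Functor.map_zero]; rfl
    · have h1 := F.γ.hom.naturality (f.1 a a')
      have h2 := congrArg F.functor.map (ShiftFamily.hom_s f h h')
      simp only [Functor.comp_map, Functor.map_comp] at h1 h2
      simp [mapFamily, reassoc_of% h1, h2]
    · have h1 := F.β.hom.naturality (f.1 a a')
      have h2 := congrArg F.functor.map (ShiftFamily.hom_t f h h')
      simp only [Functor.comp_map, Functor.map_comp, Functor.map_zsmul] at h1 h2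
      simp [mapFamily, reassoc_of% h1, h2]; rfl

end QPFunctor

end Image

/-! ## Trivializations of shift families in underlying categories -/

section Trivialization

variable {k : Type w} [CommRing k] {B : QPSupercat.{w, v, u} k}

lemma homog_congr {C : Type u} [Category.{v} C] [Preadditive C] [Linear k C]
    [GradedSupercategory k C] {X Y : C} {i j : Deg} (h : i = j) {f : X ⟶ Y}
    (hf : f ∈ homog k X Y i) : f ∈ homog k X Y j := h ▸ hf

/-- An isomorphism multiplied by the sign `(-1)^p`. -/
def sgnIso {C : Type u} [Category.{v} C] [Preadditive C] (p : ZMod 2) {X Y : C} (e : X ≅ Y) :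
    X ≅ Y where
  hom := sgn p • e.hom
  inv := sgn p • e.inv
  hom_inv_id := by simp [smul_smul, sgn_mul_self]
  inv_hom_id := by simp [smul_smul, sgn_mul_self]

namespace E

/-- An object of the underlying category, viewed in the graded supercategory. -/
abbrev as (X : (E.obj B).carrier) : B.carrier := Underlying.as X

/-- An object of the graded supercategory, viewed in the underlying category. -/
abbrev of (X : B.carrier) : (E.obj B).carrier := Underlying.of X

/-- A morphism of the underlying category, viewed in the graded supercategory. -/
def val {X Y : (E.obj B).carrier} (f : X ⟶ Y) : as X ⟶ as Y := Underlying.val f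

/-- An even morphism of degree zero, viewed in the underlying category. -/
def mk {X Y : (E.obj B).carrier} (f : as X ⟶ as Y) (hf : f ∈ homog k (as X) (as Y) 0) : X ⟶ Y :=
  Underlying.mk f hf

variable {X Y Z : (E.obj B).carrier}

lemma val_mem (f : X ⟶ Y) : val f ∈ homog k (as X) (as Y) 0 := Underlying.val_mem f

@[simp] lemma val_mk (f : as X ⟶ as Y) (hf : f ∈ homog k (as X) (as Y) 0) :
    val (mk f hf : X ⟶ Y) = f := rfl

@[simp] lemma val_comp (f : X ⟶ Y) (g : Y ⟶ Z) : val (f ≫ g) = val f ≫ val g := rfl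

lemma hom_ext {f g : X ⟶ Y} (h : val f = val g) : f = g := Underlying.hom_ext h

/-- The isomorphism of the graded supercategory underlying an isomorphism in its underlying
category. -/
def valIso (e : X ≅ Y) : as X ≅ as Y where
  hom := val e.hom
  inv := val e.inv
  hom_inv_id := congrArg val e.hom_inv_id
  inv_hom_id := congrArg val e.inv_hom_id

lemma valIso_mem (e : X ≅ Y) : (valIso e).hom ∈ homog k (as X) (as Y) 0 := val_mem e.hom

lemma val_zsmul (n : ℤ) (f : X ⟶ Y) : val (n • f) = n • val f :=
  map_zsmul (Submodule.subtype (homog k (as X) (as Y) 0)) n f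

end E

namespace ShiftFamily

variable (U V : ShiftFamily (E.obj B))

/-- The objects of the graded supercategory in a shift family of its underlying category. -/
abbrev objVal (a : Deg) : B.carrier := E.as (U.obj a)

/-- The isomorphism `Q U_a ≅ U_b` in the graded supercategory. -/
def sVal {a b : Deg} (h : b + e₁ = a) : B.Q.obj (U.objVal a) ≅ U.objVal b :=
  E.valIso (U.s h)

/-- The isomorphism `Π U_a ≅ U_b` in the graded supercategory. -/
def tVal {a b : Deg} (h : a + e₂ = b) : B.P.obj (U.objVal a) ≅ U.objVal b :=
  E.valIso (U.t h)

lemma sVal_mem {a b : Deg} (h : b + e₁ = a) :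
    (U.sVal h).hom ∈ homog k (B.Q.obj (U.objVal a)) (U.objVal b) 0 :=
  E.valIso_mem (U.s h)

lemma tVal_mem {a b : Deg} (h : a + e₂ = b) :
    (U.tVal h).hom ∈ homog k (B.P.obj (U.objVal a)) (U.objVal b) 0 :=
  E.valIso_mem (U.t h)

lemma tVal_tVal {a b : Deg} (h : a + e₂ = b) (h' : b + e₂ = a) :
    B.P.map (U.tVal h).hom ≫ (U.tVal h').hom = (xiIso B (U.objVal a)).hom :=
  congrArg E.val (U.t_t h h')

lemma sVal_tVal {a b a' b' : Deg} (h : b + e₁ = a) (h' : b' + e₁ = a') (l : a + e₂ = a')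
    (l' : b + e₂ = b') : B.P.map (U.sVal h).hom ≫ (U.tVal l').hom =
      (betaIso B.Q (U.objVal a)).hom ≫ B.Q.map (U.tVal l).hom ≫ (U.sVal h').hom :=
  congrArg E.val (U.s_t h h' l l')

variable {U V}

/-- To give a morphism of shift families it suffices to give homogeneous morphisms in the graded
supercategory. -/
def homMkVal {i : Deg} (f : ∀ a b : Deg, U.objVal a ⟶ V.objVal b)
    (hf : ∀ a b, a + i = b → f a b ∈ homog k (U.objVal a) (V.objVal b) 0)
    (hs : ∀ {a b a' b'} (h : b + e₁ = a) (h' : b' + e₁ = a') (_ : a + i = a') (_ : b + i = b'),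
      B.Q.map (f a a') ≫ (V.sVal h').hom = (U.sVal h).hom ≫ f b b')
    (ht : ∀ {a b a' b'} (h : a + e₂ = b) (h' : a' + e₂ = b') (_ : a + i = a') (_ : b + i = b'),
      B.P.map (f a a') ≫ (V.tVal h').hom = sgn i.2 • ((U.tVal h).hom ≫ f b b')) :
    hom U V i :=
  homMk (fun a b h => E.mk (f a b) (hf a b h))
    (fun h h' l l' => E.hom_ext (hs h h' l l'))
    (fun {_ b _ b'} h h' l l' => E.hom_ext ((ht h h' l l').trans
      (E.val_zsmul _ ((U.t h).hom ≫ E.mk (f b b') (hf b b' l'))).symm))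

lemma val_homMkVal_apply {i : Deg} {f : ∀ a b : Deg, U.objVal a ⟶ V.objVal b} {hf hs ht}
    {a b : Deg} (h : a + i = b) :
    E.val ((homMkVal f hf hs ht : hom U V i).1 a b) = f a b := by
  rw [homMkVal, homMk_apply h, E.val_mk]

variable (U) in
/-- A trivialization of a shift family in an underlying category: compatible isomorphisms with a
given object, homogeneous of the bidegree given by the index. -/
structure Triv (Y : B.carrier) where
  c : ∀ a, U.objVal a ≅ Y
  mem : ∀ a, (c a).hom ∈ homog k (U.objVal a) Y a
  s : ∀ {a b : Deg} (h : b + e₁ = a), (U.sVal h).hom ≫ (c b).hom = (B.σ _).hom ≫ (c a).hom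
  t : ∀ {a b : Deg} (h : a + e₂ = b),
    (U.tVal h).hom ≫ (c b).hom = sgn a.2 • ((B.ζ _).hom ≫ (c a).hom)

/-- The same descent, with the conditions `s` and `t` of `Triv` as transition maps. Around `2 e₂ =
0` the two signs multiply to `-1`, cancelling the minus sign of `xiIso_hom`; the two generators
commute by `betaIso_Q_comp`. -/
lemma exists_triv {Y : B.carrier} (c₀ : U.objVal 0 ≅ Y)
    (hc₀ : c₀.hom ∈ homog k (U.objVal 0) Y 0) : ∃ c : Triv U Y, c.c 0 = c₀ := by
  obtain ⟨f, hf0, hf₁, hf₂⟩ := exists_descent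
    (P := fun a => {c : U.objVal a ≅ Y // c.hom ∈ homog k (U.objVal a) Y a})
    (fun {a b} h =>
      { toFun := fun c => ⟨(U.sVal h).symm ≪≫ B.σ _ ≪≫ c.1, homog_congr (by rw [← h]; ext <;> simp [add_comm]) (GradedSupercategory.comp_mem (inv_mem _ (U.sVal_mem h))
            (GradedSupercategory.comp_mem (B.hσ.mem _) c.2))⟩
        invFun := fun c => ⟨(B.σ _).symm ≪≫ U.sVal h ≪≫ c.1, homog_congr (by rw [← h]; ext <;> simp [add_comm]) (GradedSupercategory.comp_mem (inv_mem _ (B.hσ.mem _))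
            (GradedSupercategory.comp_mem (U.sVal_mem h) c.2))⟩
        left_inv := fun c => Subtype.ext (Iso.ext (by simp))
        right_inv := fun c => Subtype.ext (Iso.ext (by simp)) })
    (fun {a b} h c => ⟨sgnIso a.2 ((U.tVal h).symm ≪≫ B.ζ _ ≪≫ c.1), zsmul_mem (homog_congr (by rw [← h]; ext <;> simp [add_comm]) (GradedSupercategory.comp_mem (inv_mem _ (U.tVal_mem h))
        (GradedSupercategory.comp_mem (B.hζ.mem _) c.2))) _⟩)
    (fun {a b} h h' c => Subtype.ext (Iso.ext (by
      have h1 := U.tVal_tVal h h'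
      have h2 := map_ζ_even B (U.tVal_mem h)
      have h3 : sgn b.2 * sgn a.2 = -1 := by
        rw [sgn_of_add_e₂ h, neg_mul, sgn_mul_self]
      rw [xiIso_hom] at h1
      rw [← cancel_epi (U.tVal h').hom, ← cancel_epi (B.P.map (U.tVal h).hom)]
      simp [sgnIso, smul_smul, h3, reassoc_of% h1, reassoc_of% h2])))
    (fun {a b a' b'} h h' l l' c => Subtype.ext (Iso.ext (by
      have h1 := U.sVal_tVal h h' l l'
      have h2 := map_ζ_even B (U.sVal_mem h)
      have h3 := betaIso_Q_comp B (U.objVal a)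
      have h4 : a.2 = b.2 := by rw [← h]; simp
      rw [← cancel_epi (U.tVal l').hom, ← cancel_epi (B.P.map (U.sVal h).hom), reassoc_of% h1]
      simp [sgnIso, h4, map_σ_assoc, reassoc_of% h2, reassoc_of% h3]))) ⟨c₀, hc₀⟩
  refine ⟨⟨fun a => (f a).1, fun a => (f a).2, fun h => ?_, fun {a b} h => ?_⟩,
    congrArg Subtype.val hf0⟩
  · rw [← hf₁ h]; simp
  · rw [← hf₂ h]; simp [sgnIso]

lemma Triv.conj_mem {X Y : B.carrier} (cU : Triv U X) (cV : Triv V Y) {i : Deg} {f : X ⟶ Y}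
    (hf : f ∈ homog k X Y i) {a b : Deg} (h : a + i = b) :
    (cU.c a).hom ≫ f ≫ (cV.c b).inv ∈ homog k (U.objVal a) (V.objVal b) 0 :=
  homog_congr (by rw [← h]; abel) (GradedSupercategory.comp_mem (cU.mem a)
    (GradedSupercategory.comp_mem hf (inv_mem _ (cV.mem b))))

/-- A homogeneous morphism gives a morphism of trivialized shift families. -/
lemma exists_matrix {X Y : B.carrier} (cU : Triv U X) (cV : Triv V Y) {i : Deg} {f : X ⟶ Y}
    (hf : f ∈ homog k X Y i) : ∃ g : hom U V i, ∀ {a b : Deg} (h : a + i = b),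
      g.1 a b = E.mk _ (Triv.conj_mem cU cV hf h) := by
  refine ⟨homMkVal (fun a b => (cU.c a).hom ≫ f ≫ (cV.c b).inv)
    (fun a b h => Triv.conj_mem cU cV hf h) ?_ ?_, fun h => E.hom_ext
      (val_homMkVal_apply h)⟩
  · intro a b a' b' h h' l l'
    have h1 := cU.s h
    rw [← cancel_mono (cV.c b').hom]
    simp [cV.s h', map_σ, map_σ_assoc, reassoc_of% h1]
  · intro a b a' b' h h' l l'
    have h1 := map_ζ_even B (Triv.conj_mem cU cV hf l)
    have h2 := cU.t h
    rw [← cancel_mono (cV.c b').hom, Category.assoc, cV.t h', Preadditive.comp_zsmul,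
      reassoc_of% h1, Preadditive.zsmul_comp]
    -- The sign of `a + i` from the trivialization of `V` equals the sign of `i` times that of `a`
    -- from the trivialization of `U`.
    simp [reassoc_of% h2, smul_smul, ← l, sgn_add, mul_comm]

end ShiftFamily

end Trivialization

/-! ## Lifting `(Q, Π)`-functors between underlying categories to graded superfunctors -/

section Lift

variable {k : Type w} [CommRing k] {A B : QPSupercat.{w, v, u} k}

open ShiftFamily

/-- The shift family of an object of a graded supercategory. -/
def fam (X : A.carrier) : ShiftFamily (E.obj A) := (E.obj A).family (E.of X)

/-- The component of index `0` of the shift family of an object. -/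
def famZero (X : A.carrier) : (fam X).obj 0 ≅ E.of X := Iso.refl _

lemma exists_famTriv (X : A.carrier) : ∃ c : Triv (fam X) X, c.c 0 = E.valIso (famZero X) :=
  exists_triv _ (E.valIso_mem (famZero X))

/-- The trivialization of the shift family of an object. -/
def famTriv (X : A.carrier) : Triv (fam X) X := (exists_famTriv X).choose

lemma famTriv_zero (X : A.carrier) : (famTriv X).c 0 = E.valIso (famZero X) :=
  (exists_famTriv X).choose_spec

variable (F : QPFunctor (E.obj A) (E.obj B))

lemma exists_imgTriv (X : A.carrier) :
    ∃ c : Triv (F.mapFamily (fam X)) (E.as (F.functor.obj (E.of X))),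
      c.c 0 = E.valIso (F.functor.mapIso (famZero X)) :=
  exists_triv _ (E.valIso_mem (F.functor.mapIso (famZero X)))

/-- The trivialization of the image of the shift family of an object. -/
def imgTriv (X : A.carrier) : Triv (F.mapFamily (fam X)) (E.as (F.functor.obj (E.of X))) :=
  (exists_imgTriv F X).choose

lemma imgTriv_zero (X : A.carrier) :
    (imgTriv F X).c 0 = E.valIso (F.functor.mapIso (famZero X)) :=
  (exists_imgTriv F X).choose_spec

/-- The components of the trivialization of the image of the shift family of an object. -/
def imgIso (X : A.carrier) (a : Deg) :
    E.as (F.functor.obj ((fam X).obj a)) ≅ E.as (F.functor.obj (E.of X)) :=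
  (imgTriv F X).c a

lemma imgIso_mem (X : A.carrier) (a : Deg) : (imgIso F X a).hom ∈ homog k _ _ a :=
  (imgTriv F X).mem a

lemma imgIso_zero (X : A.carrier) :
    imgIso F X 0 = E.valIso (F.functor.mapIso (famZero X)) := imgTriv_zero F X

lemma comp_inv_mem {X Y : A.carrier} {i : Deg} {f : X ⟶ Y} (hf : f ∈ homog k X Y i) :
    f ≫ ((famTriv Y).c i).inv ∈ homog k (E.as (E.of X)) ((fam Y).objVal i) 0 :=
  homog_congr (add_neg_cancel i) (GradedSupercategory.comp_mem hf (inv_mem _ ((famTriv Y).mem i)))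

/-- The action of the lift of a `(Q, Π)`-functor on homogeneous morphisms. -/
def liftMap (X Y : A.carrier) (i : Deg) : homog k X Y i →ₗ[k]
    (E.as (F.functor.obj (E.of X)) ⟶ E.as (F.functor.obj (E.of Y))) where
  -- Composing with `c_i⁻¹` makes `f` even of degree zero, so that `F` applies; the trivialization
  -- of the image restores the bidegree.
  toFun f := E.val (F.functor.map (E.mk (X := E.of X) (Y := (fam Y).obj i) _ (comp_inv_mem f.2))) ≫
    (imgIso F Y i).hom
  map_add' f g := by
    have h : E.mk (X := E.of X) (Y := (fam Y).obj i) _ (comp_inv_mem (f + g).2) =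
        E.mk _ (comp_inv_mem f.2) + E.mk _ (comp_inv_mem g.2) :=
      E.hom_ext (Preadditive.add_comp _ _ _ _ _ _)
    have := F.additive
    rw [h, Functor.map_add]
    exact Preadditive.add_comp _ _ _ _ _ _
  map_smul' r f := by
    have h : E.mk (X := E.of X) (Y := (fam Y).obj i) _ (comp_inv_mem (r • f).2) =
        r • E.mk _ (comp_inv_mem f.2) :=
      E.hom_ext (Linear.smul_comp _ _ _ _ _ _)
    have := F.linear
    rw [h, Functor.map_smul]
    exact Linear.smul_comp _ _ _ _ _ _

lemma liftMap_apply {X Y : A.carrier} {i : Deg} {f : X ⟶ Y} (hf : f ∈ homog k X Y i) :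
    liftMap F X Y i ⟨f, hf⟩ =
      E.val (F.functor.map (E.mk (X := E.of X) (Y := (fam Y).obj i) _ (comp_inv_mem hf))) ≫
        (imgIso F Y i).hom := rfl

lemma liftMap_mem {X Y : A.carrier} {i : Deg} (f : homog k X Y i) :
    liftMap F X Y i f ∈ homog k _ _ i :=
  homog_congr (zero_add i) (GradedSupercategory.comp_mem (E.val_mem _) (imgIso_mem F Y i))

/-- Extends the defining formula of the lift from index `0` to every index. The `F`-image of the
matrix of `f` and the matrix of the lifted `f` are morphisms of shift families with the same
component at `(0, i)`, hence equal. -/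
lemma val_map_conj {X Y : A.carrier} {i : Deg} {f : X ⟶ Y} (hf : f ∈ homog k X Y i) {a b : Deg}
    (h : a + i = b) :
    E.val (F.functor.map (E.mk (X := (fam X).obj a) (Y := (fam Y).obj b) _
      (Triv.conj_mem (famTriv X) (famTriv Y) hf h))) ≫ (imgIso F Y b).hom =
        (imgIso F X a).hom ≫ liftMap F X Y i ⟨f, hf⟩ := by
  obtain ⟨g, hg⟩ := exists_matrix (famTriv X) (famTriv Y) hf
  obtain ⟨g', hg'⟩ := exists_matrix (imgTriv F X) (imgTriv F Y) (liftMap_mem F ⟨f, hf⟩)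
  have hg₀ : ∀ {a b : Deg} (h : a + i = b), E.val (X := F.functor.obj ((fam X).obj a))
      (Y := F.functor.obj ((fam Y).obj b)) (g'.1 a b) =
        (imgIso F X a).hom ≫ liftMap F X Y i ⟨f, hf⟩ ≫ (imgIso F Y b).inv :=
    fun h => congrArg (E.val (X := F.functor.obj ((fam X).obj _))
      (Y := F.functor.obj ((fam Y).obj _))) (hg' h)
  have key : F.mapHom g = g' := by
    refine ShiftFamily.hom_ext (E.hom_ext ?_)
    have h1 : E.mk (X := (fam X).obj 0) (Y := (fam Y).obj i) _
        (Triv.conj_mem (famTriv X) (famTriv Y) hf (zero_add i)) =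
        (famZero X).hom ≫ E.mk (X := E.of X) (Y := (fam Y).obj i) _ (comp_inv_mem hf) :=
      E.hom_ext (by rw [E.val_mk, famTriv_zero]; rfl)
    have h2 : E.val (F.functor.map (g.1 0 i)) =
        (imgIso F X 0).hom ≫ liftMap F X Y i ⟨f, hf⟩ ≫ (imgIso F Y i).inv := by
      rw [hg (zero_add i), h1, F.functor.map_comp, E.val_comp, liftMap_apply, imgIso_zero]
      simp [E.valIso]
    exact h2.trans (hg₀ (zero_add i)).symm
  have h1 : E.val (F.functor.map (g.1 a b)) =
      (imgIso F X a).hom ≫ liftMap F X Y i ⟨f, hf⟩ ≫ (imgIso F Y b).inv :=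
    (congrArg (fun e => E.val (X := F.functor.obj ((fam X).obj a))
      (Y := F.functor.obj ((fam Y).obj b)) (e.1 a b)) key).trans (hg₀ h)
  rw [← hg h, h1]
  simp

lemma liftMap_id (X : A.carrier) :
    liftMap F X X 0 ⟨𝟙 X, GradedSupercategory.id_mem X⟩ = 𝟙 _ := by
  have h : E.mk (X := E.of X) (Y := (fam X).obj 0) _
      (comp_inv_mem (GradedSupercategory.id_mem (k := k) X)) = (famZero X).inv :=
    E.hom_ext (by rw [E.val_mk, famTriv_zero]; exact Category.id_comp _)
  rw [liftMap_apply, h, imgIso_zero]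
  exact (E.valIso (F.functor.mapIso (famZero X))).inv_hom_id

/-- Write `f ≫ g ≫ c⁻¹` as `(f ≫ c_i⁻¹) ≫ (c_i ≫ g ≫ c⁻¹)` with `c` of index `i + j`, and apply
`val_map_conj` at index `i` to the second factor. -/
lemma liftMap_comp {X Y Z : A.carrier} {i j : Deg} (f : X ⟶ Y) (hf : f ∈ homog k X Y i)
    (g : Y ⟶ Z) (hg : g ∈ homog k Y Z j) :
    liftMap F X Z (i + j) ⟨f ≫ g, GradedSupercategory.comp_mem hf hg⟩ =
      liftMap F X Y i ⟨f, hf⟩ ≫ liftMap F Y Z j ⟨g, hg⟩ := by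
  have h : E.mk (X := E.of X) (Y := (fam Z).obj (i + j)) _
      (comp_inv_mem (GradedSupercategory.comp_mem hf hg)) =
      E.mk (X := E.of X) (Y := (fam Y).obj i) _ (comp_inv_mem hf) ≫
        E.mk (X := (fam Y).obj i) (Y := (fam Z).obj (i + j)) _
          (Triv.conj_mem (famTriv Y) (famTriv Z) hg rfl) :=
    E.hom_ext (by simp)
  rw [liftMap_apply, h, F.functor.map_comp, E.val_comp, Category.assoc, val_map_conj F hg rfl,
    liftMap_apply F hf, Category.assoc]

/-- The graded superfunctor given by a `(Q, Π)`-functor between underlying categories. -/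
def lift : GSFunctor A B where
  functor := functorOfHomog (fun X => E.as (F.functor.obj (E.of X))) (liftMap F) (liftMap_id F)
    (liftMap_comp F)
  isSuper := isGradedSuperfunctor_functorOfHomog fun _ _ _ _ => liftMap_mem F _

lemma lift_map {X Y : A.carrier} {i : Deg} {f : X ⟶ Y} (hf : f ∈ homog k X Y i) :
    (lift F).functor.map f = liftMap F X Y i ⟨f, hf⟩ :=
  functorOfHomog_map (hid := liftMap_id F) (hcomp := liftMap_comp F) hf

lemma lift_map_val {X Y : A.carrier} (f : E.of X ⟶ E.of Y) :
    (lift F).functor.map (E.val f) = E.val (F.functor.map f) := by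
  have h : E.mk (X := E.of X) (Y := (fam Y).obj 0) _ (comp_inv_mem (E.val_mem f)) =
      f ≫ (famZero Y).inv :=
    E.hom_ext (by rw [E.val_mk, famTriv_zero]; rfl)
  refine (lift_map F (E.val_mem f)).trans ?_
  rw [liftMap_apply, h, imgIso_zero, F.functor.map_comp, E.val_comp, Category.assoc]
  exact (congrArg _ (E.valIso (F.functor.mapIso (famZero Y))).inv_hom_id).trans (Category.comp_id _)

lemma lift_map_triv (X : A.carrier) (a : Deg) :
    (lift F).functor.map ((famTriv X).c a).hom = (imgIso F X a).hom := by
  have h : E.mk (X := E.of ((fam X).objVal a)) (Y := (fam X).obj a) _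
      (comp_inv_mem ((famTriv X).mem a)) = 𝟙 ((fam X).obj a) :=
    E.hom_ext (Iso.hom_inv_id _)
  refine (lift_map F ((famTriv X).mem a)).trans ?_
  refine (congrArg (fun e => E.val (F.functor.map e) ≫ (imgIso F X a).hom) h).trans ?_
  refine Eq.trans ?_ (Category.id_comp _)
  exact congrArg (fun e => E.val e ≫ (imgIso F X a).hom) (F.functor.map_id _)

lemma lift_map_val' {X Y : (E.obj A).carrier} (f : X ⟶ Y) :
    (lift F).functor.map (E.val f) = E.val (F.functor.map f) :=
  lift_map_val F (X := E.as X) (Y := E.as Y) f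

/-! ### Compatibility of the lift with `β` and `γ` -/

/-- The isomorphism `β_F` in the graded supercategory. -/
def betaVal (X : A.carrier) :
    B.P.obj ((lift F).functor.obj X) ⟶ (lift F).functor.obj (A.P.obj X) :=
  E.val (F.β.hom.app (E.of X))

/-- The isomorphism `γ_F` in the graded supercategory. -/
def gammaVal (X : A.carrier) :
    B.Q.obj ((lift F).functor.obj X) ⟶ (lift F).functor.obj (A.Q.obj X) :=
  E.val (F.γ.hom.app (E.of X))

/-- Condition `t` of the image trivialization at the even index `0`, where the sign is one; the
structure map of the image family is `β_F` followed by `F t`. -/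
lemma betaVal_map_tVal (X : A.carrier) :
    betaVal F ((fam X).objVal 0) ≫ (lift F).functor.map ((fam X).tVal (zero_add e₂)).hom ≫
      (lift F).functor.map ((famTriv X).c e₂).hom =
    (B.ζ ((lift F).functor.obj ((fam X).objVal 0))).hom ≫
      (lift F).functor.map ((famTriv X).c 0).hom := by
  have h := (imgTriv F X).t (zero_add e₂)
  have h' : (lift F).functor.map ((fam X).tVal (zero_add e₂)).hom =
    E.val (F.functor.map ((fam X).t (zero_add e₂)).hom) := lift_map_val' F _
  rw [lift_map_triv, lift_map_triv, h']
  exact (Category.assoc _ _ _).symm.trans (h.trans (one_smul _ _))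

lemma gammaVal_map_sVal (X : A.carrier) :
    gammaVal F ((fam X).objVal 0) ≫ (lift F).functor.map ((fam X).sVal (neg_add_cancel e₁)).hom ≫
      (lift F).functor.map ((famTriv X).c (-e₁)).hom =
    (B.σ ((lift F).functor.obj ((fam X).objVal 0))).hom ≫
      (lift F).functor.map ((famTriv X).c 0).hom := by
  have h := (imgTriv F X).s (neg_add_cancel e₁)
  have h' : (lift F).functor.map ((fam X).sVal (neg_add_cancel e₁)).hom =
    E.val (F.functor.map ((fam X).s (neg_add_cancel e₁)).hom) := lift_map_val' F _
  rw [lift_map_triv, lift_map_triv, h']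
  exact (Category.assoc _ _ _).symm.trans h

lemma betaVal_map_ζ (X : A.carrier) : betaVal F X ≫ (lift F).functor.map (A.ζ X).hom =
    (B.ζ ((lift F).functor.obj X)).hom := by
  have key : betaVal F ((fam X).objVal 0) ≫ (lift F).functor.map (A.ζ ((fam X).objVal 0)).hom =
      (B.ζ ((lift F).functor.obj ((fam X).objVal 0))).hom := by
    rw [← cancel_mono ((lift F).functor.map ((famTriv X).c 0).hom), ← betaVal_map_tVal,
      ← Functor.map_comp, (famTriv X).t (zero_add e₂)]
    simp
  -- The object of index `0` in the family of `X` is definitionally `X`.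
  exact key

lemma gammaVal_map_σ (X : A.carrier) : gammaVal F X ≫ (lift F).functor.map (A.σ X).hom =
    (B.σ ((lift F).functor.obj X)).hom := by
  have key : gammaVal F ((fam X).objVal 0) ≫ (lift F).functor.map (A.σ ((fam X).objVal 0)).hom =
      (B.σ ((lift F).functor.obj ((fam X).objVal 0))).hom := by
    rw [← cancel_mono ((lift F).functor.map ((famTriv X).c 0).hom), ← gammaVal_map_sVal,
      ← Functor.map_comp, (famTriv X).s (neg_add_cancel e₁)]
    simp
  exact key

lemma betaIso_lift (X : A.carrier) : (betaIso (lift F).functor X).hom = betaVal F X := by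
  rw [betaIso_hom (lift F).isSuper, ← betaVal_map_ζ, Category.assoc, ← Functor.map_comp,
    Iso.hom_inv_id, CategoryTheory.Functor.map_id, Category.comp_id]

lemma gammaIso_lift (X : A.carrier) : (gammaIso (lift F).functor X).hom = gammaVal F X := by
  rw [gammaIso_hom, ← gammaVal_map_σ, Category.assoc, ← Functor.map_comp,
    Iso.hom_inv_id, CategoryTheory.Functor.map_id, Category.comp_id]

/-- The lift agrees with `F` on even degree-zero morphisms, and its `β` and `γ` are those of `F`,
because it respects `ζ` and `σ` up to these isomorphisms. -/
lemma map_lift : E.map (lift F) = F :=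
  QPFunctor.ext_of_heq (CategoryTheory.Functor.ext (fun _ => rfl) fun _ _ f =>
    (E.hom_ext (f := (E.map (lift F)).functor.map f) (g := F.functor.map f)
      (lift_map_val' F f)).trans ((Category.id_comp _).trans (Category.comp_id _)).symm)
    (fun X => heq_of_eq (E.hom_ext (X := (E.obj B).P.obj (F.functor.obj X))
      (Y := F.functor.obj ((E.obj A).P.obj X)) (betaIso_lift F (E.as X))))
    (fun X => heq_of_eq (E.hom_ext (X := (E.obj B).Q.functor.obj (F.functor.obj X))
      (Y := F.functor.obj ((E.obj A).Q.functor.obj X)) (gammaIso_lift F (E.as X))))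

end Lift

/-! ## Graded `(Q, Π)`-supercategories are generated by even morphisms of degree zero, `ζ` and `σ` -/

section Generation

variable {k : Type w} [CommRing k]

open ShiftFamily

/-- A homogeneous `f` is `(f ≫ c_i⁻¹) ≫ c_i` with even degree-zero first factor, and the
trivialization `c` is assembled step by step from `ζ`, `σ`, their inverses and even degree-zero
morphisms. -/
lemma even_zeta_sigma_induction {A : QPSupercat.{w, v, u} k}
    (P : ∀ {X Y : A.carrier}, (X ⟶ Y) → Prop)
    (hadd : ∀ {X Y : A.carrier} (f g : X ⟶ Y), P f → P g → P (f + g))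
    (hcomp : ∀ {X Y Z : A.carrier} (f : X ⟶ Y) (g : Y ⟶ Z), P f → P g → P (f ≫ g))
    (hinv : ∀ {X Y : A.carrier} (e : X ≅ Y), P e.hom → P e.inv)
    (heven : ∀ {X Y : A.carrier} (f : X ⟶ Y), f ∈ homog k X Y 0 → P f)
    (hζ : ∀ X : A.carrier, P (A.ζ X).hom) (hσ : ∀ X : A.carrier, P (A.σ X).hom)
    {X Y : A.carrier} (f : X ⟶ Y) : P f := by
  have key : ∀ a, P ((famTriv Y).c a).hom := by
    refine deg_induction (heven _ ((famTriv Y).mem 0)) (fun {a b} h => ⟨fun hb => ?_, fun ha => ?_⟩)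
      (fun {a b} h ha => ?_)
    · have e : ((famTriv Y).c b).hom =
          ((fam Y).sVal h).inv ≫ (A.σ _).hom ≫ ((famTriv Y).c a).hom := by
        rw [← (famTriv Y).s h, Iso.inv_hom_id_assoc]
      rw [e]
      exact hcomp _ _ (hinv _ (heven _ ((fam Y).sVal_mem h))) (hcomp _ _ (hσ _) hb)
    · have e : ((famTriv Y).c a).hom =
          (A.σ _).inv ≫ ((fam Y).sVal h).hom ≫ ((famTriv Y).c b).hom := by
        rw [(famTriv Y).s h, Iso.inv_hom_id_assoc]
      rw [e]
      exact hcomp _ _ (hinv _ (hσ _)) (hcomp _ _ (heven _ ((fam Y).sVal_mem h)) ha)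
    · have e : ((famTriv Y).c b).hom =
          (sgn a.2 • ((fam Y).tVal h).inv) ≫ (A.ζ _).hom ≫ ((famTriv Y).c a).hom := by
        rw [Preadditive.zsmul_comp, ← Preadditive.comp_zsmul, ← (famTriv Y).t h,
          Iso.inv_hom_id_assoc]
      rw [e]
      refine hcomp _ _ (heven _ (zsmul_mem ?_ _)) (hcomp _ _ (hζ _) ha)
      exact homog_congr neg_zero (inv_mem _ ((fam Y).tVal_mem h))
  refine hom_induction (k := k) (P := P) (heven _ (zero_mem _)) hadd (fun i f hf => ?_) f
  have e : f = (f ≫ ((famTriv Y).c i).inv) ≫ ((famTriv Y).c i).hom := by simp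
  rw [e]
  exact hcomp _ _ (heven _ (comp_inv_mem hf)) (key i)

/-! ### Lifting transformations and injectivity of `E` on functors -/

variable {A B : QPSupercat.{w, v, u} k} {F G : GSFunctor A B}

/-- The components of a `(Q, Π)`-natural transformation between restrictions of graded
superfunctors. -/
def transVal (x : QPTrans (E.map F) (E.map G)) (X : A.carrier) :
    F.functor.obj X ⟶ G.functor.obj X :=
  E.val (x.trans.app (E.of X))

lemma transVal_mem (x : QPTrans (E.map F) (E.map G)) (X : A.carrier) :
    transVal x X ∈ homog k _ _ 0 :=
  E.val_mem (x.trans.app (E.of X))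

lemma transVal_naturality (x : QPTrans (E.map F) (E.map G)) {X Y : A.carrier} (f : X ⟶ Y) :
    F.functor.map f ≫ transVal x Y = transVal x X ≫ G.functor.map f := by
  have := F.isSuper.additive
  have := G.isSuper.additive
  have hinv : ∀ {X Y : A.carrier} (e : X ≅ Y),
      F.functor.map e.hom ≫ transVal x Y = transVal x X ≫ G.functor.map e.hom →
      F.functor.map e.inv ≫ transVal x X = transVal x Y ≫ G.functor.map e.inv := fun e h => by
    rw [← cancel_epi (F.functor.map e.hom), ← Functor.map_comp_assoc, Iso.hom_inv_id,
      reassoc_of% h, ← Functor.map_comp, Iso.hom_inv_id]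
    simp
  refine even_zeta_sigma_induction
    (P := fun {X Y} f => F.functor.map f ≫ transVal x Y = transVal x X ≫ G.functor.map f)
    (fun f g hf hg => by simp [hf, hg]) (fun f g hf hg => by simp [hg, reassoc_of% hf]) hinv
    (fun {X Y} f hf => congrArg E.val
      (x.trans.naturality (E.mk (X := E.of X) (Y := E.of Y) f hf)))
    -- Since `β_F` is `ζ ≫ F ζ⁻¹`, compatibility with `β` is naturality for `ζ⁻¹`, from which that
    -- for `ζ` follows; likewise for `γ` and `σ`.
    (fun X => hinv (A.ζ X).symm ?_) (fun X => hinv (A.σ X).symm ?_) f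
  · have h : (betaIso F.functor X).hom ≫ transVal x (A.P.obj X) =
        B.P.map (transVal x X) ≫ (betaIso G.functor X).hom := congrArg E.val (x.comm_β (E.of X))
    rw [betaIso_hom F.isSuper, betaIso_hom G.isSuper, ← Category.assoc,
      map_ζ_even B (transVal_mem x X), Category.assoc, Category.assoc, cancel_epi] at h
    exact h
  · have h : (gammaIso F.functor X).hom ≫ transVal x (A.Q.obj X) =
        B.Q.map (transVal x X) ≫ (gammaIso G.functor X).hom := congrArg E.val (x.comm_γ (E.of X))
    rw [gammaIso_hom, gammaIso_hom, map_σ_assoc, Category.assoc, cancel_epi] at h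
    exact h

/-- The even supernatural transformation of degree zero given by a `(Q, Π)`-natural transformation
between restrictions of graded superfunctors. -/
def liftTrans (x : QPTrans (E.map F) (E.map G)) : GSTrans F G where
  app := transVal x
  isSupernatural := .of_natural (transVal_mem x) (transVal_naturality x)

lemma E.val_eqToHom {X Y : (E.obj B).carrier} (h : X = Y) :
    E.val (eqToHom h) = eqToHom (congrArg E.as h) := by
  subst h; rfl

/-- The cast between the restrictions is a `(Q, Π)`-natural transformation, hence natural for all
morphisms by `transVal_naturality`; its components being casts, the functors agree everywhere. -/
lemma map_injective (h : E.map F = E.map G) : F = G := by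
  have hf : (E.map F).functor = (E.map G).functor := congrArg QPFunctor.functor h
  have hobj : ∀ X, F.functor.obj X = G.functor.obj X := fun X =>
    congrArg (fun H => E.as (H.obj (E.of X))) hf
  have happ : ∀ X, transVal (eqToHom h : E.map F ⟶ E.map G) X = eqToHom (hobj X) := fun X =>
    (congrArg E.val (QPTrans.eqToHom_app h (E.of X))).trans (E.val_eqToHom _)
  refine GSFunctor.ext (CategoryTheory.Functor.ext hobj fun X Y f => ?_)
  have h' := transVal_naturality (eqToHom h : E.map F ⟶ E.map G) f
  rw [happ, happ] at h'
  rw [← reassoc_of% h']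
  simp

end Generation

/-! ## Equivalences of strict pseudofunctors -/

section Strict

open Bicategory

variable {B : Type u₁} [Bicategory.{w₁, v₁} B] [Bicategory.Strict B]
  {C : Type u₂} [Bicategory.{w₂, v₂} C] [Bicategory.Strict C]

/-- A strong transformation of strict pseudofunctors whose naturality isomorphisms are equalities. -/
def strictTrans (F G : StrictPseudofunctor B C) (app : ∀ a, F.obj a ⟶ G.obj a)
    (nat : ∀ {a b : B} (f : a ⟶ b), F.map f ≫ app b = app a ≫ G.map f)
    (nat₂ : ∀ {a b : B} {f g : a ⟶ b} (x : f ⟶ g),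
      F.map₂ x ▷ app b ≫ eqToHom (nat g) = eqToHom (nat f) ≫ app a ◁ G.map₂ x) :
    F.toPseudofunctor ⟶ G.toPseudofunctor :=
  Pseudofunctor.StrongTrans.mk app (fun f => eqToIso (nat f)) (fun x => nat₂ x)
    (fun a => by
      simp [F.mapId_eq_eqToIso, G.mapId_eq_eqToIso, Strict.leftUnitor_eqToIso,
        Strict.rightUnitor_eqToIso])
    (fun f g => by
      simp [F.mapComp_eq_eqToIso, G.mapComp_eq_eqToIso, Strict.associator_eqToIso])

/-- Strong transformations with equal components whose naturality isomorphisms are equalities are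
isomorphic. -/
def strongTransIso {F G : B ⥤ᵖ C} (η θ : F ⟶ G)
    (hη : ∀ {a b : B} (f : a ⟶ b), ∃ h, (η.naturality f).hom = eqToHom h)
    (hθ : ∀ {a b : B} (f : a ⟶ b), ∃ h, (θ.naturality f).hom = eqToHom h)
    (e : ∀ a, η.app a = θ.app a) : η ≅ θ :=
  Pseudofunctor.StrongTrans.isoMk (fun a => eqToIso (e a)) (fun f => by
    obtain ⟨_, h⟩ := hη f
    obtain ⟨_, h'⟩ := hθ f
    simp [h, h'])

lemma id_naturality_eq_eqToHom (F : B ⥤ᵖ C) {a b : B} (f : a ⟶ b) :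
    ∃ h, ((𝟙 F : F ⟶ F).naturality f).hom = eqToHom h :=
  ⟨_, by simp [Strict.leftUnitor_eqToIso, Strict.rightUnitor_eqToIso]; rfl⟩

/-- Associators of a strict 2-category and whiskerings of casts are casts, so strictness survives
composition. -/
lemma comp_naturality_eq_eqToHom {F G H : B ⥤ᵖ C} (η : F ⟶ G) (θ : G ⟶ H) {a b : B} (f : a ⟶ b)
    (hη : ∃ h, (η.naturality f).hom = eqToHom h) (hθ : ∃ h, (θ.naturality f).hom = eqToHom h) :
    ∃ h, ((η ≫ θ).naturality f).hom = eqToHom h := by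
  obtain ⟨e, h⟩ := hη
  obtain ⟨e', h'⟩ := hθ
  have e'' : F.map f ≫ η.app b ≫ θ.app b = (η.app a ≫ θ.app a) ≫ H.map f := by
    rw [← Strict.assoc, e, Strict.assoc, e', Strict.assoc]
  refine ⟨e'', ?_⟩
  rw [Pseudofunctor.StrongTrans.categoryStruct_comp_naturality_hom, h, h']
  simp only [Strict.associator_eqToIso, whiskerLeft_eqToHom, eqToHom_whiskerRight, eqToIso.hom,
    eqToIso.inv]
  erw [eqToHom_trans, eqToHom_trans, eqToHom_trans, eqToHom_trans]
  rfl

/-- Strict transformations inverse to each other give an equivalence. -/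
def equivalenceOfStrict (F G : StrictPseudofunctor B C) (app : ∀ a, F.obj a ⟶ G.obj a)
    (nat : ∀ {a b : B} (f : a ⟶ b), F.map f ≫ app b = app a ≫ G.map f)
    (nat₂ : ∀ {a b : B} {f g : a ⟶ b} (x : f ⟶ g),
      F.map₂ x ▷ app b ≫ eqToHom (nat g) = eqToHom (nat f) ≫ app a ◁ G.map₂ x)
    (app' : ∀ a, G.obj a ⟶ F.obj a)
    (nat' : ∀ {a b : B} (f : a ⟶ b), G.map f ≫ app' b = app' a ≫ F.map f)
    (nat₂' : ∀ {a b : B} {f g : a ⟶ b} (x : f ⟶ g),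
      G.map₂ x ▷ app' b ≫ eqToHom (nat' g) = eqToHom (nat' f) ≫ app' a ◁ F.map₂ x)
    (h : ∀ a, app a ≫ app' a = 𝟙 _) (h' : ∀ a, app' a ≫ app a = 𝟙 _) :
    F.toPseudofunctor ≌ G.toPseudofunctor :=
  Bicategory.Equivalence.mkOfAdjointifyCounit
    (f := strictTrans F G app nat nat₂) (g := strictTrans G F app' nat' nat₂')
    (strongTransIso _ _ (id_naturality_eq_eqToHom _)
      (fun f => comp_naturality_eq_eqToHom _ _ f ⟨nat f, rfl⟩ ⟨nat' f, rfl⟩) (fun a => (h a).symm))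
    (strongTransIso _ _
      (fun f => comp_naturality_eq_eqToHom _ _ f ⟨nat' f, rfl⟩ ⟨nat f, rfl⟩)
      (id_naturality_eq_eqToHom _) h')

end Strict

/-! ## The inverse 2-functor -/

section Inverse

variable {k : Type w} [CommRing k]

lemma GSTrans.eqToHom_app {A B : QPSupercat.{w, v, u} k} {F G : GSFunctor A B} (h : F = G) (X) :
    GSTrans.app (eqToHom h) X = eqToHom (by rw [h]) := by
  subst h; rfl

/-- The even supernatural transformation of degree zero between lifts given by a
`(Q, Π)`-natural transformation. -/
def liftMap₂ {A B : QPSupercat.{w, v, u} k} {F G : QPFunctor (E.obj A) (E.obj B)}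
    (x : F ⟶ G) : lift F ⟶ lift G :=
  -- The casts replace `F` and `G` by the restrictions of their lifts; they do not affect
  -- components, by `liftMap₂_app`.
  liftTrans (eqToHom (map_lift F) ≫ x ≫ eqToHom (map_lift G).symm)

lemma liftMap₂_app {A B : QPSupercat.{w, v, u} k} {F G : QPFunctor (E.obj A) (E.obj B)}
    (x : F ⟶ G) (X : A.carrier) :
    GSTrans.app (liftMap₂ x) X = E.val (x.trans.app (E.of X)) := by
  have h : (QPTrans.trans (eqToHom (map_lift F) ≫ x ≫ eqToHom (map_lift G).symm)).app (E.of X) =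
      x.trans.app (E.of X) := by
    erw [QPTrans.comp_trans, QPTrans.comp_trans, NatTrans.comp_app, NatTrans.comp_app,
      QPTrans.eqToHom_app, QPTrans.eqToHom_app]
    exact (Category.id_comp _).trans (Category.comp_id _)
  exact congrArg E.val h

variable {A B C : QPCat.{w, v, u} k}

/-- The action of the inverse 2-functor on functors. -/
def D.map (F : QPFunctor A B) : GSFunctor (D.obj A) (D.obj B) :=
  lift ((fromED A).comp (F.comp (toED B)))

/-- The action of the inverse 2-functor on natural transformations. -/
def D.map₂ {F G : QPFunctor A B} (x : F ⟶ G) : D.map F ⟶ D.map G :=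
  liftMap₂ (QPTrans.precomp (fromED A) (QPTrans.postcomp x (toED B)))

lemma D.map₂_app {F G : QPFunctor A B} (x : F ⟶ G) (X : (D.obj A).carrier) :
    GSTrans.app (D.map₂ x) X =
      E.val ((toED B).functor.map (x.trans.app ((fromED A).functor.obj (E.of X)))) :=
  liftMap₂_app _ X

lemma E.map_D_map (F : QPFunctor A B) :
    E.map (D.map F) = (fromED A).comp (F.comp (toED B)) := map_lift _

lemma QPFunctor.comp_assoc {A B C D : QPCat.{w, v, u} k} (F : QPFunctor A B) (G : QPFunctor B C)
    (H : QPFunctor C D) : (F.comp G).comp H = F.comp (G.comp H) :=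
  Bicategory.Strict.assoc (a := A) (b := B) (c := C) (d := D) F G H

lemma QPFunctor.id_comp (F : QPFunctor A B) : (QPFunctor.id A).comp F = F :=
  Bicategory.Strict.id_comp (a := A) (b := B) F

lemma QPFunctor.comp_id (F : QPFunctor A B) : F.comp (QPFunctor.id B) = F :=
  Bicategory.Strict.comp_id (a := A) (b := B) F

/-- By `map_injective` the laws for `D` may be checked after applying `E`, where `D F` becomes `F`
conjugated by the strictly inverse comparisons. -/
lemma D.map_id (A : QPCat.{w, v, u} k) : D.map (QPFunctor.id A) = GSFunctor.id (D.obj A) := by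
  apply map_injective
  rw [E.map_D_map, E.map_id]
  rw [QPFunctor.id_comp, fromED_comp_toED]

lemma toED_fromED_assoc (F : QPFunctor A B) : (toED A).comp ((fromED A).comp F) = F := by
  rw [← QPFunctor.comp_assoc, toED_comp_fromED, QPFunctor.id_comp]

lemma D.map_comp (F : QPFunctor A B) (G : QPFunctor B C) :
    D.map (F.comp G) = (D.map F).comp (D.map G) := by
  apply map_injective
  rw [E.map_comp, E.map_D_map, E.map_D_map, E.map_D_map]
  simp only [QPFunctor.comp_assoc, toED_fromED_assoc]

lemma GSTrans.eqToHom_comp_app {A B : QPSupercat.{w, v, u} k} {F F' G G' : GSFunctor A B}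
    (h : F = F') (x : F' ⟶ G') (h' : G' = G) (X : A.carrier) :
    GSTrans.app (eqToHom h ≫ x ≫ eqToHom h') X =
      eqToHom (by rw [h]) ≫ GSTrans.app x X ≫ eqToHom (by rw [h']) := by
  rw [GSTrans.comp_app, GSTrans.comp_app, GSTrans.eqToHom_app, GSTrans.eqToHom_app]

lemma D.map₂_precomp_app (F : QPFunctor A B) {G H : QPFunctor B C} (x : G ⟶ H)
    (X : (D.obj A).carrier) : GSTrans.app (D.map₂ (QPTrans.precomp F x)) X =
      GSTrans.app (D.map₂ x) ((D.map F).functor.obj X) :=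
  (D.map₂_app _ X).trans (D.map₂_app x ((D.map F).functor.obj X)).symm

lemma fromED_map_toED_map {X Y : A.carrier} (f : X ⟶ Y) :
    (fromED A).functor.map ((toED A).functor.map f) = f :=
  fromUnderlying_map_eq (X := .of (.of X)) (Y := .of (.of Y)) rfl

lemma D.map₂_postcomp_app {F G : QPFunctor A B} (x : F ⟶ G) (H : QPFunctor B C)
    (X : (D.obj A).carrier) : GSTrans.app (D.map₂ (QPTrans.postcomp x H)) X =
      (D.map H).functor.map (GSTrans.app (D.map₂ x) X) := by
  rw [D.map₂_app, D.map₂_app]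
  refine Eq.trans ?_ (lift_map_val' _ _).symm
  exact congrArg (fun e => E.val ((toED C).functor.map (H.functor.map e)))
    (fromED_map_toED_map (x.trans.app ((fromED A).functor.obj (E.of X)))).symm

variable (k) in
/-- The strict 2-functor from `(Q, Π)`-categories to graded `(Q, Π)`-supercategories. -/
def D : StrictPseudofunctor (QPCat.{w, v, u} k) (QPSupercat.{w, v, u} k) :=
  StrictPseudofunctor.mk''
    { obj := D.obj
      map := D.map
      map₂ := D.map₂
      map₂_id := fun {A B} F => GSTrans.hom_ext fun X => by
        rw [D.map₂_app]
        exact congrArg E.val ((toED B).functor.map_id _)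
      map₂_comp := fun {A B _ _ _} x y => GSTrans.hom_ext fun X => by
        rw [D.map₂_app]
        refine (congrArg E.val ((toED B).functor.map_comp _ _)).trans ?_
        rw [GSTrans.comp_app, D.map₂_app, D.map₂_app]
        rfl
      map_id := D.map_id
      map_comp := D.map_comp
      map₂_whisker_left := fun F G H x => GSTrans.hom_ext fun X =>
        (D.map₂_precomp_app F x X).trans (((Category.id_comp _).trans
          (Category.comp_id _)).symm.trans (GSTrans.eqToHom_comp_app (D.map_comp F G)
            (GSTrans.precomp (D.map F) (D.map₂ x)) (D.map_comp F H).symm X).symm)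
      map₂_whisker_right := fun x H => GSTrans.hom_ext fun X =>
        (D.map₂_postcomp_app x H X).trans (((Category.id_comp _).trans
          (Category.comp_id _)).symm.trans (GSTrans.eqToHom_comp_app (D.map_comp _ H)
            (GSTrans.postcomp (D.map₂ x) (D.map H)) (D.map_comp _ H).symm X).symm) }

end Inverse

/-! ## The 2-equivalence -/

section TwoEquivalence

variable {k : Type w} [CommRing k]

/-- Reduces strict naturality in 2-cells to a comparison of components, heterogeneous because the
functors are only provably equal. -/
lemma QPTrans.eqToHom_comm {A B : QPCat.{w, v, u} k} {F F' G G' : QPFunctor A B}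
    (x : F ⟶ G) (y : F' ⟶ G') (h : F = F') (h' : G = G')
    (e : ∀ X, x.trans.app X ≍ y.trans.app X) : x ≫ eqToHom h' = eqToHom h ≫ y := by
  subst h h'
  exact QPTrans.hom_ext fun X => by simpa using eq_of_heq (e X)

lemma GSTrans.eqToHom_comm {A B : QPSupercat.{w, v, u} k} {F F' G G' : GSFunctor A B}
    (x : F ⟶ G) (y : F' ⟶ G') (h : F = F') (h' : G = G')
    (e : ∀ X, GSTrans.app x X ≍ GSTrans.app y X) : x ≫ eqToHom h' = eqToHom h ≫ y := by
  subst h h'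
  exact GSTrans.hom_ext fun X => by simpa using eq_of_heq (e X)

lemma E_D_naturality {A B : QPCat.{w, v, u} k} (F : QPFunctor A B) :
    (E.map (D.map F)).comp (fromED B) = (fromED A).comp F := by
  rw [E.map_D_map, QPFunctor.comp_assoc, QPFunctor.comp_assoc, toED_comp_fromED,
    QPFunctor.comp_id]

lemma E_D_naturality' {A B : QPCat.{w, v, u} k} (F : QPFunctor A B) :
    F.comp (toED B) = (toED A).comp (E.map (D.map F)) := by
  rw [E.map_D_map, toED_fromED_assoc]

/-- The comparison of graded `(Q, Π)`-supercategories. -/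
def fromDE (A : QPSupercat.{w, v, u} k) : GSFunctor (D.obj (E.obj A)) A := lift (fromED (E.obj A))

/-- The comparison of graded `(Q, Π)`-supercategories, in the other direction. -/
def toDE (A : QPSupercat.{w, v, u} k) : GSFunctor A (D.obj (E.obj A)) := lift (toED (E.obj A))

/-- After `E`, the lifts become the comparisons for the `(Q, Π)`-category `E A`, already known to be
inverse to each other. -/
lemma toDE_comp_fromDE (A : QPSupercat.{w, v, u} k) :
    (toDE A).comp (fromDE A) = GSFunctor.id A := by
  apply map_injective
  rw [E.map_comp, toDE, fromDE, map_lift, map_lift, toED_comp_fromED, E.map_id]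

lemma fromDE_comp_toDE (A : QPSupercat.{w, v, u} k) :
    (fromDE A).comp (toDE A) = GSFunctor.id (D.obj (E.obj A)) := by
  apply map_injective
  rw [E.map_comp, toDE, fromDE, map_lift, map_lift, fromED_comp_toED, E.map_id]

lemma D_E_naturality {A B : QPSupercat.{w, v, u} k} (F : GSFunctor A B) :
    (D.map (E.map F)).comp (fromDE B) = (fromDE A).comp F := by
  apply map_injective
  rw [E.map_comp, E.map_comp, fromDE, fromDE, map_lift, map_lift, E_D_naturality]

lemma D_E_naturality' {A B : QPSupercat.{w, v, u} k} (F : GSFunctor A B) :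
    F.comp (toDE B) = (toDE A).comp (D.map (E.map F)) := by
  apply map_injective
  rw [E.map_comp, E.map_comp, toDE, toDE, map_lift, map_lift, E_D_naturality']

/-- The components of `E (D x)` are images of those of `x` under `toED`, which `fromED` undoes. -/
lemma fromED_map₂ {A B : QPCat.{w, v, u} k} {F G : QPFunctor A B} (x : F ⟶ G)
    (X : (E.obj (D.obj A)).carrier) :
    (fromED B).functor.map ((QPTrans.trans (E.map₂ (D.map₂ x))).app X) =
      x.trans.app ((fromED A).functor.obj X) := by
  have h : (QPTrans.trans (E.map₂ (D.map₂ x))).app X =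
      (toED B).functor.map (x.trans.app ((fromED A).functor.obj X)) :=
    E.hom_ext (D.map₂_app x (E.as X))
  exact (congrArg _ h).trans (fromED_map_toED_map _)

lemma E_D_naturality₂ {A B : QPCat.{w, v, u} k} {F G : QPFunctor A B} (x : F ⟶ G) :
    QPTrans.postcomp (E.map₂ (D.map₂ x)) (fromED B) ≫ eqToHom (E_D_naturality G) =
      eqToHom (E_D_naturality F) ≫ QPTrans.precomp (fromED A) x :=
  QPTrans.eqToHom_comm _ _ _ _ fun X => heq_of_eq (fromED_map₂ x X)

lemma toED_map₂ {A B : QPCat.{w, v, u} k} {F G : QPFunctor A B} (x : F ⟶ G) (X : A.carrier) :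
    (toED B).functor.map (x.trans.app X) =
      (QPTrans.trans (E.map₂ (D.map₂ x))).app ((toED A).functor.obj X) :=
  E.hom_ext (D.map₂_app x (E.as ((toED A).functor.obj X))).symm

lemma E_D_naturality₂' {A B : QPCat.{w, v, u} k} {F G : QPFunctor A B} (x : F ⟶ G) :
    QPTrans.postcomp x (toED B) ≫ eqToHom (E_D_naturality' G) =
      eqToHom (E_D_naturality' F) ≫ QPTrans.precomp (toED A) (E.map₂ (D.map₂ x)) :=
  QPTrans.eqToHom_comm _ _ _ _ fun X => heq_of_eq (toED_map₂ x X)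

/-- The composite of the two 2-functors is equivalent to the identity on `(Q, Π)`-categories. -/
def counitEquivalence : (StrictPseudofunctor.comp (D.{w, v, u} k) (E k)).toPseudofunctor ≌
    (StrictPseudofunctor.id (QPCat.{w, v, u} k)).toPseudofunctor :=
  equivalenceOfStrict (StrictPseudofunctor.comp (D.{w, v, u} k) (E k))
    (StrictPseudofunctor.id (QPCat.{w, v, u} k)) fromED E_D_naturality E_D_naturality₂
    toED E_D_naturality' E_D_naturality₂' fromED_comp_toED toED_comp_fromED

lemma fromDE_map₂ {A B : QPSupercat.{w, v, u} k} {F G : GSFunctor A B} (x : F ⟶ G)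
    (X : (D.obj (E.obj A)).carrier) :
    (fromDE B).functor.map (GSTrans.app (D.map₂ (E.map₂ x)) X) =
      GSTrans.app x ((fromDE A).functor.obj X) := by
  rw [D.map₂_app]
  refine (lift_map_val' _ _).trans ?_
  exact congrArg E.val (fromED_map_toED_map _)

lemma toDE_map₂ {A B : QPSupercat.{w, v, u} k} {F G : GSFunctor A B} (x : F ⟶ G)
    (X : A.carrier) :
    (toDE B).functor.map (GSTrans.app x X) =
      GSTrans.app (D.map₂ (E.map₂ x)) ((toDE A).functor.obj X) :=
  (lift_map_val' (toED (E.obj B)) ((QPTrans.trans (E.map₂ x)).app (E.of X))).trans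
    (D.map₂_app (E.map₂ x) ((toDE A).functor.obj X)).symm

lemma D_E_naturality₂ {A B : QPSupercat.{w, v, u} k} {F G : GSFunctor A B} (x : F ⟶ G) :
    GSTrans.postcomp (D.map₂ (E.map₂ x)) (fromDE B) ≫ eqToHom (D_E_naturality G) =
      eqToHom (D_E_naturality F) ≫ GSTrans.precomp (fromDE A) x :=
  GSTrans.eqToHom_comm _ _ _ _ fun X => heq_of_eq (fromDE_map₂ x X)

lemma D_E_naturality₂' {A B : QPSupercat.{w, v, u} k} {F G : GSFunctor A B} (x : F ⟶ G) :
    GSTrans.postcomp x (toDE B) ≫ eqToHom (D_E_naturality' G) =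
      eqToHom (D_E_naturality' F) ≫ GSTrans.precomp (toDE A) (D.map₂ (E.map₂ x)) :=
  GSTrans.eqToHom_comm _ _ _ _ fun X => heq_of_eq (toDE_map₂ x X)

attribute [local irreducible] lift D.map D.map₂ E.map E.map₂ fromED toED fromDE toDE E.obj

/-- The composite of the two 2-functors is equivalent to the identity on graded
`(Q, Π)`-supercategories. -/
def unitEquivalence : (StrictPseudofunctor.comp (E.{w, v, u} k) (D k)).toPseudofunctor ≌
    (StrictPseudofunctor.id (QPSupercat.{w, v, u} k)).toPseudofunctor :=
  equivalenceOfStrict (StrictPseudofunctor.comp (E.{w, v, u} k) (D k))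
    (StrictPseudofunctor.id (QPSupercat.{w, v, u} k)) fromDE D_E_naturality D_E_naturality₂
    toDE D_E_naturality' D_E_naturality₂' fromDE_comp_toDE toDE_comp_fromDE

end TwoEquivalence

/-- Strict 2-functors inverse to each other up to equivalence are 2-equivalences. -/
lemma isTwoEquivalence_of_strict {B : Type u₁} [Bicategory.{w₁, v₁} B] [Bicategory.Strict B]
    {C : Type u₂} [Bicategory.{w₂, v₂} C] [Bicategory.Strict C]
    (F : StrictPseudofunctor B C) (G : StrictPseudofunctor C B)
    (e : (StrictPseudofunctor.comp G F).toPseudofunctor ≌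
      (StrictPseudofunctor.id C).toPseudofunctor)
    (e' : (StrictPseudofunctor.comp F G).toPseudofunctor ≌
      (StrictPseudofunctor.id B).toPseudofunctor) : IsTwoEquivalence F.toPseudofunctor :=
  ⟨G.toPseudofunctor, ⟨e⟩, ⟨e'⟩⟩

end

end QPi

theorem mainTheorem9 (k : Type w) [CommRing k] :
    QPi.IsTwoEquivalence (QPi.E.{w, v, u} k).toPseudofunctor :=
  QPi.isTwoEquivalence_of_strict (QPi.E k) (QPi.D k) QPi.counitEquivalence QPi.unitEquivalence
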